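/- Let $R>0$, $\mathcal E=(-\infty,-R)\cup(R,\infty)$ and $\mathbb H^n=H^{n+1}(\mathcal E)\times H^{n+2}(\mathcal E)$ for $n\ge 0$. For a function $f$ on $\mathcal E$ with boundary values $f(\pm R)$ (taken from inside $\mathcal E$) write $[\![f]\!]=f(R)-f(-R)$ and $\langle f\rangle=\frac12\big(f(R)+f(-R)\big)$. Let $\varepsilon\in[0,1]$ and $\delta>0$, let $\zeta_{\rm w}$ be a function on $(-R,R)$ such that $h_{\rm w}=1+\varepsilon\zeta_{\rm w}>0$ and $1/h_{\rm w}$ is integrable, and put $\alpha=\int_{-R}^R 1/h_{\rm w}$. Let $$c(\theta)=-\frac{2\theta^2}{(1+\sqrt{1+2\varepsilon\theta})^2},$$ which is smooth on $\{1+2\varepsilon\theta>0\}$. Call $\theta$ admissible if $\inf_{\mathcal E}(1+2\varepsilon\theta)>0$ and $\inf_{\mathcal E}(1+\varepsilon c'(\theta))>0$. Let $(\theta^{\rm in},q^{\rm in})\in\mathbb H^n$ with $[\![q^{\rm in}]\!]=0$ and $\theta^{\rm in}$ admissible. For $0<T\le\infty$, a solution on $[0,T)$ is a function $U=(\theta,q)\in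 C^1([0,T);\mathbb H^n)$ with $U(0)=(\theta^{\rm in},q^{\rm in})$ such that, for every $t\in[0,T)$, $\theta(t)$ is admissible and $$(1+\varepsilon c'(\theta))\,\partial_t\theta+\partial_x q=0,\qquad (1-\delta^2\partial_x^2)\,\partial_t q+\varepsilon\,\partial_x(q^2)+\partial_x\theta=0\qquad\text{on }\mathcal E,$$ $$[\![q]\!]=0,\qquad -\delta^2\,\frac{d}{dt}[\![\partial_x q]\!]+[\![\theta]\!]=-\alpha\,\frac{d}{dt}\langle q\rangle .$$ Then there are $T^*\in(0,\infty]$ and a solution $U=(\theta,q)$ on $[0,T^*)$ such that $U\in C^\infty([0,T^*);\mathbb H^n)$, and every solution $V$ on an interval $[0,T)$, $0<T\le\infty$, satisfies $T\le T^*$ and $V=U$ on $[0,T)$. In particular there is a unique local solution, it is $C^\infty$ in time with values in $\mathbb H^n$, and $T^*$ is the maximal existence time. Moreover, if $T^*<\infty$, then $$\lim_{T\to T^*,\,T<T^*}\Big\|\Big(\theta,\;q,\;\partial_x q,\;\frac{1}{1+\varepsilon c'(\theta)},\;1+\varepsilon c'(\theta)\Big)\Big\|_{L^\infty([0,T]\times\mathcal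 E)}=+\infty .$$ -/

import Mathlib

open MeasureTheory Filter Topology Set
open scoped ENNReal ContDiff

noncomputable section

namespace WaveObstacle

/-- `v` is the weak (distributional) derivative of `u` on the open set `Ω ⊆ ℝ`. -/
structure HasWeakDeriv (Ω : Set ℝ) (u v : ℝ → ℝ) : Prop where
  locInt : LocallyIntegrableOn u Ω
  locInt' : LocallyIntegrableOn v Ω
  integral_eq : ∀ φ : ℝ → ℝ, ContDiff ℝ ∞ φ → HasCompactSupport φ → tsupport φ ⊆ Ω →
    ∫ x in Ω, u x * deriv φ x = -∫ x in Ω, v x * φ x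

theorem integrableOn_mul_test {Ω : Set ℝ} {u ψ : ℝ → ℝ} (hu : LocallyIntegrableOn u Ω)
    (hψ : Continuous ψ) {K : Set ℝ} (hK : IsCompact K) (hKΩ : K ⊆ Ω)
    (hs : Function.support ψ ⊆ K) : IntegrableOn (fun x => u x * ψ x) Ω := by
  have h1 : IntegrableOn (fun x => u x * ψ x) K :=
    (hu.integrableOn_compact_subset hKΩ hK).mul_continuousOn hψ.continuousOn hK
  have h2 : Function.support (fun x => u x * ψ x) ⊆ K := fun x hx =>
    hs (fun h => hx (by simp [h]))
  exact ((integrableOn_iff_integrable_of_support_subset h2).1 h1).integrableOn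

theorem HasWeakDeriv.integrableOn_left {Ω : Set ℝ} {u v φ : ℝ → ℝ} (h : HasWeakDeriv Ω u v)
    (hφ : ContDiff ℝ ∞ φ) (hc : HasCompactSupport φ) (hs : tsupport φ ⊆ Ω) :
    IntegrableOn (fun x => u x * deriv φ x) Ω :=
  integrableOn_mul_test h.locInt (hφ.continuous_deriv (by simp)) hc hs
    (support_deriv_subset)

theorem HasWeakDeriv.integrableOn_right {Ω : Set ℝ} {u v φ : ℝ → ℝ} (h : HasWeakDeriv Ω u v)
    (hφ : ContDiff ℝ ∞ φ) (hc : HasCompactSupport φ) (hs : tsupport φ ⊆ Ω) :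
    IntegrableOn (fun x => v x * φ x) Ω :=
  integrableOn_mul_test h.locInt' hφ.continuous hc hs (subset_tsupport φ)

theorem HasWeakDeriv.zero (Ω : Set ℝ) : HasWeakDeriv Ω 0 0 where
  locInt := fun _ _ => ⟨univ, univ_mem, integrableOn_zero⟩
  locInt' := fun _ _ => ⟨univ, univ_mem, integrableOn_zero⟩
  integral_eq := by intro φ _ _ _; simp

theorem HasWeakDeriv.add {Ω : Set ℝ} {u v u' v' : ℝ → ℝ} (h : HasWeakDeriv Ω u v)
    (h' : HasWeakDeriv Ω u' v') : HasWeakDeriv Ω (u + u') (v + v') where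
  locInt := h.locInt.add h'.locInt
  locInt' := h.locInt'.add h'.locInt'
  integral_eq := by
    intro φ hφ hc hs
    simp only [Pi.add_apply, add_mul]
    rw [integral_add (h.integrableOn_left hφ hc hs) (h'.integrableOn_left hφ hc hs),
      integral_add (h.integrableOn_right hφ hc hs) (h'.integrableOn_right hφ hc hs),
      h.integral_eq φ hφ hc hs, h'.integral_eq φ hφ hc hs]
    ring

theorem HasWeakDeriv.smul {Ω : Set ℝ} {u v : ℝ → ℝ} (h : HasWeakDeriv Ω u v) (a : ℝ) :
    HasWeakDeriv Ω (a • u) (a • v) where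
  locInt := h.locInt.smul a
  locInt' := h.locInt'.smul a
  integral_eq := by
    intro φ hφ hc hs
    simp only [Pi.smul_apply, smul_eq_mul, mul_assoc]
    rw [integral_const_mul, integral_const_mul, h.integral_eq φ hφ hc hs]
    ring

theorem HasWeakDeriv.congr {Ω : Set ℝ} {u v u' v' : ℝ → ℝ} (h : HasWeakDeriv Ω u v)
    (hu : u =ᵐ[volume.restrict Ω] u') (hv : v =ᵐ[volume.restrict Ω] v') :
    HasWeakDeriv Ω u' v' where
  locInt := by
    intro x hx
    obtain ⟨s, hs, hi⟩ := h.locInt x hx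
    exact ⟨s ∩ Ω, inter_mem hs self_mem_nhdsWithin,
      (hi.mono_set inter_subset_left).congr_fun_ae (ae_restrict_of_ae_restrict_of_subset
        inter_subset_right hu)⟩
  locInt' := by
    intro x hx
    obtain ⟨s, hs, hi⟩ := h.locInt' x hx
    exact ⟨s ∩ Ω, inter_mem hs self_mem_nhdsWithin,
      (hi.mono_set inter_subset_left).congr_fun_ae (ae_restrict_of_ae_restrict_of_subset
        inter_subset_right hv)⟩
  integral_eq := by
    intro φ hφ hc hs
    have e1 : ∫ x in Ω, u x * deriv φ x = ∫ x in Ω, u' x * deriv φ x :=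
      integral_congr_ae (hu.mono fun x hx => by simp only [hx])
    have e2 : ∫ x in Ω, v x * φ x = ∫ x in Ω, v' x * φ x :=
      integral_congr_ae (hv.mono fun x hx => by simp only [hx])
    rw [← e1, ← e2]
    exact h.integral_eq φ hφ hc hs

/-- The fluid domain `ℰ = (-∞, -R) ∪ (R, ∞)`. -/
def fluidDomain (R : ℝ) : Set ℝ := Iio (-R) ∪ Ioi R

/-- Lebesgue measure on `ℰ`. -/
abbrev fluidMeasure (R : ℝ) : Measure ℝ := volume.restrict (fluidDomain R)

/-- The Sobolev space `H^k(ℰ)`. An element is the tuple `(u, ∂ₓu, …, ∂ₓᵏu)` of a function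
`u ∈ L²(ℰ)` and its weak derivatives up to order `k`, all in `L²(ℰ)` (the tuple is determined by
its first entry). The inherited norm is `(∑_{j ≤ k} ‖∂ₓʲu‖²_{L²(ℰ)})^{1/2}`. -/
def Sobolev (R : ℝ) (k : ℕ) :
    Submodule ℝ (PiLp 2 (fun _ : Fin (k + 1) => Lp ℝ 2 (fluidMeasure R))) where
  carrier := {u | ∀ j : Fin k, HasWeakDeriv (fluidDomain R) (u j.castSucc) (u j.succ)}
  zero_mem' := fun _ => (HasWeakDeriv.zero _).congr
    (Lp.coeFn_zero _ _ _).symm (Lp.coeFn_zero _ _ _).symm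
  add_mem' := fun hu hv j => ((hu j).add (hv j)).congr
    (Lp.coeFn_add _ _).symm (Lp.coeFn_add _ _).symm
  smul_mem' := fun a _ hu j => ((hu j).smul a).congr
    (Lp.coeFn_smul _ _).symm (Lp.coeFn_smul _ _).symm

/-- `∂ₓʲ u` for `u ∈ H^k(ℰ)` and `j ≤ k`, as a function defined almost everywhere on `ℰ`. -/
def dx {R : ℝ} {k : ℕ} (j : Fin (k + 1)) (u : Sobolev R k) : ℝ → ℝ :=
  (u.1 j : Lp ℝ 2 (fluidMeasure R))

/-- `ℍ^n = H^{n+1}(ℰ) × H^{n+2}(ℰ)`, the space of the pairs `(θ, q)`. -/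
abbrev HH (R : ℝ) (n : ℕ) : Type := Sobolev R (n + 1) × Sobolev R (n + 2)

/-- The boundary value `f(R)`, taken from inside `ℰ`: the essential limit of `f` at `R` from the
right. For `f ∈ H¹(ℰ)` this is the value at `R` of the continuous representative on `[R, ∞)`. -/
def traceRight (R : ℝ) (f : ℝ → ℝ) : ℝ := limUnder (ae volume ⊓ 𝓝[>] R) f

/-- The boundary value `f(-R)`, taken from inside `ℰ`: the essential limit of `f` at `-R` from
the left. -/
def traceLeft (R : ℝ) (f : ℝ → ℝ) : ℝ := limUnder (ae volume ⊓ 𝓝[<] (-R)) f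

/-- The jump `⟦f⟧ = f(R) - f(-R)`. -/
def jump (R : ℝ) (f : ℝ → ℝ) : ℝ := traceRight R f - traceLeft R f

/-- The average `⟨f⟩ = (f(R) + f(-R)) / 2`. -/
def average (R : ℝ) (f : ℝ → ℝ) : ℝ := (traceRight R f + traceLeft R f) / 2

/-- `α = ∫_{-R}^{R} 1 / h_w` with `h_w = 1 + ε ζ_w`. -/
def alpha (R ε : ℝ) (ζw : ℝ → ℝ) : ℝ := ∫ x in Ioo (-R) R, 1 / (1 + ε * ζw x)

/-- `c(y) = -2 y² / (1 + √(1 + 2 ε y))²`; meaningful for `1 + 2 ε y ≥ 0`, and smooth for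
`1 + 2 ε y > 0`. -/
def c (ε y : ℝ) : ℝ := -(2 * y ^ 2) / (1 + √(1 + 2 * ε * y)) ^ 2

/-- The coefficient `1 + ε c'(y)`. -/
def coeff (ε y : ℝ) : ℝ := 1 + ε * deriv (c ε) y

/-- `θ` takes its values in the domain `1 + 2 ε θ > 0` where `c` is smooth, away from its
boundary, and `inf {1 + ε c'(θ)} > 0`. -/
def Admissible {R : ℝ} {k : ℕ} (ε : ℝ) (θ : Sobolev R k) : Prop :=
  ∃ m > 0, ∀ᵐ x ∂fluidMeasure R, m ≤ 1 + 2 * ε * dx 0 θ x ∧ m ≤ coeff ε (dx 0 θ x)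

/-- The time interval `[0, T)`, where `T = ∞` is allowed. -/
def timeInterval (T : EReal) : Set ℝ := {t | 0 ≤ t ∧ (t : EReal) < T}

/-- `U = (θ, q) ∈ C¹([0, T); ℍ^n)` solves the transmission problem with initial data `Uin`. -/
structure IsSolution (R ε δ α : ℝ) {n : ℕ} (Uin : HH R n) (T : EReal) (U : ℝ → HH R n) :
    Prop where
  pos : 0 < T
  contDiffOn : ContDiffOn ℝ 1 U (timeInterval T)
  admissible : ∀ t ∈ timeInterval T, Admissible ε (U t).1
  /-- `(1 + ε c'(θ)) ∂ₜθ + ∂ₓq = 0` on `ℰ`. -/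
  mass : ∀ t ∈ timeInterval T, ∀ᵐ x ∂fluidMeasure R,
    coeff ε (dx 0 (U t).1 x) * dx 0 (derivWithin (fun s => (U s).1) (timeInterval T) t) x
      + dx 1 (U t).2 x = 0
  /-- `(1 - δ² ∂ₓ²) ∂ₜq + ε ∂ₓ(q²) + ∂ₓθ = 0` on `ℰ`, where `w = ∂ₓ(q²)`. -/
  momentum : ∀ t ∈ timeInterval T, ∃ w : ℝ → ℝ,
    HasWeakDeriv (fluidDomain R) (fun x => dx 0 (U t).2 x ^ 2) w ∧
    ∀ᵐ x ∂fluidMeasure R,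
      dx 0 (derivWithin (fun s => (U s).2) (timeInterval T) t) x
        - δ ^ 2 * dx 2 (derivWithin (fun s => (U s).2) (timeInterval T) t) x
        + ε * w x + dx 1 (U t).1 x = 0
  /-- `⟦q⟧ = 0`. -/
  jump_q : ∀ t ∈ timeInterval T, jump R (dx 0 (U t).2) = 0
  /-- `-δ² d/dt ⟦∂ₓq⟧ + ⟦θ⟧ = -α d/dt ⟨q⟩`. -/
  jump_dq : ∀ t ∈ timeInterval T,
    -δ ^ 2 * derivWithin (fun s => jump R (dx 1 (U s).2)) (timeInterval T) t
      + jump R (dx 0 (U t).1)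
      = -α * derivWithin (fun s => average R (dx 0 (U s).2)) (timeInterval T) t
  initial : U 0 = Uin

/-- The `L^∞(ℰ)` norm of `(θ, q, ∂ₓq, 1 / (1 + ε c'(θ)), 1 + ε c'(θ))`, as a maximum of essential
suprema in `[0, ∞]`. -/
def supNorm {R : ℝ} {n : ℕ} (ε : ℝ) (U : HH R n) : ℝ≥0∞ :=
  eLpNorm (dx 0 U.1) ∞ (fluidMeasure R) ⊔ eLpNorm (dx 0 U.2) ∞ (fluidMeasure R) ⊔
    eLpNorm (dx 1 U.2) ∞ (fluidMeasure R) ⊔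
    eLpNorm (fun x => 1 / coeff ε (dx 0 U.1 x)) ∞ (fluidMeasure R) ⊔
    eLpNorm (fun x => coeff ε (dx 0 U.1 x)) ∞ (fluidMeasure R)

end WaveObstacle

end

/-! The change of unknown `θ = ζ + ε ζ² / 2`, with inverse `ζ = h(θ) = θ + ε c(θ)`, turns the
transmission problem into an ordinary differential equation with a polynomial vector field on a
Banach space. Indeed `1 + ε c'(θ) = h'(θ) = 1 / √(1 + 2εθ) = 1 / (1 + εζ)`, so the mass equation
becomes `∂ₜζ + ∂ₓq = 0`, and admissibility of `θ` becomes a positive lower bound for `1 + εζ`, an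
open condition because `H^{n+1}(ℰ)` embeds in the bounded functions (`abs_rep_le`).

For the momentum equation put `p = ∂ₜq` and `g = εq² + θ`. Since `⟦q⟧ = 0` gives `⟦q²⟧ = 0`,
equation and transmission conditions together say that `p - δ² ∂ₓ²p + ∂ₓg = 0`, `⟦p⟧ = 0` and
`δ²⟦∂ₓp⟧ - ⟦g⟧ = α⟨p⟩`. As `α ≥ 0`, this elliptic problem is well posed by Lax-Milgram, and its
solution operator `S` (`ellipticSolver`) gains one derivative, from `H^{n+1}` to `H^{n+2}`. Hence
`(ζ, q) ↦ (-∂ₓq, S(εq² + ζ + εζ²/2))` maps `ℍ^n` to itself without loss of derivatives. It is smooth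
and Lipschitz on balls, because `H^{n+1}(ℰ)` is an algebra (`exists_mul`). Existence, uniqueness,
smoothness in time and maximality follow from the theory of such equations
(`exists_maximal_isODESolution`), once solutions are translated in both directions
(`IsODESolution.isSolution`, `IsSolution.exists_isODESolution`).

For the blow-up criterion, suppose that the sup norms stay bounded up to a finite time. Then `ζ` and
`q` are bounded and `1 + εζ` stays away from `0` (`bounds_of_supNorm_le`). The tame estimates
`norm_mulL_self_le_of_bound` and `norm_mulL_self_le_incl` make the field grow at most linearly along
the solution, so Grönwall's inequality, with an induction on `n`, bounds the `ℍ^n` norm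
(`IsODESolution.exists_norm_le`). A bounded solution has a limit at the final time, the limit still
satisfies the positivity condition, and the solution extends, contradicting maximality. -/

namespace WaveObstacle

noncomputable section

/-! ### Locally absolutely continuous functions and weak derivatives on the line. -/

section PrimitivesAndWeakDerivatives

/-- `f` is a locally absolutely continuous function on `ℝ` with derivative `g`. -/
structure IsPrimitive (f g : ℝ → ℝ) : Prop where
  locInt : LocallyIntegrable g volume
  sub_eq : ∀ x y, f y - f x = ∫ t in x..y, g t

theorem intervalIntegrable_of_locallyIntegrable {g : ℝ → ℝ} (hg : LocallyIntegrable g volume)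
    (a b : ℝ) : IntervalIntegrable g volume a b :=
  intervalIntegrable_iff.mpr ((hg.integrableOn_isCompact isCompact_uIcc).mono_set uIoc_subset_uIcc)

theorem locallyIntegrable_mul_continuous {f g : ℝ → ℝ} (hg : LocallyIntegrable g volume)
    (hf : Continuous f) : LocallyIntegrable (fun x => g x * f x) volume := by
  rw [locallyIntegrable_iff]
  intro K hK
  exact (hg.integrableOn_isCompact hK).mul_continuousOn hf.continuousOn hK

theorem absolutelyContinuousOnInterval_comp {F f : ℝ → ℝ} {a b : ℝ} {K : NNReal}
    (hF : LipschitzOnWith K F (f '' uIcc a b)) (hf : AbsolutelyContinuousOnInterval f a b) :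
    AbsolutelyContinuousOnInterval (fun x => F (f x)) a b := by
  rw [absolutelyContinuousOnInterval_iff] at hf ⊢
  intro η hη
  obtain ⟨d, hd, h⟩ := hf (η / (K + 1)) (by positivity)
  refine ⟨d, hd, fun E hE hEd => ?_⟩
  have h1 := h E hE hEd
  calc ∑ i ∈ Finset.range E.1, dist (F (f (E.2 i).1)) (F (f (E.2 i).2))
      ≤ ∑ i ∈ Finset.range E.1, K * dist (f (E.2 i).1) (f (E.2 i).2) := by
        refine Finset.sum_le_sum fun i hi => ?_
        have := hE.1 i hi
        exact hF.dist_le_mul _ (mem_image_of_mem _ this.1) _ (mem_image_of_mem _ this.2)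
    _ = K * ∑ i ∈ Finset.range E.1, dist (f (E.2 i).1) (f (E.2 i).2) := by
        rw [Finset.mul_sum]
    _ ≤ K * (η / (K + 1)) := by gcongr
    _ < η := by
        rw [← mul_div_assoc, div_lt_iff₀ (by positivity)]
        nlinarith

namespace IsPrimitive

variable {f g f' g' : ℝ → ℝ}

theorem intervalIntegrable (h : IsPrimitive f g) (a b : ℝ) : IntervalIntegrable g volume a b :=
  intervalIntegrable_of_locallyIntegrable h.locInt a b

theorem eq_add (h : IsPrimitive f g) (x y : ℝ) : f y = f x + ∫ t in x..y, g t := by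
  linarith [h.sub_eq x y]

theorem absCont (h : IsPrimitive f g) (a b : ℝ) : AbsolutelyContinuousOnInterval f a b := by
  have h1 := (h.intervalIntegrable a b).absolutelyContinuousOnInterval_intervalIntegral
    (c := a) left_mem_uIcc
  have h2 : AbsolutelyContinuousOnInterval (fun _ => f a) a b :=
    contDiffOn_const.absolutelyContinuousOnInterval
  have h3 : f = (fun _ => f a) + fun x => ∫ v in a..x, g v := by
    ext x; exact h.eq_add a x
  rw [h3]
  exact h2.add h1

theorem continuous (h : IsPrimitive f g) : Continuous f := by
  rw [continuous_iff_continuousAt]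
  intro x
  have h1 := (h.absCont (x - 1) (x + 1)).continuousOn
  rw [uIcc_of_le (by linarith)] at h1
  exact h1.continuousAt (Icc_mem_nhds (by linarith) (by linarith))

theorem ae_hasDerivAt (h : IsPrimitive f g) : ∀ᵐ x, HasDerivAt f (g x) x := by
  filter_upwards [_root_.LocallyIntegrable.ae_hasDerivAt_integral h.locInt] with x hx
  have h3 : f = fun x => f 0 + ∫ v in 0..x, g v := by
    ext x; exact h.eq_add 0 x
  rw [h3]
  exact (hx 0).const_add _

/-- By the fundamental theorem of calculus for absolutely continuous functions, it is enough to
identify the derivative almost everywhere. Stability under products and compositions reduces to this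
criterion. -/
theorem of_absCont (hf : ∀ a b, AbsolutelyContinuousOnInterval f a b)
    (hg : LocallyIntegrable g volume) (h : ∀ᵐ x, HasDerivAt f (g x) x) : IsPrimitive f g where
  locInt := hg
  sub_eq x y := by
    rw [← (hf x y).integral_deriv_eq_sub]
    exact intervalIntegral.integral_congr_ae (h.mono fun t ht _ => ht.deriv)

theorem of_contDiff (hf : ContDiff ℝ 1 f) : IsPrimitive f (deriv f) :=
  of_absCont (fun _ _ => hf.contDiffOn.absolutelyContinuousOnInterval)
    (hf.continuous_deriv le_rfl).locallyIntegrable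
    (Eventually.of_forall fun _ => (hf.differentiable (by simp)).differentiableAt.hasDerivAt)

theorem of_integral (hg : LocallyIntegrable g volume) (a c : ℝ) :
    IsPrimitive (fun x => c + ∫ t in a..x, g t) g where
  locInt := hg
  sub_eq x y := by
    rw [← intervalIntegral.integral_interval_sub_left
      (intervalIntegrable_of_locallyIntegrable hg a y)
      (intervalIntegrable_of_locallyIntegrable hg a x)]
    ring

theorem mul (h : IsPrimitive f g) (h' : IsPrimitive f' g') :
    IsPrimitive (fun x => f x * f' x) (fun x => g x * f' x + f x * g' x) := by
  refine of_absCont (fun a b => (h.absCont a b).mul (h'.absCont a b)) ?_ ?_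
  · refine (locallyIntegrable_mul_continuous h.locInt h'.continuous).add ?_
    simpa only [mul_comm] using locallyIntegrable_mul_continuous h'.locInt h.continuous
  · filter_upwards [h.ae_hasDerivAt, h'.ae_hasDerivAt] with x h1 h2 using h1.mul h2

theorem comp (h : IsPrimitive f g) {F : ℝ → ℝ} {O : Set ℝ} (hO : IsOpen O)
    (hf : ∀ x, f x ∈ O) (hF : ContDiffOn ℝ 1 F O) :
    IsPrimitive (fun x => F (f x)) (fun x => deriv F (f x) * g x) := by
  refine of_absCont (fun a b => ?_) ?_ ?_
  · have hfc : ContinuousOn f (uIcc a b) := h.continuous.continuousOn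
    have him : f '' uIcc a b = Icc (sInf (f '' uIcc a b)) (sSup (f '' uIcc a b)) := by
      rw [uIcc] at hfc ⊢
      exact hfc.image_Icc inf_le_sup
    have hsub : f '' uIcc a b ⊆ O := by rintro _ ⟨x, _, rfl⟩; exact hf x
    rw [him] at hsub
    obtain ⟨K, hK⟩ := (hF.mono hsub).exists_lipschitzOnWith one_ne_zero (convex_Icc _ _)
      isCompact_Icc
    rw [← him] at hK
    exact absolutelyContinuousOnInterval_comp hK (h.absCont a b)
  · have hc : Continuous fun x => deriv F (f x) :=
      (hF.continuousOn_deriv_of_isOpen hO le_rfl).comp_continuous h.continuous hf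
    simpa only [mul_comm] using locallyIntegrable_mul_continuous h.locInt hc
  · filter_upwards [h.ae_hasDerivAt] with x h1
    exact ((hF.differentiableOn (by simp)).differentiableAt
      (hO.mem_nhds (hf x))).hasDerivAt.comp x h1

/-- The product `f φ` is again a primitive, and it vanishes at both ends of an interval containing
the support of `φ`, so the integral of its derivative is zero. -/
theorem hasWeakDeriv (h : IsPrimitive f g) (Ω : Set ℝ) : HasWeakDeriv Ω f g where
  locInt := h.continuous.locallyIntegrable.locallyIntegrableOn Ω
  locInt' := h.locInt.locallyIntegrableOn Ω
  integral_eq := by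
    intro φ hφ hc hs
    have hp := h.mul (of_contDiff (hφ.of_le (by exact_mod_cast le_top)))
    have hz : ∀ x, x ∉ Ω → φ x = 0 := fun x hx =>
      image_eq_zero_of_notMem_tsupport fun h => hx (hs h)
    have hz' : ∀ x, x ∉ Ω → deriv φ x = 0 := fun x hx => by
      by_contra hne
      exact hx (hs (support_deriv_subset hne))
    rw [setIntegral_eq_integral_of_forall_compl_eq_zero (fun x hx => by simp [hz' x hx]),
      setIntegral_eq_integral_of_forall_compl_eq_zero (fun x hx => by simp [hz x hx])]
    have hu : LocallyIntegrableOn f univ :=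
      h.continuous.locallyIntegrable.locallyIntegrableOn univ
    have hi1 := integrableOn_mul_test hu (hφ.continuous_deriv (by simp)) hc (subset_univ _)
      support_deriv_subset
    have hi2 := integrableOn_mul_test (h.locInt.locallyIntegrableOn univ) hφ.continuous hc
      (subset_univ _) (subset_tsupport φ)
    rw [integrableOn_univ] at hi1 hi2
    rw [eq_neg_iff_add_eq_zero, add_comm, ← integral_add hi2 hi1]
    obtain ⟨r, hr⟩ := hc.isBounded.subset_closedBall 0
    rw [Real.closedBall_eq_Icc] at hr
    have hout : ∀ x, x ∉ Icc (0 - r) (0 + r) → φ x = 0 := fun x hx =>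
      image_eq_zero_of_notMem_tsupport fun h => hx (hr h)
    have hout' : ∀ x, x ∉ Icc (0 - r) (0 + r) → deriv φ x = 0 := fun x hx => by
      by_contra hne
      exact hx (hr (support_deriv_subset hne))
    have h1 := hp.sub_eq (-(|r| + 1)) (|r| + 1)
    rw [hout (|r| + 1) (fun hx => by have := hx.2; linarith [le_abs_self r]),
      hout (-(|r| + 1)) (fun hx => by have := hx.1; linarith [le_abs_self r]),
      intervalIntegral.integral_of_le (by linarith [abs_nonneg r]),
      setIntegral_eq_integral_of_forall_compl_eq_zero] at h1
    · rw [← h1]; simp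
    · intro x hx
      have : x ∉ Icc (0 - r) (0 + r) := fun h => hx
        ⟨by have := h.1; linarith [le_abs_self r], by have := h.2; linarith [le_abs_self r]⟩
      simp [hout x this, hout' x this]

/-- Integrability of `g` gives `f` a limit at infinity. Integrability of `f` on a half-line, which
has infinite measure, forces that limit to be `0`. -/
theorem integral_Ioi (h : IsPrimitive f g) {x : ℝ} (hf : IntegrableOn f (Ioi x))
    (hg : IntegrableOn g (Ioi x)) : ∫ t in Ioi x, g t = -f x := by
  have h1 := intervalIntegral_tendsto_integral_Ioi x hg tendsto_id
  have h2 : Tendsto f atTop (𝓝 (f x + ∫ t in Ioi x, g t)) :=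
    (h1.const_add (f x)).congr fun y => (h.eq_add x y).symm
  have h3 : IntegrableAtFilter f atTop volume := ⟨_, Ioi_mem_atTop x, hf⟩
  have h4 := h3.eq_zero_of_tendsto (fun s hs => by
    obtain ⟨b, hb⟩ := mem_atTop_sets.1 hs
    exact measure_mono_top (fun y hy => hb y (mem_Ioi.1 hy).le) Real.volume_Ioi) h2
  linarith

theorem integral_Iio (h : IsPrimitive f g) {x : ℝ} (hf : IntegrableOn f (Iio x))
    (hg : IntegrableOn g (Iio x)) : ∫ t in Iio x, g t = f x := by
  rw [← integral_Iic_eq_integral_Iio]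
  rw [← integrableOn_Iic_iff_integrableOn_Iio] at hg
  have h1 := intervalIntegral_tendsto_integral_Iic x hg tendsto_id
  have h2 : Tendsto f atBot (𝓝 (f x - ∫ t in Iic x, g t)) :=
    (h1.const_sub (f x)).congr fun y => by simp only [id, h.eq_add y x]; ring
  have h3 : IntegrableAtFilter f atBot volume := ⟨_, Iio_mem_atBot x, hf⟩
  have h4 := h3.eq_zero_of_tendsto (fun s hs => by
    obtain ⟨b, hb⟩ := mem_atBot_sets.1 hs
    exact measure_mono_top (fun y hy => hb y (mem_Iio.1 hy).le) Real.volume_Iio) h2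
  linarith

end IsPrimitive

theorem exists_Icc_of_isCompact_subset {I K : Set ℝ} (hI : I.OrdConnected) (hne : I.Nonempty)
    (hK : IsCompact K) (hKI : K ⊆ I) : ∃ A B, K ⊆ Icc A B ∧ Icc A B ⊆ I := by
  obtain ⟨p, hp⟩ := hne
  have hK' : IsCompact (insert p K) := hK.insert p
  have hn : (insert p K).Nonempty := insert_nonempty p K
  have hsub : insert p K ⊆ I := insert_subset hp hKI
  refine ⟨sInf (insert p K), sSup (insert p K), fun x hx => ?_, ?_⟩
  · exact ⟨csInf_le hK'.bddBelow (mem_insert_of_mem _ hx),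
      le_csSup hK'.bddAbove (mem_insert_of_mem _ hx)⟩
  · exact hI.out (hsub (hK'.sInf_mem hn)) (hsub (hK'.sSup_mem hn))

/-- The du Bois-Reymond lemma: a function with vanishing weak derivative on an interval is
constant there. -/
theorem exists_ae_eq_const_of_integral_deriv_eq_zero {I : Set ℝ} (hI : I.OrdConnected)
    (hIo : IsOpen I) (hne : I.Nonempty) {u : ℝ → ℝ} (hu : LocallyIntegrableOn u I)
    (h : ∀ φ : ℝ → ℝ, ContDiff ℝ ∞ φ → HasCompactSupport φ → tsupport φ ⊆ I →
      ∫ x in I, u x * deriv φ x = 0) : ∃ a, ∀ᵐ x, x ∈ I → u x = a := by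
  obtain ⟨p, hp⟩ := hne
  obtain ⟨r, hr, hrI⟩ := Metric.isOpen_iff.1 hIo p hp
  let b : ContDiffBump p := ⟨r / 4, r / 2, by positivity, by linarith⟩
  let ψ₀ : ℝ → ℝ := b.normed volume
  have hψ₀s : ContDiff ℝ ∞ ψ₀ := b.contDiff_normed
  have hψ₀c : HasCompactSupport ψ₀ := b.hasCompactSupport_normed
  have hψ₀t : tsupport ψ₀ ⊆ I := by
    rw [b.tsupport_normed_eq]
    exact (Metric.closedBall_subset_ball (by change r / 2 < r; linarith)).trans hrI
  have hψ₀i : ∫ x, ψ₀ x = 1 := b.integral_normed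
  have int_mul : ∀ ψ : ℝ → ℝ, Continuous ψ → HasCompactSupport ψ → tsupport ψ ⊆ I →
      IntegrableOn (fun x => u x * ψ x) I := fun ψ h1 h2 h3 =>
    integrableOn_mul_test hu h1 h2 h3 (subset_tsupport ψ)
  -- If `u` is constant, testing against `ψ₀`, whose integral is `1`, returns that constant.
  set a := ∫ x in I, u x * ψ₀ x with ha
  refine ⟨a, ?_⟩
  have key : ∀ ψ : ℝ → ℝ, ContDiff ℝ ∞ ψ → HasCompactSupport ψ → tsupport ψ ⊆ I →
      ∫ x in I, u x * ψ x = (∫ x, ψ x) * a := by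
    intro ψ hs hc ht
    set m := ∫ x, ψ x with hm
    -- Subtracting the multiple `m` of `ψ₀` makes the integral vanish, which is what gives `χ` a
    -- compactly supported primitive, usable as a test function in `h`.
    let χ : ℝ → ℝ := fun x => ψ x - m * ψ₀ x
    have hχs : ContDiff ℝ ∞ χ := hs.sub (contDiff_const.mul hψ₀s)
    have hχi : ∫ x, χ x = 0 := by
      change ∫ x, (ψ x - m * ψ₀ x) = 0
      rw [integral_sub (hs.continuous.integrable_of_hasCompactSupport hc)
        ((hψ₀s.continuous.integrable_of_hasCompactSupport hψ₀c).const_mul m),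
        integral_const_mul, hψ₀i, hm]
      ring
    -- The primitive `φ` need not vanish between the two supports. Connectedness of `I` keeps an
    -- interval containing both of them inside `I`.
    obtain ⟨A, B, hAB, hABI⟩ := exists_Icc_of_isCompact_subset hI ⟨p, hp⟩
      (hc.isCompact.union hψ₀c.isCompact) (union_subset ht hψ₀t)
    have hχ0 : ∀ x, x ∉ Icc A B → χ x = 0 := by
      intro x hx
      have h1 : ψ x = 0 := image_eq_zero_of_notMem_tsupport fun h => hx (hAB (Or.inl h))
      have h2 : ψ₀ x = 0 := image_eq_zero_of_notMem_tsupport fun h => hx (hAB (Or.inr h))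
      simp [χ, h1, h2]
    let φ : ℝ → ℝ := fun x => ∫ t in A..x, χ t
    have hφd : ∀ x, HasDerivAt φ (χ x) x := fun x =>
      intervalIntegral.integral_hasDerivAt_right (hχs.continuous.intervalIntegrable _ _)
        (hχs.continuous.stronglyMeasurableAtFilter _ _) hχs.continuous.continuousAt
    have hφd' : deriv φ = χ := funext fun x => (hφd x).deriv
    have hφs : ContDiff ℝ ∞ φ := by
      rw [contDiff_infty_iff_deriv]
      exact ⟨fun x => (hφd x).differentiableAt, hφd' ▸ hχs⟩
    have hφ0 : ∀ x, x ∉ Icc A B → φ x = 0 := by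
      intro x hx
      by_cases hxA : x < A
      · change ∫ t in A..x, χ t = 0
        rw [intervalIntegral.integral_symm, intervalIntegral.integral_of_le hxA.le,
          integral_Ioc_eq_integral_Ioo, setIntegral_eq_zero_of_forall_eq_zero, neg_zero]
        intro t ht
        exact hχ0 t fun h => not_lt.2 h.1 ht.2
      · have hxB : B < x := by
          by_contra hB
          exact hx ⟨not_lt.1 hxA, not_lt.1 hB⟩
        have hAx : A ≤ x := not_lt.1 hxA
        change ∫ t in A..x, χ t = 0
        rw [intervalIntegral.integral_of_le hAx, ← integral_Icc_eq_integral_Ioc,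
          setIntegral_eq_integral_of_forall_compl_eq_zero, hχi]
        intro t ht
        exact hχ0 t fun h => ht ⟨h.1, h.2.trans hxB.le⟩
    have hφt : tsupport φ ⊆ Icc A B := by
      refine closure_minimal (fun x hx => ?_) isClosed_Icc
      by_contra hn
      exact hx (hφ0 x hn)
    have hφc : HasCompactSupport φ := HasCompactSupport.of_support_subset_isCompact isCompact_Icc
      ((subset_tsupport φ).trans hφt)
    have h1 := h φ hφs hφc (hφt.trans hABI)
    rw [hφd'] at h1
    have h2 : ∀ x, u x * χ x = u x * ψ x - m * (u x * ψ₀ x) := fun x => by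
      simp only [χ]; ring
    simp only [h2] at h1
    rw [integral_sub (int_mul ψ hs.continuous hc ht)
      ((int_mul ψ₀ hψ₀s.continuous hψ₀c hψ₀t).const_mul m), integral_const_mul] at h1
    linarith
  have hz : ∀ᵐ x, x ∈ I → u x - a = 0 := by
    refine hIo.ae_eq_zero_of_integral_contDiff_smul_eq_zero
      (hu.sub ((locallyIntegrable_const a).locallyIntegrableOn I)) ?_
    intro ψ hs hc ht
    have h0 : ∀ x, x ∉ I → ψ x = 0 := fun x hx =>
      image_eq_zero_of_notMem_tsupport fun h => hx (ht h)
    rw [← setIntegral_eq_integral_of_forall_compl_eq_zero (s := I)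
      (fun x hx => by simp [h0 x hx])]
    have h3 : ∀ x, ψ x • (u x - a) = u x * ψ x - a * ψ x := fun x => by
      rw [smul_eq_mul]; ring
    simp only [h3]
    rw [integral_sub (int_mul ψ hs.continuous hc ht)
      ((hs.continuous.integrable_of_hasCompactSupport hc).integrableOn.const_mul a),
      integral_const_mul, key ψ hs hc ht,
      setIntegral_eq_integral_of_forall_compl_eq_zero (fun x hx => h0 x hx)]
    ring
  filter_upwards [hz] with x hx hxI
  linarith [hx hxI]

end PrimitivesAndWeakDerivatives

/-! ### Extension of functions on the exterior domain to the whole line. -/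

section Extension

theorem isOpen_fluidDomain (R : ℝ) : IsOpen (fluidDomain R) := isOpen_Iio.union isOpen_Ioi

theorem measurableSet_fluidDomain (R : ℝ) : MeasurableSet (fluidDomain R) :=
  (isOpen_fluidDomain R).measurableSet

/-- The closed fluid domain `(-∞, -R] ∪ [R, ∞)`. -/
def closedDomain (R : ℝ) : Set ℝ := Iic (-R) ∪ Ici R

theorem fluidDomain_subset_closedDomain (R : ℝ) : fluidDomain R ⊆ closedDomain R :=
  union_subset_union Iio_subset_Iic_self Ioi_subset_Ici_self

theorem closedDomain_subset_closure (R : ℝ) : closedDomain R ⊆ closure (fluidDomain R) := by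
  rw [fluidDomain, closure_union, closure_Iio, closure_Ioi, closedDomain]

theorem right_mem_closedDomain (R : ℝ) : R ∈ closedDomain R := Or.inr self_mem_Ici

theorem left_mem_closedDomain (R : ℝ) : -R ∈ closedDomain R := Or.inl self_mem_Iic

/-- Almost everywhere equality propagates to the open set by continuity and then to its closure. The
closure contains `±R`, so boundary values can be read from any continuous representative. -/
theorem eqOn_closedDomain_of_ae_eq {R : ℝ} {f g : ℝ → ℝ} (hf : Continuous f) (hg : Continuous g)
    (h : f =ᵐ[fluidMeasure R] g) : EqOn f g (closedDomain R) := by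
  have h1 : EqOn f g (fluidDomain R) := Measure.eqOn_of_ae_eq h hf.continuousOn hg.continuousOn
    (by rw [(isOpen_fluidDomain R).interior_eq]; exact subset_closure)
  exact (h1.closure hf hg).mono (closedDomain_subset_closure R)

theorem forall_le_of_ae_le {R a : ℝ} {f : ℝ → ℝ} (hf : Continuous f)
    (h : ∀ᵐ x ∂fluidMeasure R, a ≤ f x) : ∀ x ∈ closedDomain R, a ≤ f x := by
  have h1 : (fun x => max a (f x)) =ᵐ[fluidMeasure R] f := h.mono fun x hx => max_eq_right hx
  intro x hx
  rw [← eqOn_closedDomain_of_ae_eq (continuous_const.max hf) hf h1 hx]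
  exact le_max_left _ _

/-- On each half-line `u` differs from a primitive of `v` by a constant, by du Bois-Reymond. The two
pieces are joined by an affine function on `[-R, R]`, so the extension takes there only values
between its two boundary values. -/
theorem HasWeakDeriv.exists_isPrimitive {R : ℝ} (hR : 0 < R) {u v : ℝ → ℝ}
    (h : HasWeakDeriv (fluidDomain R) u v)
    (hv : LocallyIntegrable ((fluidDomain R).indicator v) volume) :
    ∃ f g, IsPrimitive f g ∧ u =ᵐ[fluidMeasure R] f ∧ v =ᵐ[fluidMeasure R] g ∧
      ∀ x ∈ Icc (-R) R, f x ∈ uIcc (f (-R)) (f R) := by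
  set w := (fluidDomain R).indicator v with hw
  have hwv : ∀ x ∈ fluidDomain R, w x = v x := fun x hx => indicator_of_mem hx v
  set W : ℝ → ℝ := fun x => 0 + ∫ t in R..x, w t with hW
  have hWp : IsPrimitive W w := IsPrimitive.of_integral hv R 0
  have hWd := hWp.hasWeakDeriv (fluidDomain R)
  have key : ∀ I : Set ℝ, I ⊆ fluidDomain R → I.OrdConnected → IsOpen I → I.Nonempty →
      ∃ a, ∀ᵐ x, x ∈ I → u x - W x = a := by
    intro I hI hIc hIo hne
    refine exists_ae_eq_const_of_integral_deriv_eq_zero hIc hIo hne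
      ((h.locInt.mono_set hI).sub (hWd.locInt.mono_set hI)) ?_
    intro φ hφ hc ht
    have ht' := ht.trans hI
    have h0 : ∀ x, x ∉ I → deriv φ x = 0 := fun x hx => by
      by_contra hne
      exact hx (ht (support_deriv_subset hne))
    have h1 : ∀ (F : ℝ → ℝ), ∫ x in I, F x * deriv φ x = ∫ x in fluidDomain R, F x * deriv φ x := by
      intro F
      rw [setIntegral_eq_integral_of_forall_compl_eq_zero (fun x hx => by simp [h0 x hx]),
        setIntegral_eq_integral_of_forall_compl_eq_zero
          (fun x hx => by simp [h0 x fun h => hx (hI h)])]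
    rw [h1]
    simp only [sub_mul]
    rw [integral_sub (h.integrableOn_left hφ hc ht') (hWd.integrableOn_left hφ hc ht'),
      h.integral_eq φ hφ hc ht', hWd.integral_eq φ hφ hc ht', sub_eq_zero, neg_inj]
    exact setIntegral_congr_fun (measurableSet_fluidDomain R) fun x hx => by simp only [hwv x hx]
  obtain ⟨a, ha⟩ := key (Ioi R) subset_union_right ordConnected_Ioi isOpen_Ioi nonempty_Ioi
  obtain ⟨b, hb⟩ := key (Iio (-R)) subset_union_left ordConnected_Iio isOpen_Iio nonempty_Iio
  -- The slope that joins the value `b` at `-R` to the value `a` at `R`; here `W` vanishes at both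
  -- points.
  set s := (a - b) / (2 * R) with hs
  have hs' : 2 * R * s = a - b := by rw [hs]; field_simp
  set z : ℝ → ℝ := (Icc (-R) R).indicator (fun _ => s) with hz
  have hzi : Integrable z volume := (integrable_indicator_iff measurableSet_Icc).2
    (integrableOn_const (by simp))
  have hzl : LocallyIntegrable z volume := hzi.locallyIntegrable
  have hz0 : ∀ x ∈ fluidDomain R, z x = 0 := by
    intro x hx
    refine indicator_of_notMem (fun h => ?_) _
    rcases hx with hx | hx
    · exact not_lt.2 h.1 hx
    · exact not_lt.2 h.2 hx
  have hw0 : ∀ x ∈ Icc (-R) R, w x = 0 := by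
    intro x hx
    refine indicator_of_notMem (fun h => ?_) _
    rcases h with h | h
    · exact not_lt.2 hx.1 h
    · exact not_lt.2 hx.2 h
  set f : ℝ → ℝ := fun x => a + ∫ t in R..x, (w t + z t) with hf
  have hfp : IsPrimitive f (fun t => w t + z t) := IsPrimitive.of_integral (hv.add hzl) R a
  have hfi : ∀ x, f x = a + W x + ∫ t in R..x, z t := by
    intro x
    simp only [hf, hW]
    rw [intervalIntegral.integral_add (intervalIntegrable_of_locallyIntegrable hv _ _)
      (intervalIntegrable_of_locallyIntegrable hzl _ _)]
    ring
  have hfr : ∀ x ∈ Ioi R, f x = a + W x := by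
    intro x hx
    rw [hfi x, intervalIntegral.integral_of_le (le_of_lt hx),
      setIntegral_eq_zero_of_forall_eq_zero fun t ht => hz0 t (Or.inr ht.1), add_zero]
  have hfm : ∀ x ∈ Icc (-R) R, f x = a - (R - x) * s := by
    intro x hx
    have h1 : ∫ t in x..R, (w t + z t) = ∫ t in x..R, s := by
      refine intervalIntegral.integral_congr fun t ht => ?_
      rw [uIcc_of_le hx.2] at ht
      have ht' : t ∈ Icc (-R) R := ⟨hx.1.trans ht.1, ht.2⟩
      simp only [hw0 t ht', hz, indicator_of_mem ht', zero_add]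
    simp only [hf]
    rw [intervalIntegral.integral_symm, h1, intervalIntegral.integral_const, smul_eq_mul]
    ring
  have hfl : ∀ x ∈ Iio (-R), f x = b + W x := by
    intro x hx
    have h2 := hfp.sub_eq x (-R)
    have h3 := hWp.sub_eq x (-R)
    have h4 : ∫ t in x..(-R), (w t + z t) = ∫ t in x..(-R), w t := by
      rw [intervalIntegral.integral_of_le (le_of_lt hx),
        intervalIntegral.integral_of_le (le_of_lt hx), integral_Ioc_eq_integral_Ioo,
        integral_Ioc_eq_integral_Ioo]
      exact setIntegral_congr_fun measurableSet_Ioo fun t ht => by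
        simp only [hz0 t (Or.inl ht.2), add_zero]
    have h5 := hfm (-R) ⟨le_rfl, by linarith⟩
    have h6 : W (-R) = 0 := by
      simp only [hW]
      rw [intervalIntegral.integral_symm, intervalIntegral.integral_of_le (by linarith),
        setIntegral_eq_zero_of_forall_eq_zero fun t ht => hw0 t ⟨ht.1.le, ht.2⟩]
      simp
    linarith
  refine ⟨f, _, hfp, ?_, ?_, ?_⟩
  · rw [EventuallyEq, ae_restrict_iff' (measurableSet_fluidDomain R)]
    filter_upwards [ha, hb] with x h1 h2 hx
    rcases hx with hx | hx
    · rw [hfl x hx]; linarith [h2 hx]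
    · rw [hfr x hx]; linarith [h1 hx]
  · rw [EventuallyEq, ae_restrict_iff' (measurableSet_fluidDomain R)]
    refine Eventually.of_forall fun x hx => ?_
    simp only [hz0 x hx, hwv x hx, add_zero]
  · intro x hx
    rw [hfm x hx, hfm (-R) ⟨le_rfl, by linarith⟩, hfm R ⟨by linarith, le_rfl⟩, mem_uIcc]
    rcases le_total 0 s with h0 | h0
    · left; constructor <;> nlinarith [hx.1, hx.2]
    · right; constructor <;> nlinarith [hx.1, hx.2]

theorem HasWeakDeriv.unique {R : ℝ} {u v v' : ℝ → ℝ} (h : HasWeakDeriv (fluidDomain R) u v)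
    (h' : HasWeakDeriv (fluidDomain R) u v') : v =ᵐ[fluidMeasure R] v' := by
  rw [EventuallyEq, ae_restrict_iff' (measurableSet_fluidDomain R)]
  have h1 : ∀ᵐ x, x ∈ fluidDomain R → v x - v' x = 0 := by
    refine (isOpen_fluidDomain R).ae_eq_zero_of_integral_contDiff_smul_eq_zero
      (h.locInt'.sub h'.locInt') ?_
    intro φ hφ hc ht
    rw [← setIntegral_eq_integral_of_forall_compl_eq_zero (s := fluidDomain R) (fun x hx => by
      rw [image_eq_zero_of_notMem_tsupport fun h => hx (ht h), zero_smul])]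
    have h3 : ∀ x, φ x • (v x - v' x) = v x * φ x - v' x * φ x := fun x => by
      rw [smul_eq_mul]; ring
    simp only [h3]
    rw [integral_sub (h.integrableOn_right hφ hc ht) (h'.integrableOn_right hφ hc ht)]
    linarith [h.integral_eq φ hφ hc ht, h'.integral_eq φ hφ hc ht]
  filter_upwards [h1] with x hx hxR
  linarith [hx hxR]

theorem locallyIntegrable_indicator_of_memLp {R : ℝ} {v : ℝ → ℝ} (hv : MemLp v 2 (fluidMeasure R)) :
    LocallyIntegrable ((fluidDomain R).indicator v) volume :=
  ((memLp_indicator_iff_restrict (measurableSet_fluidDomain R)).2 hv).locallyIntegrable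
    (by norm_num)

theorem locallyIntegrableOn_of_memLp {R : ℝ} {v : ℝ → ℝ} (hv : MemLp v 2 (fluidMeasure R)) :
    LocallyIntegrableOn v (fluidDomain R) :=
  locallyIntegrableOn_of_locallyIntegrable_restrict (hv.locallyIntegrable (by norm_num))

end Extension

local instance {R : ℝ} {k : ℕ} : NormedAddCommGroup (Sobolev R k) := inferInstance
local instance {R : ℝ} {k : ℕ} : SeminormedAddCommGroup (Sobolev R k) := inferInstance
local instance {R : ℝ} {k : ℕ} : Module ℝ (Sobolev R k) := inferInstance
local instance {R : ℝ} {k : ℕ} : MulAction ℝ (Sobolev R k) := inferInstance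
local instance {R : ℝ} {k : ℕ} : NormedSpace ℝ (Sobolev R k) := inferInstance
local instance {R : ℝ} {k : ℕ} : IsTopologicalAddGroup (Sobolev R k) := inferInstance
local instance {R : ℝ} {k : ℕ} : ContinuousAdd (Sobolev R k) := inferInstance
local instance {R : ℝ} {k : ℕ} : ContinuousConstSMul ℝ (Sobolev R k) := inferInstance
local instance {R : ℝ} {k : ℕ} : SMulCommClass ℝ ℝ (Sobolev R k) := inferInstance
local instance {R : ℝ} {k l : ℕ} : Module ℝ (Sobolev R k →L[ℝ] Sobolev R l) := inferInstance

/-! ### The Sobolev spaces of the exterior domain: completeness, derivatives and inclusions. -/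

section SobolevSpaces

variable {R : ℝ} {k : ℕ}

/-- `L²(ℰ)`. -/
abbrev LTwo (R : ℝ) : Type := Lp ℝ 2 (fluidMeasure R)

theorem integral_sq_eq_norm_sq (f : LTwo R) : ∫ x, f x ^ 2 ∂fluidMeasure R = ‖f‖ ^ 2 := by
  rw [← real_inner_self_eq_norm_sq, L2.inner_def]
  simp [sq]

theorem integrable_mul_lTwo {f g : ℝ → ℝ} (hf : MemLp f 2 (fluidMeasure R))
    (hg : MemLp g 2 (fluidMeasure R)) : Integrable (fun x => f x * g x) (fluidMeasure R) :=
  hf.integrable_mul hg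

theorem hasWeakDeriv_iff_of_lTwo (u v : LTwo R) : HasWeakDeriv (fluidDomain R) u v ↔
    ∀ φ : ℝ → ℝ, ContDiff ℝ ∞ φ → HasCompactSupport φ → tsupport φ ⊆ fluidDomain R →
      ∫ x in fluidDomain R, u x * deriv φ x = -∫ x in fluidDomain R, v x * φ x :=
  ⟨fun h => h.integral_eq, fun h => ⟨locallyIntegrableOn_of_memLp (Lp.memLp u),
    locallyIntegrableOn_of_memLp (Lp.memLp v), h⟩⟩

theorem continuous_integral_mul {ψ : ℝ → ℝ} (hψ : Continuous ψ) (hc : HasCompactSupport ψ) :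
    Continuous fun u : LTwo R => ∫ x in fluidDomain R, u x * ψ x := by
  have hm : MemLp ψ 2 (fluidMeasure R) :=
    (hψ.memLp_of_hasCompactSupport hc (μ := volume) (p := 2)).restrict _
  have h1 : ∀ u : LTwo R, ∫ x in fluidDomain R, u x * ψ x = inner ℝ u hm.toLp := by
    intro u
    rw [L2.inner_def]
    refine integral_congr_ae ?_
    filter_upwards [hm.coeFn_toLp] with x hx
    simp [hx, mul_comm]
  simp only [h1]
  fun_prop

/-- `∂ₓʲ` as a continuous linear map from `H^k(ℰ)` to `L²(ℰ)`. -/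
def dxL (j : Fin (k + 1)) : Sobolev R k →L[ℝ] LTwo R :=
  (PiLp.proj 2 (fun _ : Fin (k + 1) => LTwo R) j).comp (Sobolev R k).subtypeL

theorem dxL_coe (j : Fin (k + 1)) (u : Sobolev R k) : ⇑(dxL j u) = dx j u := rfl

theorem memLp_dx (j : Fin (k + 1)) (u : Sobolev R k) : MemLp (dx j u) 2 (fluidMeasure R) :=
  Lp.memLp _

theorem dx_add (j : Fin (k + 1)) (u v : Sobolev R k) :
    dx j (u + v) =ᵐ[fluidMeasure R] fun x => dx j u x + dx j v x := Lp.coeFn_add _ _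

theorem dx_neg (j : Fin (k + 1)) (u : Sobolev R k) :
    dx j (-u) =ᵐ[fluidMeasure R] fun x => -dx j u x := Lp.coeFn_neg _

theorem dx_smul (j : Fin (k + 1)) (a : ℝ) (u : Sobolev R k) :
    dx j (a • u) =ᵐ[fluidMeasure R] fun x => a * dx j u x := Lp.coeFn_smul _ _

theorem norm_dxL_le (j : Fin (k + 1)) (u : Sobolev R k) : ‖dxL j u‖ ≤ ‖u‖ :=
  PiLp.norm_apply_le u.1 j

theorem norm_sq_eq_sum (u : Sobolev R k) : ‖u‖ ^ 2 = ∑ j, ‖dxL j u‖ ^ 2 :=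
  PiLp.norm_sq_eq_of_L2 _ u.1

/-- For a fixed test function both sides of the weak derivative identity are continuous in the `L²`
norm, so the space is an intersection of closed sets. Completeness follows. -/
theorem isClosed_sobolev : IsClosed (Sobolev R k : Set (PiLp 2 fun _ : Fin (k + 1) => LTwo R)) := by
  have h : (Sobolev R k : Set (PiLp 2 fun _ : Fin (k + 1) => LTwo R)) =
      ⋂ j : Fin k, ⋂ φ : ℝ → ℝ, ⋂ _ : ContDiff ℝ ∞ φ, ⋂ _ : HasCompactSupport φ,
        ⋂ _ : tsupport φ ⊆ fluidDomain R, {u | ∫ x in fluidDomain R, u j.castSucc x * deriv φ x =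
          -∫ x in fluidDomain R, u j.succ x * φ x} := by
    ext u
    simp only [mem_iInter, mem_ofPred_eq]
    exact forall_congr' fun j => hasWeakDeriv_iff_of_lTwo _ _
  rw [h]
  refine isClosed_iInter fun j => isClosed_iInter fun φ => isClosed_iInter fun hφ =>
    isClosed_iInter fun hc => isClosed_iInter fun _ => isClosed_eq ?_ ?_
  · exact (continuous_integral_mul (hφ.continuous_deriv (by simp)) hc.deriv).comp
      (PiLp.continuous_apply 2 _ _)
  · have h1 : Continuous fun u : PiLp 2 fun _ : Fin (k + 1) => LTwo R =>
        ∫ x in fluidDomain R, u j.succ x * φ x :=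
      (continuous_integral_mul hφ.continuous hc).comp (PiLp.continuous_apply 2 _ _)
    exact h1.neg

instance : CompleteSpace (Sobolev R k) := isClosed_sobolev.completeSpace_coe

/-- The weak derivative `∂ₓ : H^{k+1}(ℰ) → H^k(ℰ)`. -/
def tail : Sobolev R (k + 1) →L[ℝ] Sobolev R k :=
  LinearMap.mkContinuous
    { toFun := fun u => ⟨WithLp.toLp 2 fun j => u.1 j.succ, fun j => u.2 j.succ⟩
      map_add' := fun _ _ => rfl
      map_smul' := fun _ _ => rfl } 1 (fun u => by
    rw [one_mul]
    refine le_of_sq_le_sq ?_ (norm_nonneg _)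
    rw [norm_sq_eq_sum, norm_sq_eq_sum u, Fin.sum_univ_succ (n := k + 1)]
    exact le_add_of_nonneg_left (sq_nonneg ‖dxL 0 u‖))

/-- The inclusion `H^{k+1}(ℰ) → H^k(ℰ)`. -/
def incl : Sobolev R (k + 1) →L[ℝ] Sobolev R k :=
  LinearMap.mkContinuous
    { toFun := fun u => ⟨WithLp.toLp 2 fun j => u.1 j.castSucc, fun j => u.2 j.castSucc⟩
      map_add' := fun _ _ => rfl
      map_smul' := fun _ _ => rfl } 1 (fun u => by
    rw [one_mul]
    refine le_of_sq_le_sq ?_ (norm_nonneg _)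
    rw [norm_sq_eq_sum, norm_sq_eq_sum u, Fin.sum_univ_castSucc (n := k + 1)]
    exact le_add_of_nonneg_right (sq_nonneg ‖dxL (Fin.last _) u‖))

theorem incl_tail (u : Sobolev R (k + 2)) : incl (tail u) = tail (incl u) := rfl

theorem norm_tail_le (u : Sobolev R (k + 1)) : ‖tail u‖ ≤ ‖u‖ := by
  refine le_of_sq_le_sq ?_ (norm_nonneg _)
  rw [norm_sq_eq_sum, norm_sq_eq_sum u, Fin.sum_univ_succ (n := k + 1)]
  exact le_add_of_nonneg_left (sq_nonneg ‖dxL 0 u‖)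

theorem norm_incl_le (u : Sobolev R (k + 1)) : ‖incl u‖ ≤ ‖u‖ := by
  refine le_of_sq_le_sq ?_ (norm_nonneg _)
  rw [norm_sq_eq_sum, norm_sq_eq_sum u, Fin.sum_univ_castSucc (n := k + 1)]
  exact le_add_of_nonneg_right (sq_nonneg ‖dxL (Fin.last _) u‖)

theorem norm_sq_eq_add_tail (u : Sobolev R (k + 1)) :
    ‖u‖ ^ 2 = ‖dxL 0 u‖ ^ 2 + ‖tail u‖ ^ 2 := by
  rw [norm_sq_eq_sum, norm_sq_eq_sum (tail u), Fin.sum_univ_succ]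
  rfl

theorem norm_le_add_tail (u : Sobolev R (k + 1)) : ‖u‖ ≤ ‖dxL 0 u‖ + ‖tail u‖ := by
  refine le_of_sq_le_sq ?_ (by positivity)
  rw [norm_sq_eq_add_tail]
  nlinarith [norm_nonneg (dxL 0 u), norm_nonneg (tail u)]

theorem hasWeakDeriv_dx (u : Sobolev R (k + 1)) :
    HasWeakDeriv (fluidDomain R) (dx 0 u) (dx 1 u) := u.2 0

/-- Uniqueness of weak derivatives propagates equality from one entry of the tuple to the next. -/
theorem sobolev_ext {u v : Sobolev R k} (h : dx 0 u =ᵐ[fluidMeasure R] dx 0 v) : u = v := by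
  refine Subtype.ext (PiLp.ext fun j => ?_)
  induction j using Fin.induction with
  | zero => exact Lp.ext h
  | succ i ih =>
    have h1 := u.2 i
    rw [ih] at h1
    exact Lp.ext (h1.unique (v.2 i))

/-- The element of `H^{k+1}(ℰ)` with prescribed value and weak derivative. -/
def consSobolev (f : LTwo R) (w : Sobolev R k) (h : HasWeakDeriv (fluidDomain R) f (dx 0 w)) :
    Sobolev R (k + 1) :=
  ⟨WithLp.toLp 2 (Fin.cons f fun j => w.1 j), fun j => by
    induction j using Fin.cases with
    | zero => exact h
    | succ i => exact w.2 i⟩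

theorem tail_consSobolev (f : LTwo R) (w : Sobolev R k)
    (h : HasWeakDeriv (fluidDomain R) f (dx 0 w)) : tail (consSobolev f w h) = w := rfl

theorem dxL_zero_consSobolev (f : LTwo R) (w : Sobolev R k)
    (h : HasWeakDeriv (fluidDomain R) f (dx 0 w)) : dxL 0 (consSobolev f w h) = f := rfl

/-- A square integrable function whose weak derivative is in `H^k(ℰ)` is in `H^{k+1}(ℰ)`. -/
theorem exists_sobolev_succ {f : ℝ → ℝ} (hf : MemLp f 2 (fluidMeasure R)) (w : Sobolev R k)
    (h : HasWeakDeriv (fluidDomain R) f (dx 0 w)) :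
    ∃ u : Sobolev R (k + 1), dx 0 u =ᵐ[fluidMeasure R] f ∧ tail u = w :=
  ⟨consSobolev hf.toLp w (h.congr hf.coeFn_toLp.symm EventuallyEq.rfl), hf.coeFn_toLp, rfl⟩

/-! ### Continuous representatives, integration by parts and boundary values. -/

section Representative

variable [hR : Fact (0 < R)]

theorem exists_isPrimitive_dx (u : Sobolev R (k + 1)) :
    ∃ f g, IsPrimitive f g ∧ dx 0 u =ᵐ[fluidMeasure R] f ∧ dx 1 u =ᵐ[fluidMeasure R] g ∧
      ∀ x ∈ Icc (-R) R, f x ∈ uIcc (f (-R)) (f R) :=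
  (hasWeakDeriv_dx u).exists_isPrimitive hR.out
    (locallyIntegrable_indicator_of_memLp (memLp_dx 1 u))

/-- The absolutely continuous representative of `u ∈ H^{k+1}(ℰ)`, extended to `ℝ`. -/
def rep (u : Sobolev R (k + 1)) : ℝ → ℝ := (exists_isPrimitive_dx u).choose

/-- The derivative of the absolutely continuous representative. -/
def repDeriv (u : Sobolev R (k + 1)) : ℝ → ℝ := (exists_isPrimitive_dx u).choose_spec.choose

theorem isPrimitive_rep (u : Sobolev R (k + 1)) : IsPrimitive (rep u) (repDeriv u) :=
  (exists_isPrimitive_dx u).choose_spec.choose_spec.1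

theorem dx_zero_ae_eq_rep (u : Sobolev R (k + 1)) : dx 0 u =ᵐ[fluidMeasure R] rep u :=
  (exists_isPrimitive_dx u).choose_spec.choose_spec.2.1

theorem dx_one_ae_eq_repDeriv (u : Sobolev R (k + 1)) : dx 1 u =ᵐ[fluidMeasure R] repDeriv u :=
  (exists_isPrimitive_dx u).choose_spec.choose_spec.2.2.1

theorem rep_mem_uIcc (u : Sobolev R (k + 1)) {x : ℝ} (hx : x ∈ Icc (-R) R) :
    rep u x ∈ uIcc (rep u (-R)) (rep u R) :=
  (exists_isPrimitive_dx u).choose_spec.choose_spec.2.2.2 x hx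

theorem continuous_rep (u : Sobolev R (k + 1)) : Continuous (rep u) := (isPrimitive_rep u).continuous

theorem rep_eq_of_ae_eq (u : Sobolev R (k + 1)) {f : ℝ → ℝ} (hf : Continuous f)
    (h : dx 0 u =ᵐ[fluidMeasure R] f) {x : ℝ} (hx : x ∈ closedDomain R) : rep u x = f x :=
  eqOn_closedDomain_of_ae_eq (continuous_rep u) hf ((dx_zero_ae_eq_rep u).symm.trans h) hx

theorem memLp_rep (u : Sobolev R (k + 1)) : MemLp (rep u) 2 (fluidMeasure R) :=
  (memLp_dx 0 u).ae_eq (dx_zero_ae_eq_rep u)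

theorem memLp_repDeriv (u : Sobolev R (k + 1)) : MemLp (repDeriv u) 2 (fluidMeasure R) :=
  (memLp_dx 1 u).ae_eq (dx_one_ae_eq_repDeriv u)

theorem integrable_rep_mul (u v : Sobolev R (k + 1)) :
    Integrable (fun x => rep u x * rep v x) (fluidMeasure R) :=
  integrable_mul_lTwo (memLp_rep u) (memLp_rep v)

theorem integrable_deriv_rep_mul (u v : Sobolev R (k + 1)) :
    Integrable (fun x => repDeriv u x * rep v x + rep u x * repDeriv v x) (fluidMeasure R) :=
  (integrable_mul_lTwo (memLp_repDeriv u) (memLp_rep v)).add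
    (integrable_mul_lTwo (memLp_rep u) (memLp_repDeriv v))

theorem integral_Ioi_deriv_rep_mul (u v : Sobolev R (k + 1)) {x : ℝ} (hx : R ≤ x) :
    ∫ t in Ioi x, (repDeriv u t * rep v t + rep u t * repDeriv v t) = -(rep u x * rep v x) := by
  have hsub : Ioi x ⊆ fluidDomain R := (Ioi_subset_Ioi hx).trans subset_union_right
  exact ((isPrimitive_rep u).mul (isPrimitive_rep v)).integral_Ioi
    (IntegrableOn.mono_set (integrable_rep_mul u v) hsub)
    (IntegrableOn.mono_set (integrable_deriv_rep_mul u v) hsub)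

theorem integral_Iio_deriv_rep_mul (u v : Sobolev R (k + 1)) {x : ℝ} (hx : x ≤ -R) :
    ∫ t in Iio x, (repDeriv u t * rep v t + rep u t * repDeriv v t) = rep u x * rep v x := by
  have hsub : Iio x ⊆ fluidDomain R := (Iio_subset_Iio hx).trans subset_union_left
  exact ((isPrimitive_rep u).mul (isPrimitive_rep v)).integral_Iio
    (IntegrableOn.mono_set (integrable_rep_mul u v) hsub)
    (IntegrableOn.mono_set (integrable_deriv_rep_mul u v) hsub)

/-- Integration by parts on `ℰ`. -/
theorem integral_deriv_mul_add (u v : Sobolev R (k + 1)) :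
    ∫ x, (dx 1 u x * dx 0 v x + dx 0 u x * dx 1 v x) ∂fluidMeasure R =
      rep u (-R) * rep v (-R) - rep u R * rep v R := by
  have h1 : ∫ x, (dx 1 u x * dx 0 v x + dx 0 u x * dx 1 v x) ∂fluidMeasure R =
      ∫ x, (repDeriv u x * rep v x + rep u x * repDeriv v x) ∂fluidMeasure R := by
    refine integral_congr_ae ?_
    filter_upwards [dx_zero_ae_eq_rep u, dx_zero_ae_eq_rep v, dx_one_ae_eq_repDeriv u,
      dx_one_ae_eq_repDeriv v] with x h1 h2 h3 h4
    rw [h1, h2, h3, h4]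
  have hi := integrable_deriv_rep_mul u v
  have hμ : fluidMeasure R = volume.restrict (Iio (-R) ∪ Ioi R) := rfl
  rw [h1, hμ, setIntegral_union _ measurableSet_Ioi
    (IntegrableOn.mono_set hi subset_union_left) (IntegrableOn.mono_set hi subset_union_right),
    integral_Ioi_deriv_rep_mul u v le_rfl, integral_Iio_deriv_rep_mul u v le_rfl]
  · ring
  · rw [Set.disjoint_left]
    intro x h2 h3
    have := hR.out
    simp only [mem_Iio, mem_Ioi] at h2 h3
    linarith

/-- On a half-line from `x` to infinity inside the domain, `u(x)²` is up to sign the integral of `2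
u u'`, and `|2 u u'| ≤ u² + u'²`. -/
theorem abs_rep_le (u : Sobolev R (k + 1)) {x : ℝ} (hx : x ∈ closedDomain R) :
    |rep u x| ≤ ‖u‖ := by
  have hI : ∀ s ⊆ fluidDomain R,
      |∫ t in s, (repDeriv u t * rep u t + rep u t * repDeriv u t)| ≤ ‖u‖ ^ 2 := by
    intro s hs
    have hi1 : Integrable (fun t => rep u t ^ 2) (fluidMeasure R) := by
      simpa only [sq] using integrable_rep_mul u u
    have hi2 : Integrable (fun t => repDeriv u t ^ 2) (fluidMeasure R) := by
      simpa only [sq] using integrable_mul_lTwo (memLp_repDeriv u) (memLp_repDeriv u)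
    have hi3 : IntegrableOn (fun t => rep u t ^ 2 + repDeriv u t ^ 2) (fluidDomain R) := hi1.add hi2
    calc |∫ t in s, (repDeriv u t * rep u t + rep u t * repDeriv u t)|
        ≤ ∫ t in s, (rep u t ^ 2 + repDeriv u t ^ 2) := by
          rw [← Real.norm_eq_abs]
          refine norm_integral_le_of_norm_le (IntegrableOn.mono_set hi3 hs)
            (Eventually.of_forall fun t => ?_)
          rw [Real.norm_eq_abs, abs_le]
          constructor <;> nlinarith [sq_nonneg (rep u t + repDeriv u t),
            sq_nonneg (rep u t - repDeriv u t)]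
      _ ≤ ∫ t in fluidDomain R, (rep u t ^ 2 + repDeriv u t ^ 2) :=
          setIntegral_mono_set hi3 (Eventually.of_forall fun t => by
            change 0 ≤ rep u t ^ 2 + repDeriv u t ^ 2; positivity) hs.eventuallyLE
      _ = ‖dxL 0 u‖ ^ 2 + ‖dxL 1 u‖ ^ 2 := by
          rw [integral_add hi1 hi2, ← integral_sq_eq_norm_sq, ← integral_sq_eq_norm_sq]
          congr 1
          · exact integral_congr_ae ((dx_zero_ae_eq_rep u).mono fun t ht => by
              simp only [dxL_coe, ht])
          · exact integral_congr_ae ((dx_one_ae_eq_repDeriv u).mono fun t ht => by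
              simp only [dxL_coe, ht])
      _ ≤ ‖u‖ ^ 2 := by
          rw [norm_sq_eq_add_tail]
          have : ‖dxL 1 u‖ ≤ ‖tail u‖ := norm_dxL_le 0 (tail u)
          gcongr
  refine abs_le_of_sq_le_sq ?_ (norm_nonneg _)
  rcases hx with hx | hx
  · have h1 := hI (Iio x) ((Iio_subset_Iio hx).trans subset_union_left)
    rw [integral_Iio_deriv_rep_mul u u hx] at h1
    nlinarith [abs_le.1 h1]
  · have h1 := hI (Ioi x) ((Ioi_subset_Ioi hx).trans subset_union_right)
    rw [integral_Ioi_deriv_rep_mul u u hx] at h1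
    nlinarith [abs_le.1 h1]

theorem rep_add (u v : Sobolev R (k + 1)) {x : ℝ} (hx : x ∈ closedDomain R) :
    rep (u + v) x = rep u x + rep v x := by
  refine rep_eq_of_ae_eq _ ((continuous_rep u).add (continuous_rep v)) ?_ hx
  filter_upwards [dx_add 0 u v, dx_zero_ae_eq_rep u, dx_zero_ae_eq_rep v] with x h1 h2 h3
  rw [h1, h2, h3, Pi.add_apply]

theorem rep_smul (a : ℝ) (u : Sobolev R (k + 1)) {x : ℝ} (hx : x ∈ closedDomain R) :
    rep (a • u) x = a * rep u x := by
  refine rep_eq_of_ae_eq _ (continuous_const.mul (continuous_rep u)) ?_ hx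
  filter_upwards [dx_smul 0 a u, dx_zero_ae_eq_rep u] with x h1 h2
  rw [h1, h2, Pi.mul_apply]

/-- Evaluation of the continuous representative at a point of the closed domain. -/
def evalL (x : closedDomain R) : Sobolev R (k + 1) →L[ℝ] ℝ :=
  LinearMap.mkContinuous
    { toFun := fun u => rep u x
      map_add' := fun u v => rep_add u v x.2
      map_smul' := fun a u => rep_smul a u x.2 } 1
    fun u => by rw [one_mul]; exact abs_rep_le u x.2

theorem evalL_apply (x : closedDomain R) (u : Sobolev R (k + 1)) : evalL x u = rep u x := rfl

theorem rep_incl (u : Sobolev R (k + 2)) {x : ℝ} (hx : x ∈ closedDomain R) :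
    rep (incl u) x = rep u x :=
  rep_eq_of_ae_eq _ (continuous_rep u) (dx_zero_ae_eq_rep u) hx

/-- The boundary value at `R`. -/
def evalRight : Sobolev R (k + 1) →L[ℝ] ℝ := evalL ⟨R, right_mem_closedDomain R⟩

/-- The boundary value at `-R`. -/
def evalLeft : Sobolev R (k + 1) →L[ℝ] ℝ := evalL ⟨-R, left_mem_closedDomain R⟩

theorem evalRight_apply (u : Sobolev R (k + 1)) : evalRight u = rep u R := rfl

theorem evalLeft_apply (u : Sobolev R (k + 1)) : evalLeft u = rep u (-R) := rfl

end Representative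

/-- The limit along the essential filter is the ordinary limit of the continuous representative. The
filter is nontrivial, so that limits are unique, because the intervals `(R, b)` have positive
measure. -/
theorem traceRight_eq {f F : ℝ → ℝ} (hF : Continuous F) (h : f =ᵐ[fluidMeasure R] F) :
    traceRight R f = F R := by
  have h1 : ∀ᵐ x, x ∈ fluidDomain R → f x = F x :=
    (ae_restrict_iff' (measurableSet_fluidDomain R)).1 h
  have h2 : f =ᶠ[ae volume ⊓ 𝓝[>] R] F := by
    have h3 : ∀ᶠ x in ae volume ⊓ 𝓝[>] R, x ∈ fluidDomain R → f x = F x := h1.filter_mono inf_le_left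
    have h4 : ∀ᶠ x in ae volume ⊓ 𝓝[>] R, x ∈ Ioi R :=
      Eventually.filter_mono inf_le_right self_mem_nhdsWithin
    filter_upwards [h3, h4] with x h5 h6 using h5 (Or.inr h6)
  have h3 : Tendsto f (ae volume ⊓ 𝓝[>] R) (𝓝 (F R)) :=
    ((hF.tendsto R).mono_left (inf_le_right.trans nhdsWithin_le_nhds)).congr' h2.symm
  have : (ae volume ⊓ 𝓝[>] R).NeBot := by
    rw [inf_neBot_iff]
    intro s hs t ht
    obtain ⟨b, hb, hbt⟩ := mem_nhdsGT_iff_exists_Ioo_subset.1 ht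
    by_contra hne
    have h5 : Ioo R b ⊆ sᶜ := fun x hx hxs => hne ⟨x, hxs, hbt hx⟩
    have h6 := measure_mono_null h5 (mem_ae_iff.1 hs)
    simp [Real.volume_Ioo] at h6
    exact not_lt.2 h6 hb
  exact h3.limUnder_eq

theorem traceLeft_eq {f F : ℝ → ℝ} (hF : Continuous F) (h : f =ᵐ[fluidMeasure R] F) :
    traceLeft R f = F (-R) := by
  have h1 : ∀ᵐ x, x ∈ fluidDomain R → f x = F x :=
    (ae_restrict_iff' (measurableSet_fluidDomain R)).1 h
  have h2 : f =ᶠ[ae volume ⊓ 𝓝[<] (-R)] F := by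
    have h3 : ∀ᶠ x in ae volume ⊓ 𝓝[<] (-R), x ∈ fluidDomain R → f x = F x :=
      h1.filter_mono inf_le_left
    have h4 : ∀ᶠ x in ae volume ⊓ 𝓝[<] (-R), x ∈ Iio (-R) :=
      Eventually.filter_mono inf_le_right self_mem_nhdsWithin
    filter_upwards [h3, h4] with x h5 h6 using h5 (Or.inl h6)
  have h3 : Tendsto f (ae volume ⊓ 𝓝[<] (-R)) (𝓝 (F (-R))) :=
    ((hF.tendsto (-R)).mono_left (inf_le_right.trans nhdsWithin_le_nhds)).congr' h2.symm
  have : (ae volume ⊓ 𝓝[<] (-R)).NeBot := by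
    rw [inf_neBot_iff]
    intro s hs t ht
    obtain ⟨b, hb, hbt⟩ := mem_nhdsLT_iff_exists_Ioo_subset.1 ht
    by_contra hne
    have h5 : Ioo b (-R) ⊆ sᶜ := fun x hx hxs => hne ⟨x, hxs, hbt hx⟩
    have h6 := measure_mono_null h5 (mem_ae_iff.1 hs)
    rw [Real.volume_Ioo, ENNReal.ofReal_eq_zero] at h6
    linarith [mem_Iio.1 hb]
  exact h3.limUnder_eq

theorem jump_eq [Fact (0 < R)] (u : Sobolev R (k + 1)) :
    jump R (dx 0 u) = evalRight u - evalLeft u := by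
  rw [jump, traceRight_eq (continuous_rep u) (dx_zero_ae_eq_rep u),
    traceLeft_eq (continuous_rep u) (dx_zero_ae_eq_rep u)]
  rfl

theorem average_eq [Fact (0 < R)] (u : Sobolev R (k + 1)) :
    average R (dx 0 u) = (evalRight u + evalLeft u) / 2 := by
  rw [average, traceRight_eq (continuous_rep u) (dx_zero_ae_eq_rep u),
    traceLeft_eq (continuous_rep u) (dx_zero_ae_eq_rep u)]
  rfl

end SobolevSpaces

/-! ### The algebra property, tame estimates and composition with smooth functions. -/

section Products

variable {R : ℝ} {k : ℕ}

theorem aestronglyMeasurable_dx (j : Fin (k + 1)) (u : Sobolev R k) :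
    AEStronglyMeasurable (dx j u) (fluidMeasure R) := (memLp_dx j u).1

theorem exists_lTwo_mul {f : ℝ → ℝ} (hf : AEStronglyMeasurable f (fluidMeasure R)) {a : ℝ}
    (ha : ∀ᵐ x ∂fluidMeasure R, |f x| ≤ a) (g : LTwo R) :
    ∃ w : LTwo R, w =ᵐ[fluidMeasure R] (fun x => f x * g x) ∧ ‖w‖ ≤ a * ‖g‖ := by
  have hb : ∀ᵐ x ∂fluidMeasure R, ‖f x * g x‖ ≤ a * ‖g x‖ := by
    filter_upwards [ha] with x hx
    rw [norm_mul]
    exact mul_le_mul_of_nonneg_right hx (norm_nonneg _)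
  have hm : MemLp (fun x => f x * g x) 2 (fluidMeasure R) :=
    (Lp.memLp g).of_le_mul (hf.mul (Lp.aestronglyMeasurable g)) hb
  refine ⟨hm.toLp, hm.coeFn_toLp, Lp.norm_le_mul_norm_of_ae_le_mul ?_⟩
  filter_upwards [hb, hm.coeFn_toLp] with x h1 h2
  rwa [h2]

section Algebra

variable [hR : Fact (0 < R)]

theorem ae_abs_dx_le (u : Sobolev R (k + 1)) : ∀ᵐ x ∂fluidMeasure R, |dx 0 u x| ≤ ‖u‖ := by
  filter_upwards [dx_zero_ae_eq_rep u, ae_restrict_mem (measurableSet_fluidDomain R)] with x h1 h2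
  rw [h1]
  exact abs_rep_le u (fluidDomain_subset_closedDomain R h2)

theorem hasWeakDeriv_mul (u v : Sobolev R (k + 1)) :
    HasWeakDeriv (fluidDomain R) (fun x => dx 0 u x * dx 0 v x)
      (fun x => dx 1 u x * dx 0 v x + dx 0 u x * dx 1 v x) := by
  refine (((isPrimitive_rep u).mul (isPrimitive_rep v)).hasWeakDeriv (fluidDomain R)).congr ?_ ?_
  · filter_upwards [dx_zero_ae_eq_rep u, dx_zero_ae_eq_rep v] with x h1 h2
    rw [h1, h2]
  · filter_upwards [dx_zero_ae_eq_rep u, dx_zero_ae_eq_rep v, dx_one_ae_eq_repDeriv u,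
      dx_one_ae_eq_repDeriv v] with x h1 h2 h3 h4
    rw [h1, h2, h3, h4]

/-- The sup bounds `a`, `b` are kept apart from the Sobolev norms: this is what later yields an
estimate of `u²` linear in the `H¹` norm. -/
theorem exists_mul_one {u v : Sobolev R 1} {a b : ℝ}
    (ha : ∀ᵐ x ∂fluidMeasure R, |dx 0 u x| ≤ a) (hb : ∀ᵐ x ∂fluidMeasure R, |dx 0 v x| ≤ b) :
    ∃ w : Sobolev R 1, dx 0 w =ᵐ[fluidMeasure R] (fun x => dx 0 u x * dx 0 v x) ∧
      ‖w‖ ≤ a * ‖dxL 0 v‖ + (b * ‖dxL 1 u‖ + a * ‖dxL 1 v‖) := by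
  obtain ⟨w₀, h₀, n₀⟩ := exists_lTwo_mul (aestronglyMeasurable_dx 0 u) ha (dxL 0 v)
  obtain ⟨w₁, h₁, n₁⟩ := exists_lTwo_mul (aestronglyMeasurable_dx 0 v) hb (dxL 1 u)
  obtain ⟨w₂, h₂, n₂⟩ := exists_lTwo_mul (aestronglyMeasurable_dx 0 u) ha (dxL 1 v)
  -- At order `0` the tuple has one entry and there is no derivative condition to check.
  let t : Sobolev R 0 := ⟨WithLp.toLp 2 fun _ => w₁ + w₂, fun j => j.elim0⟩
  have ht : dx 0 t =ᵐ[fluidMeasure R] fun x => dx 1 u x * dx 0 v x + dx 0 u x * dx 1 v x := by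
    have : dx 0 t = ⇑(w₁ + w₂) := rfl
    rw [this]
    filter_upwards [h₁, h₂, Lp.coeFn_add w₁ w₂] with x e1 e2 e3
    rw [e3, Pi.add_apply, e1, e2, mul_comm (dx 0 v x)]
    rfl
  have hw := (hasWeakDeriv_mul u v).congr h₀.symm ht.symm
  refine ⟨consSobolev w₀ t hw, h₀, (norm_le_add_tail _).trans ?_⟩
  have n3 : ‖t‖ = ‖w₁ + w₂‖ := by
    have h := norm_sq_eq_sum t
    rw [Fin.sum_univ_one] at h
    exact (sq_eq_sq₀ (norm_nonneg _) (norm_nonneg _)).1 h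
  rw [tail_consSobolev, dxL_zero_consSobolev, n3]
  exact add_le_add n₀ ((norm_add_le _ _).trans (add_le_add n₁ n₂))

/-- Induction through the Leibniz rule: the derivative `u'v + uv'` is a sum of two products one
order lower. The base case uses the embedding in the bounded functions. -/
theorem exists_mul (k : ℕ) : ∃ C, 0 ≤ C ∧ ∀ u v : Sobolev R (k + 1), ∃ w : Sobolev R (k + 1),
    dx 0 w =ᵐ[fluidMeasure R] (fun x => dx 0 u x * dx 0 v x) ∧ ‖w‖ ≤ C * ‖u‖ * ‖v‖ := by
  induction k with
  | zero =>
    refine ⟨3, by norm_num, fun u v => ?_⟩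
    obtain ⟨w, h, hw⟩ := exists_mul_one (ae_abs_dx_le u) (ae_abs_dx_le v)
    refine ⟨w, h, hw.trans ?_⟩
    have h1 := norm_dxL_le 0 v
    have h2 := norm_dxL_le 1 v
    have h3 := norm_dxL_le 1 u
    have h4 := norm_nonneg u
    have h5 := norm_nonneg v
    nlinarith [mul_le_mul_of_nonneg_left h1 h4, mul_le_mul_of_nonneg_left h2 h4,
      mul_le_mul_of_nonneg_left h3 h5]
  | succ k ih =>
    obtain ⟨C, hC, h⟩ := ih
    refine ⟨1 + 2 * C, by positivity, fun u v => ?_⟩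
    obtain ⟨w₀, h₀, n₀⟩ := exists_lTwo_mul (aestronglyMeasurable_dx 0 u) (ae_abs_dx_le u) (dxL 0 v)
    obtain ⟨w₁, h₁, n₁⟩ := h (tail u) (incl v)
    obtain ⟨w₂, h₂, n₂⟩ := h (incl u) (tail v)
    have ht : dx 0 (w₁ + w₂) =ᵐ[fluidMeasure R]
        fun x => dx 1 u x * dx 0 v x + dx 0 u x * dx 1 v x := by
      filter_upwards [h₁, h₂, dx_add 0 w₁ w₂] with x e1 e2 e3
      rw [e3, e1, e2]
      rfl
    refine ⟨consSobolev w₀ (w₁ + w₂) ((hasWeakDeriv_mul u v).congr h₀.symm ht.symm), h₀,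
      (norm_le_add_tail _).trans ?_⟩
    rw [tail_consSobolev, dxL_zero_consSobolev]
    have h1 := norm_dxL_le 0 v
    have e1 : ‖w₁‖ ≤ C * ‖u‖ * ‖v‖ := n₁.trans (by
      gcongr
      exacts [norm_tail_le u, norm_incl_le v])
    have e2 : ‖w₂‖ ≤ C * ‖u‖ * ‖v‖ := n₂.trans (by
      gcongr
      exacts [norm_incl_le u, norm_tail_le v])
    have e0 : ‖w₀‖ ≤ ‖u‖ * ‖v‖ := n₀.trans (by gcongr)
    linarith [norm_add_le w₁ w₂]

theorem exists_mulL (k : ℕ) : ∃ B : Sobolev R (k + 1) →L[ℝ] Sobolev R (k + 1) →L[ℝ]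
    Sobolev R (k + 1), ∀ u v, dx 0 (B u v) =ᵐ[fluidMeasure R] fun x => dx 0 u x * dx 0 v x := by
  obtain ⟨C, _, h⟩ := exists_mul (R := R) k
  choose B hB hn using h
  refine ⟨LinearMap.mkContinuous₂ (LinearMap.mk₂ ℝ B ?_ ?_ ?_ ?_) C hn, hB⟩
  · intro u u' v
    refine sobolev_ext ?_
    filter_upwards [hB (u + u') v, hB u v, hB u' v, dx_add 0 (B u v) (B u' v), dx_add 0 u u']
      with x h1 h2 h3 h4 h5
    rw [h1, h4, h2, h3, h5, add_mul]
  · intro c u v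
    refine sobolev_ext ?_
    filter_upwards [hB (c • u) v, hB u v, dx_smul 0 c (B u v), dx_smul 0 c u]
      with x h1 h2 h3 h4
    rw [h1, h3, h2, h4, mul_assoc]
  · intro u v v'
    refine sobolev_ext ?_
    filter_upwards [hB u (v + v'), hB u v, hB u v', dx_add 0 (B u v) (B u v'), dx_add 0 v v']
      with x h1 h2 h3 h4 h5
    rw [h1, h4, h2, h3, h5, mul_add]
  · intro c u v
    refine sobolev_ext ?_
    filter_upwards [hB u (c • v), hB u v, dx_smul 0 c (B u v), dx_smul 0 c v]
      with x h1 h2 h3 h4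
    rw [h1, h3, h2, h4]
    ring

/-- Multiplication in the algebra `H^{k+1}(ℰ)`. -/
def mulL : Sobolev R (k + 1) →L[ℝ] Sobolev R (k + 1) →L[ℝ] Sobolev R (k + 1) :=
  (exists_mulL k).choose

theorem dx_mulL (u v : Sobolev R (k + 1)) :
    dx 0 (mulL u v) =ᵐ[fluidMeasure R] fun x => dx 0 u x * dx 0 v x :=
  (exists_mulL k).choose_spec u v

theorem mulL_comm (u v : Sobolev R (k + 1)) : mulL u v = mulL v u := by
  refine sobolev_ext ?_
  filter_upwards [dx_mulL u v, dx_mulL v u] with x h1 h2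
  rw [h1, h2, mul_comm]

theorem rep_mulL (u v : Sobolev R (k + 1)) {x : ℝ} (hx : x ∈ closedDomain R) :
    rep (mulL u v) x = rep u x * rep v x := by
  refine rep_eq_of_ae_eq _ ((continuous_rep u).mul (continuous_rep v)) ?_ hx
  filter_upwards [dx_mulL u v, dx_zero_ae_eq_rep u, dx_zero_ae_eq_rep v] with x h1 h2 h3
  rw [h1, h2, h3, Pi.mul_apply]

theorem incl_mulL (u v : Sobolev R (k + 2)) : incl (mulL u v) = mulL (incl u) (incl v) := by
  refine sobolev_ext ?_
  filter_upwards [dx_mulL u v, dx_mulL (incl u) (incl v)] with x h1 h2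
  rw [h2]
  exact h1

theorem dx_one_mulL (u v : Sobolev R (k + 1)) : dx 1 (mulL u v) =ᵐ[fluidMeasure R]
    fun x => dx 1 u x * dx 0 v x + dx 0 u x * dx 1 v x :=
  (hasWeakDeriv_dx (mulL u v)).unique ((hasWeakDeriv_mul u v).congr (dx_mulL u v).symm
    EventuallyEq.rfl)

theorem tail_mulL (u v : Sobolev R (k + 2)) :
    tail (mulL u v) = mulL (tail u) (incl v) + mulL (incl u) (tail v) := by
  refine sobolev_ext ?_
  filter_upwards [dx_one_mulL u v, dx_mulL (tail u) (incl v), dx_mulL (incl u) (tail v),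
    dx_add 0 (mulL (tail u) (incl v)) (mulL (incl u) (tail v))] with x h1 h2 h3 h4
  rw [h4, h2, h3]
  exact h1

/-- The tame estimate at the lowest order: with a sup bound given, the square is controlled linearly
by the norm. It starts the induction in the blow-up criterion. -/
theorem norm_mulL_self_le_of_bound {u : Sobolev R 1} {a : ℝ}
    (ha : ∀ᵐ x ∂fluidMeasure R, |dx 0 u x| ≤ a) (ha0 : 0 ≤ a) : ‖mulL u u‖ ≤ 3 * a * ‖u‖ := by
  obtain ⟨w, h, hw⟩ := exists_mul_one ha ha
  have : mulL u u = w := sobolev_ext ((dx_mulL u u).trans h.symm)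
  rw [this]
  refine hw.trans ?_
  have h1 := mul_le_mul_of_nonneg_left (norm_dxL_le 0 u) ha0
  have h2 := mul_le_mul_of_nonneg_left (norm_dxL_le 1 u) ha0
  linarith

/-- The tame estimate at higher order: since `(u²)' = 2uu'`, one of the two factors can always be
measured with one derivative fewer. A bound at the lower order thus makes the square grow at most
linearly. -/
theorem norm_mulL_self_le_incl : ∃ C, 0 ≤ C ∧ ∀ u : Sobolev R (k + 2),
    ‖mulL u u‖ ≤ C * ‖incl u‖ * ‖u‖ := by
  set B : Sobolev R (k + 1) →L[ℝ] Sobolev R (k + 1) →L[ℝ] Sobolev R (k + 1) := mulL with hB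
  refine ⟨1 + 2 * ‖B‖, by positivity, fun u => (norm_le_add_tail _).trans ?_⟩
  have h0 : ‖dxL 0 (mulL u u)‖ ≤ ‖incl u‖ * ‖u‖ := by
    obtain ⟨w, h, hw⟩ := exists_lTwo_mul (aestronglyMeasurable_dx 0 u) (ae_abs_dx_le (incl u))
      (dxL 0 u)
    have e : dxL 0 (mulL u u) = w := Lp.ext ((dx_mulL u u).trans h.symm)
    rw [e]
    exact hw.trans (mul_le_mul_of_nonneg_left (norm_dxL_le 0 u) (norm_nonneg _))
  have h1 : ‖mulL (tail u) (incl u)‖ ≤ ‖B‖ * ‖u‖ * ‖incl u‖ :=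
    (B.le_opNorm₂ (tail u) (incl u)).trans (by gcongr; exact norm_tail_le u)
  rw [tail_mulL, mulL_comm (incl u)]
  linarith [norm_add_le (mulL (tail u) (incl u)) (mulL (tail u) (incl u))]

/-- Inside `[-R, R]` the representative lies between its boundary values. Hence a composition `F ∘
rep u` makes sense on the whole line as soon as it does on the closed domain. -/
theorem rep_mem_of_forall_closedDomain {u : Sobolev R (k + 1)} {J : Set ℝ} (hJ : Convex ℝ J)
    (hu : ∀ x ∈ closedDomain R, rep u x ∈ J) (x : ℝ) : rep u x ∈ J := by
  by_cases hx : x ∈ Icc (-R) R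
  · exact hJ.ordConnected.uIcc_subset (hu _ (left_mem_closedDomain R))
      (hu _ (right_mem_closedDomain R)) (rep_mem_uIcc u hx)
  · refine hu x ?_
    by_contra h
    simp only [closedDomain, mem_union, mem_Iic, mem_Ici, not_or, not_le] at h
    exact hx ⟨h.1.le, h.2.le⟩

/-- Composition with a smooth function vanishing at `0` preserves `H^{k+1}(ℰ)`. -/
theorem exists_comp {J O : Set ℝ} (hJ : IsCompact J) (hJc : Convex ℝ J) (hJ0 : (0 : ℝ) ∈ J)
    (hO : IsOpen O) (hJO : J ⊆ O) (k : ℕ) : ∀ (F : ℝ → ℝ), ContDiffOn ℝ ∞ F O → F 0 = 0 →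
    ∀ u : Sobolev R (k + 1), (∀ x ∈ closedDomain R, rep u x ∈ J) →
      ∃ w : Sobolev R (k + 1), dx 0 w =ᵐ[fluidMeasure R] fun x => F (dx 0 u x) := by
  have base : ∀ (k : ℕ) (F : ℝ → ℝ), ContDiffOn ℝ ∞ F O → F 0 = 0 →
      ∀ u : Sobolev R (k + 1), (∀ x ∈ closedDomain R, rep u x ∈ J) →
      MemLp (fun x => F (dx 0 u x)) 2 (fluidMeasure R) ∧
      MemLp (fun x => deriv F (dx 0 u x) * dx 1 u x) 2 (fluidMeasure R) ∧
      HasWeakDeriv (fluidDomain R) (fun x => F (dx 0 u x))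
        (fun x => deriv F (dx 0 u x) * dx 1 u x) := by
    intro k F hF hF0 u hu
    have hF1 : ContDiffOn ℝ 1 F O := hF.of_le (by exact_mod_cast le_top)
    have hu' := rep_mem_of_forall_closedDomain hJc hu
    have hp := (isPrimitive_rep u).comp hO (fun x => hJO (hu' x)) hF1
    have e1 : (fun x => F (rep u x)) =ᵐ[fluidMeasure R] fun x => F (dx 0 u x) :=
      (dx_zero_ae_eq_rep u).mono fun x hx => by simp only [hx]
    have e2 : (fun x => deriv F (rep u x) * repDeriv u x) =ᵐ[fluidMeasure R]
        fun x => deriv F (dx 0 u x) * dx 1 u x := by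
      filter_upwards [dx_zero_ae_eq_rep u, dx_one_ae_eq_repDeriv u] with x h1 h2
      rw [h1, h2]
    refine ⟨?_, ?_, (hp.hasWeakDeriv _).congr e1 e2⟩
    · obtain ⟨K, hK⟩ := (hF1.mono hJO).exists_lipschitzOnWith one_ne_zero hJc hJ
      refine MemLp.ae_eq e1 ((memLp_rep u).of_le_mul (c := K)
        hp.continuous.aestronglyMeasurable (Eventually.of_forall fun x => ?_))
      have := hK.dist_le_mul _ (hu' x) _ hJ0
      simpa [hF0] using this
    · have hc : ContinuousOn (deriv F) J := (hF1.continuousOn_deriv_of_isOpen hO le_rfl).mono hJO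
      obtain ⟨K, hK⟩ := hJ.exists_bound_of_continuousOn hc
      have hc' : Continuous fun x => deriv F (rep u x) :=
        hc.comp_continuous (continuous_rep u) hu'
      refine MemLp.ae_eq e2 ((memLp_repDeriv u).of_le_mul (c := K)
        (hc'.aestronglyMeasurable.mul (memLp_repDeriv u).1) (Eventually.of_forall fun x => ?_))
      rw [norm_mul]
      exact mul_le_mul_of_nonneg_right (hK _ (hu' x)) (norm_nonneg _)
  induction k with
  | zero =>
    intro F hF hF0 u hu
    obtain ⟨h1, h2, h3⟩ := base 0 F hF hF0 u hu
    let t : Sobolev R 0 := ⟨WithLp.toLp 2 fun _ => h2.toLp, fun j => j.elim0⟩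
    have ht : dx 0 t =ᵐ[fluidMeasure R] fun x => deriv F (dx 0 u x) * dx 1 u x := h2.coeFn_toLp
    obtain ⟨w, hw, _⟩ := exists_sobolev_succ h1 t (h3.congr EventuallyEq.rfl ht.symm)
    exact ⟨w, hw⟩
  | succ k ih =>
    intro F hF hF0 u hu
    obtain ⟨h1, _, h3⟩ := base (k + 1) F hF hF0 u hu
    -- The induction hypothesis requires a function vanishing at `0`, as square integrability on an
    -- unbounded domain does. The constant `deriv F 0` is therefore subtracted here and restored as
    -- the term `F'(0) u'`.
    have hd : ContDiffOn ℝ ∞ (fun y => deriv F y - deriv F 0) O :=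
      (((contDiffOn_infty_iff_deriv_of_isOpen hO).1 hF).2).sub contDiffOn_const
    obtain ⟨w, hw⟩ := ih _ hd (sub_self _) (incl u) fun x hx => by
      rw [rep_incl u hx]; exact hu x hx
    have ht : dx 0 (mulL w (tail u) + deriv F 0 • tail u) =ᵐ[fluidMeasure R]
        fun x => deriv F (dx 0 u x) * dx 1 u x := by
      filter_upwards [dx_add 0 (mulL w (tail u)) (deriv F 0 • tail u), dx_mulL w (tail u), hw,
        dx_smul 0 (deriv F 0) (tail u)] with x e1 e2 e3 e4
      rw [e1, e2, e3, e4]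
      change (deriv F (dx 0 u x) - deriv F 0) * dx 1 u x + deriv F 0 * dx 1 u x = _
      ring
    obtain ⟨w', hw', _⟩ := exists_sobolev_succ h1 _ (h3.congr EventuallyEq.rfl ht.symm)
    exact ⟨w', hw'⟩

end Algebra

end Products

/-! ### The elliptic transmission problem and its solution operator. -/

section EllipticProblem

/-- Lax-Milgram. It will be used with `A v = v`, `B v = v'` and `c` the boundary value; since `α ≥
0` the boundary term only helps, and the form is coercive with constant `min 1 d`. -/
theorem exists_inner_add_inner_eq {V H : Type*} [NormedAddCommGroup V] [InnerProductSpace ℝ V]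
    [CompleteSpace V] [NormedAddCommGroup H] [InnerProductSpace ℝ H] (A B : V →L[ℝ] H)
    (c : V →L[ℝ] ℝ) {d α : ℝ} (hd : 0 < d) (hα : 0 ≤ α)
    (hn : ∀ v, ‖v‖ ^ 2 = ‖A v‖ ^ 2 + ‖B v‖ ^ 2) (g : H) :
    ∃ p, ∀ v, inner ℝ (A p) (A v) + d * inner ℝ (B p) (B v) + α * (c p * c v) =
      inner ℝ g (B v) := by
  let b : V →L[ℝ] V →L[ℝ] ℝ := LinearMap.mkContinuous₂ (LinearMap.mk₂ ℝ
    (fun p v => inner ℝ (A p) (A v) + d * inner ℝ (B p) (B v) + α * (c p * c v))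
    (fun x y z => by simp only [map_add, inner_add_left]; ring)
    (fun c x y => by simp only [map_smul, real_inner_smul_left, smul_eq_mul]; ring)
    (fun x y z => by simp only [map_add, inner_add_right]; ring)
    (fun c x y => by simp only [map_smul, real_inner_smul_right, smul_eq_mul]; ring))
    (‖A‖ * ‖A‖ + d * (‖B‖ * ‖B‖) + α * (‖c‖ * ‖c‖)) (fun x y => by
      have h0 : |inner ℝ (A x) (A y)| ≤ (‖A‖ * ‖x‖) * (‖A‖ * ‖y‖) :=
        (abs_real_inner_le_norm _ _).trans (by gcongr <;> exact A.le_opNorm _)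
      have h1 : |inner ℝ (B x) (B y)| ≤ (‖B‖ * ‖x‖) * (‖B‖ * ‖y‖) :=
        (abs_real_inner_le_norm _ _).trans (by gcongr <;> exact B.le_opNorm _)
      have h2 : |c x * c y| ≤ (‖c‖ * ‖x‖) * (‖c‖ * ‖y‖) := by
        rw [abs_mul]
        gcongr <;> exact c.le_opNorm _
      refine (abs_add_three _ _ _).trans ?_
      rw [abs_mul d, abs_mul α, abs_of_nonneg hα, abs_of_nonneg hd.le]
      linarith [mul_le_mul_of_nonneg_left h1 hd.le, mul_le_mul_of_nonneg_left h2 hα])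
  have hb : ∀ p v, b p v = inner ℝ (A p) (A v) + d * inner ℝ (B p) (B v) + α * (c p * c v) :=
    fun _ _ => rfl
  have hco : IsCoercive b := by
    refine ⟨min 1 d, by positivity, fun u => ?_⟩
    rw [hb, real_inner_self_eq_norm_sq, real_inner_self_eq_norm_sq, mul_assoc, ← sq, hn]
    have h2 := mul_le_mul_of_nonneg_right (min_le_left 1 d) (sq_nonneg ‖A u‖)
    have h3 := mul_le_mul_of_nonneg_right (min_le_right 1 d) (sq_nonneg ‖B u‖)
    have h4 := mul_nonneg hα (mul_self_nonneg (c u))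
    linarith
  refine ⟨hco.continuousLinearEquivOfBilin.symm
    ((InnerProductSpace.toDual ℝ V).symm ((innerSL ℝ g).comp B)), fun v => ?_⟩
  rw [← hb, ← hco.continuousLinearEquivOfBilin_apply, ContinuousLinearEquiv.apply_symm_apply,
    InnerProductSpace.toDual_symm_apply]
  rfl

theorem exists_mem_ker_inner_add_inner_eq {E H : Type*} [NormedAddCommGroup E]
    [InnerProductSpace ℝ E] [CompleteSpace E] [NormedAddCommGroup H] [InnerProductSpace ℝ H]
    (A B : E →L[ℝ] H) (c J : E →L[ℝ] ℝ) {d α : ℝ} (hd : 0 < d) (hα : 0 ≤ α)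
    (hn : ∀ v, ‖v‖ ^ 2 = ‖A v‖ ^ 2 + ‖B v‖ ^ 2) (g : H) :
    ∃ p, J p = 0 ∧ ∀ v, J v = 0 →
      inner ℝ (A p) (A v) + d * inner ℝ (B p) (B v) + α * (c p * c v) = inner ℝ g (B v) := by
  let V : Submodule ℝ E := LinearMap.ker J.toLinearMap
  have hV : IsClosed (V : Set E) := J.isClosed_ker
  have : CompleteSpace V := hV.completeSpace_coe
  obtain ⟨p, hp⟩ := exists_inner_add_inner_eq (A.comp V.subtypeL) (B.comp V.subtypeL)
    (c.comp V.subtypeL) hd hα (fun v => hn v) g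
  exact ⟨p, p.2, fun v hv => hp ⟨v, hv⟩⟩

variable {R δ α : ℝ} {k n : ℕ} [hR : Fact (0 < R)]

theorem exists_sobolev_one_of_isPrimitive {f g : ℝ → ℝ} (h : IsPrimitive f g)
    (hf : MemLp f 2 (fluidMeasure R)) (hg : MemLp g 2 (fluidMeasure R)) :
    ∃ u : Sobolev R 1, dx 0 u =ᵐ[fluidMeasure R] f ∧ dx 1 u =ᵐ[fluidMeasure R] g ∧
      ∀ x ∈ closedDomain R, rep u x = f x := by
  let t : Sobolev R 0 := ⟨WithLp.toLp 2 fun _ => hg.toLp, fun j => j.elim0⟩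
  have ht : dx 0 t =ᵐ[fluidMeasure R] g := hg.coeFn_toLp
  obtain ⟨u, hu, hut⟩ := exists_sobolev_succ hf t
    ((h.hasWeakDeriv _).congr EventuallyEq.rfl ht.symm)
  refine ⟨u, hu, ?_, fun x hx => rep_eq_of_ae_eq u h.continuous hu hx⟩
  rw [← hut] at ht
  exact ht

theorem exists_sobolev_one_of_contDiff {φ : ℝ → ℝ} (hφ : ContDiff ℝ ∞ φ)
    (hc : HasCompactSupport φ) :
    ∃ u : Sobolev R 1, dx 0 u =ᵐ[fluidMeasure R] φ ∧ dx 1 u =ᵐ[fluidMeasure R] deriv φ ∧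
      ∀ x ∈ closedDomain R, rep u x = φ x :=
  exists_sobolev_one_of_isPrimitive
    (IsPrimitive.of_contDiff (hφ.of_le (by exact_mod_cast le_top)))
    ((hφ.continuous.memLp_of_hasCompactSupport hc (μ := volume) (p := 2)).restrict _)
    (((hφ.continuous_deriv (by simp)).memLp_of_hasCompactSupport hc.deriv
      (μ := volume) (p := 2)).restrict _)

/-- `p` solves `(1 - δ²∂ₓ²) p + ∂ₓ g = 0` on `ℰ` with `⟦p⟧ = 0` and
`δ² ⟦∂ₓ p⟧ - ⟦g⟧ = α ⟨p⟩`. -/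
structure SolvesElliptic (δ α : ℝ) (g : Sobolev R (n + 1)) (p : Sobolev R (n + 2)) : Prop where
  eqn : dxL 0 p - δ ^ 2 • dxL 2 p + dxL 1 g = 0
  jump_zero : evalRight p - evalLeft p = 0
  flux : δ ^ 2 * (evalRight (tail p) - evalLeft (tail p)) - (evalRight g - evalLeft g) =
    α * evalRight p

theorem evalRight_incl (u : Sobolev R (k + 2)) : evalRight (incl u) = evalRight u :=
  rep_incl u (right_mem_closedDomain R)

theorem evalLeft_incl (u : Sobolev R (k + 2)) : evalLeft (incl u) = evalLeft u :=
  rep_incl u (left_mem_closedDomain R)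

/-- The three conditions involve only low derivatives and boundary values, none of which sees the
order of the ambient space. This allows regularity to be raised step by step. -/
theorem solvesElliptic_incl_iff {g : Sobolev R (n + 2)} {p : Sobolev R (n + 3)} :
    SolvesElliptic δ α (incl g) (incl p) ↔ SolvesElliptic δ α g p := by
  have e1 : dxL 0 (incl p) - δ ^ 2 • dxL 2 (incl p) + dxL 1 (incl g) =
      dxL 0 p - δ ^ 2 • dxL 2 p + dxL 1 g := rfl
  constructor
  · intro h
    have h3 := h.flux
    have h2 := h.jump_zero
    rw [← incl_tail, evalRight_incl, evalRight_incl, evalRight_incl, evalLeft_incl,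
      evalLeft_incl] at h3
    rw [evalRight_incl, evalLeft_incl] at h2
    exact ⟨e1 ▸ h.eqn, h2, h3⟩
  · intro h
    refine ⟨e1 ▸ h.eqn, ?_, ?_⟩
    · rw [evalRight_incl, evalLeft_incl, h.jump_zero]
    · rw [← incl_tail, evalRight_incl, evalRight_incl, evalRight_incl, evalLeft_incl,
        evalLeft_incl, h.flux]

theorem exists_forall_inner_eq (hδ : 0 < δ) (hα : 0 ≤ α) (g : LTwo R) :
    ∃ p : Sobolev R 1, evalRight p - evalLeft p = 0 ∧
      ∀ v : Sobolev R 1, evalRight v - evalLeft v = 0 →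
        inner ℝ (dxL 0 p) (dxL 0 v) + δ ^ 2 * inner ℝ (dxL 1 p) (dxL 1 v)
          + α * (evalRight p * evalRight v) = inner ℝ g (dxL 1 v) := by
  have hn : ∀ v : Sobolev R 1, ‖v‖ ^ 2 = ‖dxL 0 v‖ ^ 2 + ‖dxL 1 v‖ ^ 2 := fun v => by
    rw [norm_sq_eq_sum v, Fin.sum_univ_two]
  exact exists_mem_ker_inner_add_inner_eq (dxL 0) (dxL 1) evalRight (evalRight - evalLeft)
    (pow_pos hδ 2) hα hn g

/-- With `P = δ²p' - g`, the weak form tested on functions vanishing at `±R` says `P' = p`; hence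
`P`, and with it `p'`, is in `H¹`. A test function with boundary values `1` then recovers the flux
condition `⟦P⟧ = α p(R)`. -/
theorem exists_solvesElliptic_zero (hδ : 0 < δ) (hα : 0 ≤ α) (g : Sobolev R 1) :
    ∃ p : Sobolev R 2, SolvesElliptic (n := 0) δ α g p := by
  obtain ⟨p, hp, h⟩ := exists_forall_inner_eq hδ hα (dxL 0 g)
  have hδ2 : δ ^ 2 ≠ 0 := by positivity
  have h' : ∀ v : Sobolev R 1, evalRight v - evalLeft v = 0 →
      ∫ x in fluidDomain R, (dx 0 p x * dx 0 v x + (δ ^ 2 * dx 1 p x - dx 0 g x) * dx 1 v x)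
        = -(α * (evalRight p * evalRight v)) := by
    intro v hv
    have h1 := h v hv
    simp only [L2.inner_def] at h1
    have e0 : ∀ x : ℝ, dx 0 p x * dx 0 v x + (δ ^ 2 * dx 1 p x - dx 0 g x) * dx 1 v x =
        (dx 0 p x * dx 0 v x + δ ^ 2 * (dx 1 p x * dx 1 v x)) - dx 0 g x * dx 1 v x := fun x => by
      ring
    have i0 := integrable_mul_lTwo (memLp_dx 0 p) (memLp_dx 0 v)
    have i1 := integrable_mul_lTwo (memLp_dx 1 p) (memLp_dx 1 v)
    have i2 := integrable_mul_lTwo (memLp_dx 0 g) (memLp_dx 1 v)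
    simp only [e0]
    have i3 : Integrable (fun x => dx 0 p x * dx 0 v x + δ ^ 2 * (dx 1 p x * dx 1 v x))
        (fluidMeasure R) := i0.add (i1.const_mul _)
    rw [integral_sub i3 i2, integral_add i0 (i1.const_mul _),
      integral_const_mul]
    simp only [dxL_coe, RCLike.inner_apply, conj_trivial] at h1
    simp only [mul_comm (dx 0 v _), mul_comm (dx 1 v _)] at h1
    linarith
  -- The function `P = δ²p' - g`, whose weak derivative will be `p`.
  have hPm : MemLp (fun x => δ ^ 2 * dx 1 p x - dx 0 g x) 2 (fluidMeasure R) :=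
    ((memLp_dx 1 p).const_mul _).sub (memLp_dx 0 g)
  have hP : HasWeakDeriv (fluidDomain R) (fun x => δ ^ 2 * dx 1 p x - dx 0 g x)
      (dx 0 (incl p)) := by
    refine ⟨locallyIntegrableOn_of_memLp hPm, locallyIntegrableOn_of_memLp (memLp_dx 0 p), ?_⟩
    intro φ hφ hc ht
    obtain ⟨v, hv0, hv1, hvr⟩ := exists_sobolev_one_of_contDiff (R := R) hφ hc
    have hz : ∀ x, x ∉ fluidDomain R → φ x = 0 := fun x hx =>
      image_eq_zero_of_notMem_tsupport fun h => hx (ht h)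
    have hRR := hR.out
    have hvR : evalRight v = 0 := by
      rw [evalRight_apply, hvr R (right_mem_closedDomain R)]
      refine hz R fun h => ?_
      rcases h with h | h
      · have := mem_Iio.1 h; linarith
      · exact lt_irrefl _ (mem_Ioi.1 h)
    have hvL : evalLeft v = 0 := by
      rw [evalLeft_apply, hvr (-R) (left_mem_closedDomain R)]
      refine hz (-R) fun h => ?_
      rcases h with h | h
      · exact lt_irrefl _ (mem_Iio.1 h)
      · have := mem_Ioi.1 h; linarith
    have h1 := h' v (by rw [hvR, hvL, sub_zero])
    have i0 := integrable_mul_lTwo (memLp_dx 0 p) (memLp_dx 0 v)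
    have i1 := integrable_mul_lTwo hPm (memLp_dx 1 v)
    rw [integral_add i0 i1, hvR] at h1
    have e0 : ∫ x in fluidDomain R, dx 0 p x * dx 0 v x = ∫ x in fluidDomain R, dx 0 p x * φ x :=
      integral_congr_ae (hv0.mono fun x hx => by simp only [hx])
    have e1 : ∫ x in fluidDomain R, (δ ^ 2 * dx 1 p x - dx 0 g x) * dx 1 v x =
        ∫ x in fluidDomain R, (δ ^ 2 * dx 1 p x - dx 0 g x) * deriv φ x :=
      integral_congr_ae (hv1.mono fun x hx => by simp only [hx])
    have e2 : dx 0 (incl p) = dx 0 p := rfl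
    rw [e0, e1] at h1
    rw [e2]
    linarith
  obtain ⟨Q, hQ0, hQt⟩ := exists_sobolev_succ hPm (incl p) hP
  have hQ1 : dx 1 Q = dx 0 p := by
    have : dx 1 Q = dx 0 (tail Q) := rfl
    rw [this, hQt]
    rfl
  let r : Sobolev R 1 := (δ ^ 2)⁻¹ • (Q + g)
  have hQr : Q = δ ^ 2 • r - g := by
    simp only [r]
    rw [smul_inv_smul₀ hδ2, add_sub_cancel_right]
  have hr0 : dx 0 r =ᵐ[fluidMeasure R] dx 1 p := by
    filter_upwards [dx_smul 0 (δ ^ 2)⁻¹ (Q + g), dx_add 0 Q g, hQ0] with x h1 h2 h3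
    rw [h1, h2, h3]
    field_simp
    ring
  let q : Sobolev R 2 := consSobolev (dxL 0 p) r
    ((hasWeakDeriv_dx p).congr EventuallyEq.rfl hr0.symm)
  have hqp : incl q = p := sobolev_ext (EventuallyEq.refl _ _)
  have hqt : tail q = r := rfl
  have eR : evalRight q = evalRight p := by rw [← hqp, evalRight_incl]
  have eL : evalLeft q = evalLeft p := by rw [← hqp, evalLeft_incl]
  refine ⟨q, ?_, by rw [eR, eL, hp], ?_⟩
  · have h2 : dxL 2 q = dxL 1 r := rfl
    have h0 : dxL 0 q = dxL 0 p := rfl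
    have h3 : dxL 1 Q = dxL 0 p := Lp.ext (by rw [dxL_coe, dxL_coe, hQ1])
    rw [h2, h0, ← map_smul, ← sub_add_cancel (δ ^ 2 • r) g, ← hQr, map_add, h3]
    abel
  -- A bump function equal to `1` at `±R` is admissible in the weak form, and integration by parts
  -- leaves exactly the jump of `Q`.
  · have hJ : evalRight Q - evalLeft Q = α * evalRight p := by
      let b : ContDiffBump (0 : ℝ) := ⟨R, 2 * R, hR.out, by linarith [hR.out]⟩
      obtain ⟨v, hv0, hv1, hvr⟩ := exists_sobolev_one_of_contDiff (R := R) b.contDiff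
        b.hasCompactSupport
      have hb1 : ∀ x : ℝ, |x| = R → b x = 1 := fun x hx =>
        b.one_of_mem_closedBall (by rw [mem_closedBall_zero_iff, Real.norm_eq_abs, hx])
      have hvR : rep v R = 1 := by
        rw [hvr R (right_mem_closedDomain R)]
        exact hb1 _ (abs_of_pos hR.out)
      have hvL : rep v (-R) = 1 := by
        rw [hvr (-R) (left_mem_closedDomain R)]
        exact hb1 _ (by rw [abs_neg, abs_of_pos hR.out])
      have h1 := h' v (by rw [evalRight_apply, evalLeft_apply, hvR, hvL, sub_self])
      have h2 := integral_deriv_mul_add Q v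
      have h3 : ∫ x in fluidDomain R, (dx 1 Q x * dx 0 v x + dx 0 Q x * dx 1 v x) =
          ∫ x in fluidDomain R, (dx 0 p x * dx 0 v x +
            (δ ^ 2 * dx 1 p x - dx 0 g x) * dx 1 v x) :=
        integral_congr_ae (hQ0.mono fun x hx => by simp only [hx, hQ1])
      rw [h3, h1, hvR, hvL, evalRight_apply v, hvR] at h2
      rw [evalRight_apply Q, evalLeft_apply Q]
      linarith
    rw [eR, ← hJ, hqt, hQr]
    simp only [map_sub, map_smul, smul_eq_mul]
    ring

/-- Elliptic regularity: the equation gives `p'' = δ⁻²(p + g')`, whose right-hand side has one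
derivative more than was known of `p''`. -/
theorem exists_solvesElliptic (hδ : 0 < δ) (hα : 0 ≤ α) (n : ℕ) : ∀ g : Sobolev R (n + 1),
    ∃ p : Sobolev R (n + 2), SolvesElliptic δ α g p := by
  induction n with
  | zero => exact exists_solvesElliptic_zero hδ hα
  | succ n ih =>
    intro g
    obtain ⟨p, hp⟩ := ih (incl g)
    have hδ2 : δ ^ 2 ≠ 0 := by positivity
    let r : Sobolev R (n + 1) := (δ ^ 2)⁻¹ • (incl p + tail g)
    have hr : dxL 0 r = dxL 2 p := by
      have h1 := hp.eqn
      have h2 : dxL 0 r = (δ ^ 2)⁻¹ • (dxL 0 p + dxL 1 (incl g)) := rfl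
      rw [h2, inv_smul_eq_iff₀ hδ2, ← sub_eq_zero, ← h1]
      abel
    have hr' : dx 0 r = dx 2 p := by rw [← dxL_coe, hr, dxL_coe]
    have hw : HasWeakDeriv (fluidDomain R) (dxL 1 p) (dx 0 r) := by
      rw [hr']
      exact hasWeakDeriv_dx (tail p)
    let s : Sobolev R (n + 2) := consSobolev (dxL 1 p) r hw
    let q : Sobolev R (n + 3) := consSobolev (dxL 0 p) s (hasWeakDeriv_dx p)
    have hqp : incl q = p := sobolev_ext (EventuallyEq.refl _ _)
    exact ⟨q, solvesElliptic_incl_iff.1 (hqp ▸ hp)⟩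

theorem SolvesElliptic.sub {g g' : Sobolev R (n + 1)} {p p' : Sobolev R (n + 2)}
    (h : SolvesElliptic δ α g p) (h' : SolvesElliptic δ α g' p') :
    SolvesElliptic δ α (g - g') (p - p') where
  eqn := by
    have h1 := h.eqn
    have h2 := h'.eqn
    rw [← sub_eq_zero.2 (h1.trans h2.symm)]
    simp only [map_sub, smul_sub]
    abel
  jump_zero := by
    simp only [map_sub]
    linarith [h.jump_zero, h'.jump_zero]
  flux := by
    simp only [map_sub]
    linarith [h.flux, h'.flux]

theorem SolvesElliptic.add {g g' : Sobolev R (n + 1)} {p p' : Sobolev R (n + 2)}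
    (h : SolvesElliptic δ α g p) (h' : SolvesElliptic δ α g' p') :
    SolvesElliptic δ α (g + g') (p + p') where
  eqn := by
    have h1 := h.eqn
    have h2 := h'.eqn
    rw [← add_zero (0 : LTwo R)]
    nth_rewrite 1 [← h1]
    rw [← h2]
    simp only [map_add, smul_add]
    abel
  jump_zero := by
    simp only [map_add]
    linarith [h.jump_zero, h'.jump_zero]
  flux := by
    simp only [map_add]
    linarith [h.flux, h'.flux]

theorem SolvesElliptic.smul (c : ℝ) {g : Sobolev R (n + 1)} {p : Sobolev R (n + 2)}
    (h : SolvesElliptic δ α g p) : SolvesElliptic δ α (c • g) (c • p) where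
  eqn := by
    have h1 := congrArg (fun z => c • z) h.eqn
    simp only [smul_zero] at h1
    rw [← h1]
    simp only [map_smul, smul_add, smul_sub]
    rw [smul_comm c (δ ^ 2)]
  jump_zero := by
    simp only [map_smul, smul_eq_mul]
    linear_combination c * h.jump_zero
  flux := by
    simp only [map_smul, smul_eq_mul]
    linear_combination c * h.flux

/-- The energy identity: multiplying `p = δ²p''` by `p` and integrating gives `‖p‖² + δ²‖p'‖² + α
p(R)² = 0`, where all terms are nonnegative. -/
theorem SolvesElliptic.eq_zero (hα : 0 ≤ α) {p : Sobolev R (n + 2)}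
    (h : SolvesElliptic δ α (0 : Sobolev R (n + 1)) p) : p = 0 := by
  have h1 := h.eqn
  have h2 := h.jump_zero
  have h3 := h.flux
  simp only [map_zero, add_zero, sub_zero] at h1 h3
  rw [sub_eq_zero] at h1
  have h4 := integral_deriv_mul_add (tail p) (incl p)
  have e1 : dx 1 (tail p) = dx 2 p := rfl
  have e2 : dx 0 (tail p) = dx 1 p := rfl
  have e3 : dx 0 (incl p) = dx 0 p := rfl
  have e4 : dx 1 (incl p) = dx 1 p := rfl
  rw [e1, e2, e3, e4, rep_incl p (right_mem_closedDomain R), rep_incl p (left_mem_closedDomain R),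
    ← evalRight_apply, ← evalRight_apply, ← evalLeft_apply, ← evalLeft_apply,
    integral_add (integrable_mul_lTwo (memLp_dx 2 p) (memLp_dx 0 p))
      (integrable_mul_lTwo (memLp_dx 1 p) (memLp_dx 1 p))] at h4
  have h5 : δ ^ 2 * ∫ x, dx 2 p x * dx 0 p x ∂fluidMeasure R = ‖dxL 0 p‖ ^ 2 := by
    rw [← integral_sq_eq_norm_sq, ← integral_const_mul]
    refine integral_congr_ae ?_
    have h6 := Lp.coeFn_smul (δ ^ 2) (dxL 2 p)
    rw [← h1] at h6
    filter_upwards [h6] with x hx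
    have hx' : dx 0 p x = δ ^ 2 * dx 2 p x := hx
    simp only [dxL_coe]
    rw [← mul_assoc, ← hx', sq]
  have h7 : 0 ≤ ∫ x, dx 1 p x * dx 1 p x ∂fluidMeasure R :=
    integral_nonneg fun x => mul_self_nonneg _
  have h8 : ‖dxL 0 p‖ ^ 2 ≤ 0 := by
    rw [← h5]
    have h9 : δ ^ 2 * (∫ x, dx 2 p x * dx 0 p x ∂fluidMeasure R +
        ∫ x, dx 1 p x * dx 1 p x ∂fluidMeasure R) = -(α * evalRight p * evalRight p) := by
      rw [h4, ← h3]
      linear_combination (-δ ^ 2 * evalLeft (tail p)) * h2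
    nlinarith [mul_nonneg hα (mul_self_nonneg (evalRight p)), mul_nonneg (sq_nonneg δ) h7]
  have h10 : dxL 0 p = dxL 0 (0 : Sobolev R (n + 2)) := by
    rw [map_zero, ← norm_eq_zero]
    nlinarith [norm_nonneg (dxL 0 p)]
  exact sobolev_ext (by rw [← dxL_coe, h10, dxL_coe])

theorem SolvesElliptic.unique (hα : 0 ≤ α) {g : Sobolev R (n + 1)} {p p' : Sobolev R (n + 2)}
    (h : SolvesElliptic δ α g p) (h' : SolvesElliptic δ α g p') : p = p' := by
  have h1 := h.sub h'
  rw [sub_self] at h1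
  exact sub_eq_zero.1 (h1.eq_zero hα)

/-- Uniqueness makes the solution map linear and its graph the set of pairs satisfying three closed
conditions. The closed graph theorem then gives continuity without quantitative elliptic estimates.
-/
theorem exists_ellipticSolver (hδ : 0 < δ) (hα : 0 ≤ α) (n : ℕ) :
    ∃ S : Sobolev R (n + 1) →L[ℝ] Sobolev R (n + 2), ∀ g, SolvesElliptic δ α g (S g) := by
  choose S hS using exists_solvesElliptic (R := R) hδ hα n
  let L : Sobolev R (n + 1) →ₗ[ℝ] Sobolev R (n + 2) :=
    { toFun := S
      map_add' := fun g g' => (hS _).unique hα ((hS g).add (hS g'))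
      map_smul' := fun c g => (hS _).unique hα ((hS g).smul c) }
  have hL : Continuous L := by
    refine L.continuous_of_isClosed_graph ?_
    have hg : (L.graph : Set (Sobolev R (n + 1) × Sobolev R (n + 2))) =
        {z | dxL 0 z.2 - δ ^ 2 • dxL 2 z.2 + dxL 1 z.1 = 0} ∩
        ({z | evalRight z.2 - evalLeft z.2 = 0} ∩
        {z | δ ^ 2 * (evalRight (tail z.2) - evalLeft (tail z.2)) -
          (evalRight z.1 - evalLeft z.1) = α * evalRight z.2}) := by
      ext z
      simp only [SetLike.mem_coe, LinearMap.mem_graph_iff, mem_inter_iff, mem_ofPred_eq]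
      constructor
      · intro h
        have h1 : SolvesElliptic δ α z.1 z.2 := by rw [h]; exact hS z.1
        exact ⟨h1.eqn, h1.jump_zero, h1.flux⟩
      · rintro ⟨h1, h2, h3⟩
        exact SolvesElliptic.unique hα ⟨h1, h2, h3⟩ (hS z.1)
    rw [hg]
    refine (isClosed_eq ?_ continuous_const).inter
      ((isClosed_eq ?_ continuous_const).inter (isClosed_eq ?_ ?_)) <;> fun_prop
  exact ⟨⟨L, hL⟩, hS⟩

/-- The solution operator `g ↦ p` of the elliptic transmission problem. -/
def ellipticSolver (hδ : 0 < δ) (hα : 0 ≤ α) (n : ℕ) :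
    Sobolev R (n + 1) →L[ℝ] Sobolev R (n + 2) :=
  (exists_ellipticSolver hδ hα n).choose

theorem solvesElliptic_ellipticSolver (hδ : 0 < δ) (hα : 0 ≤ α) (g : Sobolev R (n + 1)) :
    SolvesElliptic δ α g (ellipticSolver hδ hα n g) :=
  (exists_ellipticSolver hδ hα n).choose_spec g

theorem SolvesElliptic.eq_ellipticSolver (hδ : 0 < δ) (hα : 0 ≤ α) {g : Sobolev R (n + 1)}
    {p : Sobolev R (n + 2)} (h : SolvesElliptic δ α g p) : p = ellipticSolver hδ hα n g :=
  h.unique hα (solvesElliptic_ellipticSolver hδ hα g)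

theorem incl_ellipticSolver (hδ : 0 < δ) (hα : 0 ≤ α) (g : Sobolev R (n + 2)) :
    incl (ellipticSolver hδ hα (n + 1) g) = ellipticSolver hδ hα n (incl g) :=
  (solvesElliptic_incl_iff.2 (solvesElliptic_ellipticSolver hδ hα g)).eq_ellipticSolver hδ hα

end EllipticProblem

/-! ### Maximal solutions of autonomous differential equations in a Banach space. -/

section MaximalSolutions

theorem zero_mem_timeInterval {T : EReal} (hT : 0 < T) : (0 : ℝ) ∈ timeInterval T :=
  ⟨le_rfl, by exact_mod_cast hT⟩

theorem timeInterval_coe (τ : ℝ) : timeInterval (τ : EReal) = Ico 0 τ := by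
  ext t
  simp [timeInterval]

theorem mem_timeInterval_of_le {T : EReal} {s t : ℝ} (ht : t ∈ timeInterval T) (hs : 0 ≤ s)
    (hst : s ≤ t) : s ∈ timeInterval T :=
  ⟨hs, (EReal.coe_le_coe_iff.2 hst).trans_lt ht.2⟩

theorem exists_gt_mem_timeInterval {T : EReal} {t : ℝ} (ht : t ∈ timeInterval T) :
    ∃ s, t < s ∧ s ∈ timeInterval T := by
  obtain ⟨s, h1, h2⟩ := EReal.lt_iff_exists_real_btwn.1 ht.2
  have h1' : t < s := by exact_mod_cast h1
  exact ⟨s, h1', ht.1.trans h1'.le, h2⟩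

theorem timeInterval_mem_nhdsGE {T : EReal} {t : ℝ} (ht : t ∈ timeInterval T) :
    timeInterval T ∈ 𝓝[≥] t := by
  obtain ⟨s, hts, hs⟩ := exists_gt_mem_timeInterval ht
  filter_upwards [Icc_mem_nhdsGE hts] with x hx
  exact mem_timeInterval_of_le hs (ht.1.trans hx.1) hx.2

theorem timeInterval_mem_nhds {T : EReal} {t : ℝ} (ht : t ∈ timeInterval T) (h0 : 0 < t) :
    timeInterval T ∈ 𝓝 t := by
  obtain ⟨s, hts, hs⟩ := exists_gt_mem_timeInterval ht
  filter_upwards [Icc_mem_nhds h0 hts] with x hx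
  exact mem_timeInterval_of_le hs hx.1 hx.2

theorem timeInterval_mem_nhdsWithin {T T' : EReal} {t : ℝ} (ht : t ∈ timeInterval T) :
    timeInterval T ∈ 𝓝[timeInterval T'] t := by
  obtain ⟨s, hts, hs⟩ := exists_gt_mem_timeInterval ht
  filter_upwards [mem_nhdsWithin_of_mem_nhds (Iio_mem_nhds hts), self_mem_nhdsWithin] with x h1 h2
  exact mem_timeInterval_of_le hs h2.1 (le_of_lt h1)

theorem convex_timeInterval (T : EReal) : Convex ℝ (timeInterval T) := by
  refine OrdConnected.convex ⟨fun x hx y hy z hz => ?_⟩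
  exact mem_timeInterval_of_le hy (hx.1.trans hz.1) hz.2

theorem uniqueDiffOn_timeInterval (T : EReal) : UniqueDiffOn ℝ (timeInterval T) := by
  intro t ht
  have h := (uniqueDiffOn_Ici t) t self_mem_Ici
  exact (h.mono_nhds (nhdsWithin_le_iff.2 (timeInterval_mem_nhdsGE ht)))

section ODE

variable {E : Type*} [NormedAddCommGroup E] [NormedSpace ℝ E]

/-- `u` solves `u' = F(u)`, `u(0) = u₀` on `[0, T)` with values in `Ω`. -/
structure IsODESolution (F : E → E) (Ω : Set E) (u₀ : E) (T : EReal) (u : ℝ → E) : Prop where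
  pos : 0 < T
  hasDeriv : ∀ t ∈ timeInterval T, HasDerivWithinAt u (F (u t)) (timeInterval T) t
  mem : ∀ t ∈ timeInterval T, u t ∈ Ω
  initial : u 0 = u₀

variable {F : E → E} {Ω : Set E} {u₀ : E} {T T' : EReal} {u v : ℝ → E}

namespace IsODESolution

theorem continuousOn (h : IsODESolution F Ω u₀ T u) : ContinuousOn u (timeInterval T) :=
  fun t ht => (h.hasDeriv t ht).continuousWithinAt

theorem hasDerivWithinAt_Ici (h : IsODESolution F Ω u₀ T u) {t : ℝ} (ht : t ∈ timeInterval T) :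
    HasDerivWithinAt u (F (u t)) (Ici t) t :=
  (h.hasDeriv t ht).mono_of_mem_nhdsWithin (timeInterval_mem_nhdsGE ht)

theorem hasDerivAt (h : IsODESolution F Ω u₀ T u) {t : ℝ} (ht : t ∈ timeInterval T) (h0 : 0 < t) :
    HasDerivAt u (F (u t)) t :=
  (h.hasDeriv t ht).hasDerivAt (timeInterval_mem_nhds ht h0)

/-- On `[0, t]` both solutions are bounded by compactness, so a Lipschitz constant on a single ball
suffices for the uniqueness theorem. -/
theorem eq_of_mem (hL : ∀ r, ∃ K, LipschitzOnWith K F (Metric.closedBall 0 r))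
    (hu : IsODESolution F Ω u₀ T u) (hv : IsODESolution F Ω u₀ T' v) {t : ℝ}
    (ht : t ∈ timeInterval T) (ht' : t ∈ timeInterval T') : u t = v t := by
  have hs : Icc 0 t ⊆ timeInterval T := fun s hs => mem_timeInterval_of_le ht hs.1 hs.2
  have hs' : Icc 0 t ⊆ timeInterval T' := fun s hs => mem_timeInterval_of_le ht' hs.1 hs.2
  obtain ⟨a, ha⟩ := isCompact_Icc.exists_bound_of_continuousOn (hu.continuousOn.mono hs)
  obtain ⟨b, hb⟩ := isCompact_Icc.exists_bound_of_continuousOn (hv.continuousOn.mono hs')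
  obtain ⟨K, hK⟩ := hL (max a b)
  refine ODE_solution_unique_of_mem_Icc_right (v := fun _ => F)
    (s := fun _ => Metric.closedBall 0 (max a b)) (fun _ _ => hK) (hu.continuousOn.mono hs)
    (fun s h => hu.hasDerivWithinAt_Ici (hs ⟨h.1, h.2.le⟩)) (fun s h => ?_)
    (hv.continuousOn.mono hs') (fun s h => hv.hasDerivWithinAt_Ici (hs' ⟨h.1, h.2.le⟩))
    (fun s h => ?_) (hu.initial.trans hv.initial.symm) ⟨ht.1, le_rfl⟩
  · rw [mem_closedBall_zero_iff]
    exact (ha s ⟨h.1, h.2.le⟩).trans (le_max_left _ _)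
  · rw [mem_closedBall_zero_iff]
    exact (hb s ⟨h.1, h.2.le⟩).trans (le_max_right _ _)

theorem contDiffOn (hF : ContDiff ℝ ∞ F) (h : IsODESolution F Ω u₀ T u) :
    ContDiffOn ℝ ∞ u (timeInterval T) := by
  have hd : EqOn (derivWithin u (timeInterval T)) (fun t => F (u t)) (timeInterval T) :=
    fun t ht => (h.hasDeriv t ht).derivWithin (uniqueDiffOn_timeInterval T t ht)
  rw [contDiffOn_infty]
  intro n
  induction n with
  | zero => exact contDiffOn_zero.2 h.continuousOn
  | succ n ih =>
    push_cast
    rw [contDiffOn_succ_iff_derivWithin (uniqueDiffOn_timeInterval T)]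
    refine ⟨fun t ht => (h.hasDeriv t ht).differentiableWithinAt, by simp, ?_⟩
    exact ((hF.of_le (by exact_mod_cast le_top)).comp_contDiffOn ih).congr hd

variable [CompleteSpace E]

/-- On a ball the field is bounded, so a bounded solution is Lipschitz in time and satisfies the
Cauchy criterion at `τ`. -/
theorem exists_tendsto {τ r : ℝ} (hL : ∀ r, ∃ K, LipschitzOnWith K F (Metric.closedBall 0 r))
    (h : IsODESolution F Ω u₀ τ u) (hr : ∀ t ∈ Ico 0 τ, ‖u t‖ ≤ r) :
    ∃ z, Tendsto u (𝓝[<] τ) (𝓝 z) := by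
  have hτ : 0 < τ := by exact_mod_cast h.pos
  obtain ⟨K, hK⟩ := hL (max r 0)
  have hmem : ∀ t ∈ Ico 0 τ, u t ∈ Metric.closedBall (0 : E) (max r 0) := fun t ht => by
    rw [mem_closedBall_zero_iff]
    exact (hr t ht).trans (le_max_left _ _)
  have hb : ∀ t ∈ Ico 0 τ, ‖F (u t)‖₊ ≤ ‖F 0‖₊ + K * (max r 0).toNNReal := by
    intro t ht
    rw [← NNReal.coe_le_coe]
    push_cast
    have h1 := hK.norm_sub_le (hmem t ht) (Metric.mem_closedBall_self (le_max_right r 0))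
    rw [sub_zero] at h1
    have h2 := mem_closedBall_zero_iff.1 (hmem t ht)
    have h3 : ‖F (u t)‖ ≤ ‖F 0‖ + ‖F (u t) - F 0‖ := norm_le_norm_add_norm_sub' _ _
    have h4 : (K : ℝ) * ‖u t‖ ≤ K * max r 0 := by gcongr
    rw [Real.coe_toNNReal _ (le_max_right r 0)]
    linarith
  have hd := h.hasDeriv
  have hcv := convex_timeInterval (τ : EReal)
  rw [timeInterval_coe] at hd hcv
  have hlip := hcv.lipschitzOnWith_of_nnnorm_hasDerivWithin_le hd hb
  have hc : Cauchy (map u (𝓝[<] τ)) :=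
    (cauchy_nhds.mono (nhdsWithin_le_nhds (s := Iio τ))).map_of_le hlip.uniformContinuousOn
      (le_principal_iff.2 (Ico_mem_nhdsLT hτ))
  exact cauchy_map_iff_exists_tendsto.1 hc

end IsODESolution

variable [CompleteSpace E]

theorem exists_isODESolution (hF : ContDiff ℝ ∞ F) (hΩ : IsOpen Ω) (hu₀ : u₀ ∈ Ω) :
    ∃ T u, IsODESolution F Ω u₀ T u := by
  have hF1 : ContDiffAt ℝ 1 F u₀ := (hF.of_le (by exact_mod_cast le_top)).contDiffAt
  obtain ⟨v, hv0, η, hη, hv⟩ :=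
    hF1.exists_forall_mem_closedBall_exists_eq_forall_mem_Ioo_hasDerivAt₀ 0
  have hc : ContinuousAt v 0 := (hv 0 ⟨by linarith, by linarith⟩).continuousAt
  obtain ⟨ρ, hρ, hρΩ⟩ := Metric.mem_nhds_iff.1 (hc.preimage_mem_nhds (hΩ.mem_nhds (hv0 ▸ hu₀)))
  refine ⟨((min η ρ : ℝ) : EReal), v, ?_, ?_, ?_, hv0⟩
  · exact_mod_cast lt_min hη hρ
  · intro t ht
    rw [timeInterval_coe] at ht ⊢
    exact (hv t ⟨by linarith [ht.1], by linarith [ht.2, min_le_left η ρ]⟩).hasDerivWithinAt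
  · intro t ht
    rw [timeInterval_coe] at ht
    refine hρΩ ?_
    rw [mem_ball_zero_iff, Real.norm_eq_abs, abs_of_nonneg ht.1]
    exact ht.2.trans_le (min_le_right _ _)

theorem IsODESolution.exists_extension (hF : ContDiff ℝ ∞ F) (hΩ : IsOpen Ω) {τ : ℝ}
    (hu : IsODESolution F Ω u₀ τ u) {z : E} (hz : z ∈ Ω) (hlim : Tendsto u (𝓝[<] τ) (𝓝 z)) :
    ∃ τ' > τ, ∃ w, IsODESolution F Ω u₀ (τ' : EReal) w := by
  have hτ : 0 < τ := by exact_mod_cast hu.pos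
  have hF1 : ContDiffAt ℝ 1 F z := (hF.of_le (by exact_mod_cast le_top)).contDiffAt
  obtain ⟨v, hv0, η, hη, hv⟩ :=
    hF1.exists_forall_mem_closedBall_exists_eq_forall_mem_Ioo_hasDerivAt₀ τ
  have hc : ContinuousAt v τ := (hv τ ⟨by linarith, by linarith⟩).continuousAt
  obtain ⟨ρ, hρ, hρΩ⟩ := Metric.mem_nhds_iff.1 (hc.preimage_mem_nhds (hΩ.mem_nhds (hv0 ▸ hz)))
  set w : ℝ → E := fun t => if t < τ then u t else v t with hw
  have hwu : ∀ t, t < τ → w t = u t := fun t ht => if_pos ht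
  have hwv : ∀ t, τ ≤ t → w t = v t := fun t ht => if_neg (not_lt.2 ht)
  refine ⟨τ + min η ρ, by linarith [lt_min hη hρ], w, ?_, ?_, ?_, ?_⟩
  · exact_mod_cast add_pos hτ (lt_min hη hρ)
  · intro t ht
    rw [timeInterval_coe] at ht
    have ht2 : t < τ + η := ht.2.trans_le (by gcongr; exact min_le_left _ _)
    rcases lt_trichotomy t τ with h | h | h
    · have htm : t ∈ timeInterval (τ : EReal) := by rw [timeInterval_coe]; exact ⟨ht.1, h⟩
      have h1 := (hu.hasDeriv t htm).mono_of_mem_nhdsWithin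
        (timeInterval_mem_nhdsWithin (T' := ((τ + min η ρ : ℝ) : EReal)) htm)
      rw [hwu t h]
      refine h1.congr_of_eventuallyEq ?_ (hwu t h)
      filter_upwards [mem_nhdsWithin_of_mem_nhds (Iio_mem_nhds h)] with s hs using hwu s hs
    · subst h
      refine HasDerivAt.hasDerivWithinAt ?_
      have hr : HasDerivWithinAt w (F (w t)) (Ici t) t := by
        rw [hwv t le_rfl]
        exact (hv t ⟨by linarith, by linarith⟩).hasDerivWithinAt.congr
          (fun s hs => hwv s hs) (hwv t le_rfl)
      have hd : ∀ s ∈ Ioo 0 t, HasDerivAt w (F (u s)) s := fun s hs => by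
        have hsm : s ∈ timeInterval (t : EReal) := by
          rw [timeInterval_coe]; exact ⟨hs.1.le, hs.2⟩
        refine (hu.hasDerivAt hsm hs.1).congr_of_eventuallyEq ?_
        filter_upwards [Iio_mem_nhds hs.2] with x hx using hwu x hx
      have hwz : w t = z := (hwv t le_rfl).trans hv0
      -- At the gluing time the left derivative is obtained as the limit of the derivatives `F (u
      -- s)`, by continuity of `F` and of `w`.
      have hl : HasDerivWithinAt w (F (w t)) (Iic t) t := by
        refine hasDerivWithinAt_Iic_of_tendsto_deriv (s := Ioo 0 t)
          (fun s hs => (hd s hs).differentiableAt.differentiableWithinAt) ?_ (Ioo_mem_nhdsLT hτ) ?_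
        · rw [ContinuousWithinAt, hwz]
          refine (hlim.mono_left (nhdsWithin_mono _ Ioo_subset_Iio_self)).congr' ?_
          filter_upwards [self_mem_nhdsWithin] with s hs using (hwu s hs.2).symm
        · rw [hwz]
          refine ((hF.continuous.tendsto z).comp hlim).congr' ?_
          filter_upwards [Ioo_mem_nhdsLT hτ] with s hs using ((hd s hs).deriv).symm
      have := hl.union hr
      rwa [Iic_union_Ici, hasDerivWithinAt_univ] at this
    · refine HasDerivAt.hasDerivWithinAt ?_
      rw [hwv t h.le]
      refine (hv t ⟨by linarith, ht2⟩).congr_of_eventuallyEq ?_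
      filter_upwards [Ioi_mem_nhds h] with s hs using hwv s (le_of_lt hs)
  · intro t ht
    rw [timeInterval_coe] at ht
    rcases lt_or_ge t τ with h | h
    · rw [hwu t h]
      exact hu.mem t (by rw [timeInterval_coe]; exact ⟨ht.1, h⟩)
    · rw [hwv t h]
      refine hρΩ ?_
      rw [Metric.mem_ball, Real.dist_eq, abs_of_nonneg (by linarith)]
      linarith [ht.2, min_le_right η ρ]
  · rw [hwu 0 hτ, hu.initial]

/-- Existence of a maximal solution of an autonomous ordinary differential equation. -/
theorem exists_maximal_isODESolution (hF : ContDiff ℝ ∞ F)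
    (hL : ∀ r, ∃ K, LipschitzOnWith K F (Metric.closedBall 0 r)) (hΩ : IsOpen Ω) (hu₀ : u₀ ∈ Ω) :
    ∃ T u, IsODESolution F Ω u₀ T u ∧
      (∀ T' v, IsODESolution F Ω u₀ T' v → T' ≤ T ∧ EqOn v u (timeInterval T')) ∧
      ∀ τ : ℝ, T = τ → ∀ z ∈ Ω, ¬ Tendsto u (𝓝[<] τ) (𝓝 z) := by
  classical
  set 𝒯 : Set EReal := {T | ∃ u, IsODESolution F Ω u₀ T u} with h𝒯
  -- At each time any solution alive at that time is used; by uniqueness the value does not depend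
  -- on the choice.
  let U : ℝ → E := fun t =>
    if h : ∃ T u, IsODESolution F Ω u₀ T u ∧ t ∈ timeInterval T then h.choose_spec.choose t else u₀
  have hU : ∀ T u, IsODESolution F Ω u₀ T u → EqOn u U (timeInterval T) := by
    intro T u hu t ht
    have h : ∃ T u, IsODESolution F Ω u₀ T u ∧ t ∈ timeInterval T := ⟨T, u, hu, ht⟩
    have e : U t = h.choose_spec.choose t := dif_pos h
    rw [e]
    exact hu.eq_of_mem hL h.choose_spec.choose_spec.1 ht h.choose_spec.choose_spec.2
  have hlt : ∀ t ∈ timeInterval (sSup 𝒯), ∃ T u, IsODESolution F Ω u₀ T u ∧ t ∈ timeInterval T := by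
    intro t ht
    obtain ⟨T, ⟨u, hu⟩, htT⟩ := lt_sSup_iff.1 ht.2
    exact ⟨T, u, hu, ht.1, htT⟩
  obtain ⟨T₀, v₀, hv₀⟩ := exists_isODESolution hF hΩ hu₀
  have hsol : IsODESolution F Ω u₀ (sSup 𝒯) U := by
    refine ⟨hv₀.pos.trans_le (le_sSup ⟨v₀, hv₀⟩), ?_, ?_, ?_⟩
    · intro t ht
      obtain ⟨T, u, hu, htT⟩ := hlt t ht
      have h1 : HasDerivWithinAt U (F (U t)) (timeInterval T) t := by
        rw [← hU T u hu htT]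
        exact (hu.hasDeriv t htT).congr (fun s hs => (hU T u hu hs).symm) (hU T u hu htT).symm
      exact h1.mono_of_mem_nhdsWithin (timeInterval_mem_nhdsWithin htT)
    · intro t ht
      obtain ⟨T, u, hu, htT⟩ := hlt t ht
      rw [← hU T u hu htT]
      exact hu.mem t htT
    · rw [← hU T₀ v₀ hv₀ (zero_mem_timeInterval hv₀.pos), hv₀.initial]
  refine ⟨sSup 𝒯, U, hsol, fun T' v hv => ⟨le_sSup ⟨v, hv⟩, hU T' v hv⟩, ?_⟩
  intro τ hτ z hz hlim
  rw [hτ] at hsol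
  obtain ⟨τ', hττ', w, hw⟩ := hsol.exists_extension hF hΩ hz hlim
  have h1 : (τ' : EReal) ≤ τ := hτ ▸ le_sSup (show (τ' : EReal) ∈ 𝒯 from ⟨w, hw⟩)
  exact not_le.2 hττ' (EReal.coe_le_coe_iff.1 h1)

end ODE

end MaximalSolutions

/-! ### The scalar change of unknown, and tools for fields and integrals in time. -/

section Elevation

section Scalar

variable {ε y : ℝ}

/-- `h(y) = y + ε c(y)`, the inverse of `ζ ↦ ζ + ε ζ² / 2`. -/
def elevation (ε y : ℝ) : ℝ := y + ε * c ε y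

theorem elevation_eq (hy : 0 ≤ 1 + 2 * ε * y) : elevation ε y = 2 * y / (1 + √(1 + 2 * ε * y)) := by
  have hs := Real.sqrt_nonneg (1 + 2 * ε * y)
  have hs2 := Real.sq_sqrt hy
  set s := √(1 + 2 * ε * y) with hsdef
  have h1 : (1 + s) ≠ 0 := by positivity
  rw [elevation, c, ← hsdef]
  field_simp
  linear_combination y * hs2

theorem one_add_elevation (hy : 0 ≤ 1 + 2 * ε * y) :
    1 + ε * elevation ε y = √(1 + 2 * ε * y) := by
  rw [elevation_eq hy]
  have hs := Real.sqrt_nonneg (1 + 2 * ε * y)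
  have hs2 := Real.sq_sqrt hy
  set s := √(1 + 2 * ε * y)
  have h1 : (1 + s) ≠ 0 := by positivity
  field_simp
  linear_combination -hs2

theorem elevation_add_sq (hy : 0 ≤ 1 + 2 * ε * y) :
    elevation ε y + ε / 2 * elevation ε y ^ 2 = y := by
  have h := one_add_elevation hy
  have h2 := elevation_eq hy
  have hs := Real.sqrt_nonneg (1 + 2 * ε * y)
  set s := √(1 + 2 * ε * y)
  have h1 : (1 + s) ≠ 0 := by positivity
  rw [eq_div_iff h1] at h2
  linear_combination (1 / 2) * h2 + (elevation ε y / 2) * h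

theorem continuous_elevation (ε : ℝ) : Continuous (elevation ε) := by
  unfold elevation c
  refine continuous_id.add (continuous_const.mul (Continuous.div (by fun_prop) (by fun_prop) ?_))
  intro y
  have := Real.sqrt_nonneg (1 + 2 * ε * y)
  positivity

theorem elevation_zero (ε : ℝ) : elevation ε 0 = 0 := by simp [elevation, c]

/-- This makes `coeff` the derivative of `elevation`, which is what linearises the mass equation. -/
theorem hasDerivAt_c (hy : 0 < 1 + 2 * ε * y) : DifferentiableAt ℝ (c ε) y ∧
    coeff ε y = 1 / √(1 + 2 * ε * y) := by
  have hs : 0 < √(1 + 2 * ε * y) := Real.sqrt_pos.2 hy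
  have hs2 := Real.sq_sqrt hy.le
  have h1 : HasDerivAt (fun y => 1 + 2 * ε * y) (2 * ε) y := by
    simpa using ((hasDerivAt_id y).const_mul (2 * ε)).const_add 1
  have h2 := (h1.sqrt hy.ne').const_add 1
  have h3 : HasDerivAt (fun y : ℝ => -(2 * y ^ 2)) (-(2 * (2 * y))) y := by
    simpa using (((hasDerivAt_pow 2 y).const_mul 2).fun_neg)
  have h4 := h3.div (h2.pow 2) (pow_ne_zero 2 (by positivity))
  have h5 : HasDerivAt (c ε) _ y := h4
  refine ⟨h5.differentiableAt, ?_⟩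
  rw [coeff, h5.deriv]
  simp only [Pi.pow_apply]
  set s := √(1 + 2 * ε * y) with hsdef
  have hne : s ≠ 0 := hs.ne'
  have hne1 : (1 + s) ≠ 0 := by positivity
  -- The variable `y` enters only through `e = εy = (s² - 1) / 2`, so the claim becomes a rational
  -- identity in `s` alone, with no division by `ε`.
  obtain ⟨e, he⟩ : ∃ e, e = ε * y := ⟨_, rfl⟩
  have he2 : e = (s ^ 2 - 1) / 2 := by rw [hs2, he]; ring
  have h6 : 1 + ε * ((-(2 * (2 * y)) * (1 + s) ^ 2 -
      -(2 * y ^ 2) * ((2 : ℕ) * (1 + s) ^ (2 - 1) * (2 * ε / (2 * s)))) / ((1 + s) ^ 2) ^ 2) =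
      1 + (-4 * e * (1 + s) ^ 2 + 4 * e ^ 2 * (1 + s) / s) / (1 + s) ^ 4 := by
    rw [he]
    push_cast
    field_simp
    ring
  rw [h6, he2]
  field_simp
  ring

theorem coeff_eq (hy : 0 < 1 + 2 * ε * y) : coeff ε y = 1 / √(1 + 2 * ε * y) := (hasDerivAt_c hy).2

theorem hasDerivAt_elevation (hy : 0 < 1 + 2 * ε * y) :
    HasDerivAt (elevation ε) (coeff ε y) y := by
  have h := ((hasDerivAt_c hy).1.hasDerivAt.const_mul ε)
  exact (hasDerivAt_id y).add h

theorem contDiffOn_elevation (ε : ℝ) : ContDiffOn ℝ ∞ (elevation ε) {y | 0 < 1 + 2 * ε * y} := by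
  have h1 : ContDiffOn ℝ ∞ (fun y => √(1 + 2 * ε * y)) {y | 0 < 1 + 2 * ε * y} :=
    ContDiffOn.sqrt (by fun_prop) fun y hy => ne_of_gt hy
  unfold elevation c
  refine contDiffOn_id.add (contDiffOn_const.mul (ContDiffOn.div (by fun_prop)
    ((contDiffOn_const.add h1).pow 2) ?_))
  intro y _
  have := Real.sqrt_nonneg (1 + 2 * ε * y)
  positivity

end Scalar

section LipschitzOnBalls

variable {E G H : Type*} [NormedAddCommGroup E] [NormedAddCommGroup G] [NormedAddCommGroup H]

/-- `f` is Lipschitz on every ball. -/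
def LipschitzOnBalls (f : E → G) : Prop :=
  ∀ r, ∃ K, 0 ≤ K ∧ ∀ x y, ‖x‖ ≤ r → ‖y‖ ≤ r → ‖f x - f y‖ ≤ K * ‖x - y‖

theorem LipschitzOnBalls.exists_lipschitzOnWith {f : E → G} (hf : LipschitzOnBalls f) (r : ℝ) :
    ∃ K, LipschitzOnWith K f (Metric.closedBall 0 r) := by
  obtain ⟨K, hK, h⟩ := hf r
  refine ⟨⟨K, hK⟩, LipschitzOnWith.of_dist_le_mul fun x hx y hy => ?_⟩
  rw [dist_eq_norm, dist_eq_norm]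
  exact h x y (mem_closedBall_zero_iff.1 hx) (mem_closedBall_zero_iff.1 hy)

theorem lipschitzOnBalls_clm [NormedSpace ℝ E] [NormedSpace ℝ G] (L : E →L[ℝ] G) : LipschitzOnBalls L := fun _ =>
  ⟨‖L‖, norm_nonneg _, fun x y _ _ => by rw [← map_sub]; exact L.le_opNorm _⟩

theorem LipschitzOnBalls.add {f g : E → G} (hf : LipschitzOnBalls f) (hg : LipschitzOnBalls g) :
    LipschitzOnBalls fun x => f x + g x := fun r => by
  obtain ⟨K, hK, h⟩ := hf r
  obtain ⟨K', hK', h'⟩ := hg r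
  refine ⟨K + K', by positivity, fun x y hx hy => ?_⟩
  rw [add_sub_add_comm, add_mul]
  exact (norm_add_le _ _).trans (add_le_add (h x y hx hy) (h' x y hx hy))

theorem LipschitzOnBalls.prodMk {f : E → G} {g : E → H} (hf : LipschitzOnBalls f)
    (hg : LipschitzOnBalls g) : LipschitzOnBalls fun x => (f x, g x) := fun r => by
  obtain ⟨K, hK, h⟩ := hf r
  obtain ⟨K', hK', h'⟩ := hg r
  refine ⟨max K K', le_max_of_le_left hK, fun x y hx hy => ?_⟩
  rw [Prod.mk_sub_mk, Prod.norm_mk]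
  exact max_le ((h x y hx hy).trans (by gcongr; exact le_max_left _ _))
    ((h' x y hx hy).trans (by gcongr; exact le_max_right _ _))

theorem LipschitzOnBalls.clm_comp [NormedSpace ℝ G] [NormedSpace ℝ H]
    {f : E → G} (L : G →L[ℝ] H) (hf : LipschitzOnBalls f) :
    LipschitzOnBalls fun x => L (f x) := fun r => by
  obtain ⟨K, hK, h⟩ := hf r
  refine ⟨‖L‖ * K, by positivity, fun x y hx hy => ?_⟩
  rw [← map_sub, mul_assoc]
  exact (L.le_opNorm _).trans (by gcongr; exact h x y hx hy)

theorem LipschitzOnBalls.comp_clm [NormedSpace ℝ E] [NormedSpace ℝ G]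
    {f : G → H} (hf : LipschitzOnBalls f) (L : E →L[ℝ] G) :
    LipschitzOnBalls fun x => f (L x) := fun r => by
  obtain ⟨K, hK, h⟩ := hf (‖L‖ * r)
  refine ⟨K * ‖L‖, by positivity, fun x y hx hy => ?_⟩
  refine (h _ _ ((L.le_opNorm x).trans (by gcongr)) ((L.le_opNorm y).trans (by gcongr))).trans ?_
  rw [← map_sub, mul_assoc]
  gcongr
  exact L.le_opNorm _

theorem lipschitzOnBalls_quadratic [NormedSpace ℝ E] [NormedSpace ℝ G]
    (B : E →L[ℝ] E →L[ℝ] G) : LipschitzOnBalls fun x => B x x := by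
  intro r
  refine ⟨2 * ‖B‖ * |r|, by positivity, fun x y hx hy => ?_⟩
  have e : B x x - B y y = B (x - y) x + B y (x - y) := by
    simp only [map_sub, sub_apply]
    abel
  have h1 : ‖B (x - y) x‖ ≤ ‖B‖ * ‖x - y‖ * |r| := (B.le_opNorm₂ _ _).trans (by
    gcongr; exact hx.trans (le_abs_self r))
  have h2 : ‖B y (x - y)‖ ≤ ‖B‖ * |r| * ‖x - y‖ := (B.le_opNorm₂ _ _).trans (by
    gcongr; exact hy.trans (le_abs_self r))
  rw [e]
  linarith [norm_add_le (B (x - y) x) (B y (x - y))]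

theorem contDiff_quadratic [NormedSpace ℝ E] [NormedSpace ℝ G] (B : E →L[ℝ] E →L[ℝ] G) : ContDiff ℝ ∞ fun x => B x x :=
  B.contDiff.clm_apply contDiff_id

theorem hasDerivWithinAt_quadratic [NormedSpace ℝ E] [NormedSpace ℝ G]
    (B : E →L[ℝ] E →L[ℝ] G) {u : ℝ → E} {u' : E} {s : Set ℝ} {t : ℝ}
    (hu : HasDerivWithinAt u u' s t) :
    HasDerivWithinAt (fun t => B (u t) (u t)) (B u' (u t) + B (u t) u') s t :=
  (B.hasFDerivAt.comp_hasDerivWithinAt t hu).clm_apply hu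

end LipschitzOnBalls

section TimeIntegral

variable {E : Type*} [NormedAddCommGroup E] [NormedSpace ℝ E]

theorem hasDerivWithinAt_integral_timeInterval [CompleteSpace E] {T : EReal} {f : ℝ → E}
    (hf : ContinuousOn f (timeInterval T)) {t : ℝ} (ht : t ∈ timeInterval T) :
    HasDerivWithinAt (fun s => ∫ r in 0..s, f r) (f t) (timeInterval T) t := by
  obtain ⟨a, hta, ha⟩ := exists_gt_mem_timeInterval ht
  have h0a : 0 ≤ a := ht.1.trans hta.le
  have hsub : Icc 0 a ⊆ timeInterval T := fun s hs => mem_timeInterval_of_le ha hs.1 hs.2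
  -- The integrand is extended by constants outside `[0, a]` so that the two-sided fundamental
  -- theorem applies even at `t = 0`.
  set Q : ℝ → E := IccExtend h0a ((Icc 0 a).domRestrict f) with hQ
  have hQc : Continuous Q := (continuousOn_iff_continuous_domRestrict.1 (hf.mono hsub)).Icc_extend'
  have hQf : ∀ s ∈ Icc 0 a, Q s = f s := fun s hs => by
    rw [hQ, IccExtend_of_mem h0a _ hs]
    rfl
  have h1 : HasDerivAt (fun s => ∫ r in 0..s, Q r) (Q t) t :=
    intervalIntegral.integral_hasDerivAt_right (hQc.intervalIntegrable _ _)
      (hQc.stronglyMeasurableAtFilter _ _) hQc.continuousAt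
  rw [hQf t ⟨ht.1, hta.le⟩] at h1
  have h2 : ∀ s ∈ Icc 0 a, ∫ r in 0..s, f r = ∫ r in 0..s, Q r := fun s hs => by
    refine intervalIntegral.integral_congr fun r hr => ?_
    rw [uIcc_of_le hs.1] at hr
    exact (hQf r ⟨hr.1, hr.2.trans hs.2⟩).symm
  refine h1.hasDerivWithinAt.congr_of_eventuallyEq ?_ (h2 t ⟨ht.1, hta.le⟩)
  filter_upwards [mem_nhdsWithin_of_mem_nhds (Iio_mem_nhds hta), self_mem_nhdsWithin] with s h3 h4
  exact h2 s ⟨h4.1, le_of_lt h3⟩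

theorem eq_of_hasDerivWithinAt_timeInterval {T : EReal} {f g f' : ℝ → E}
    (hf : ∀ t ∈ timeInterval T, HasDerivWithinAt f (f' t) (timeInterval T) t)
    (hg : ∀ t ∈ timeInterval T, HasDerivWithinAt g (f' t) (timeInterval T) t)
    (h0 : f 0 = g 0) {t : ℝ} (ht : t ∈ timeInterval T) : f t = g t := by
  have h := (convex_timeInterval T).norm_image_sub_le_of_norm_hasDerivWithin_le
    (f := fun t => f t - g t) (C := 0) (fun s hs => (hf s hs).sub (hg s hs)) (fun s _ => by simp)
    (mem_timeInterval_of_le ht le_rfl ht.1) ht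
  simp only [h0, sub_self, sub_zero, zero_mul, norm_le_zero_iff] at h
  exact sub_eq_zero.1 h

theorem IsODESolution.norm_le_of_norm_le_mul {F : E → E} {Ω : Set E} {u₀ : E} {τ K : ℝ} {u : ℝ → E}
    (h : IsODESolution F Ω u₀ τ u) (hK : 0 ≤ K) (hb : ∀ t ∈ Ico 0 τ, ‖F (u t)‖ ≤ K * ‖u t‖) :
    ∀ t ∈ Ico 0 τ, ‖u t‖ ≤ ‖u₀‖ * Real.exp (K * τ) := by
  intro t ht
  have hs : ∀ s ∈ Icc 0 t, s ∈ timeInterval (τ : EReal) := fun s hs => by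
    rw [timeInterval_coe]; exact ⟨hs.1, hs.2.trans_lt ht.2⟩
  have h1 := norm_le_gronwallBound_of_norm_deriv_right_le (δ := ‖u₀‖) (K := K) (ε := 0)
    (h.continuousOn.mono hs) (fun s h2 => h.hasDerivWithinAt_Ici (hs s ⟨h2.1, h2.2.le⟩))
    (by rw [h.initial]) (fun s h2 => by
      rw [add_zero]; exact hb s ⟨h2.1, h2.2.trans ht.2⟩) t ⟨ht.1, le_rfl⟩
  rw [gronwallBound_ε0, sub_zero] at h1
  refine h1.trans ?_
  gcongr
  exact ht.2.le

end TimeIntegral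

end Elevation

/-! ### The vector field in the variables `(ζ, q)` and the passage to `(θ, q)`. -/

section VectorField

section Generic

variable {E₁ E₂ : Type*} [NormedAddCommGroup E₁] [NormedSpace ℝ E₁] [NormedAddCommGroup E₂]
  [NormedSpace ℝ E₂] (B : E₁ →L[ℝ] E₁ →L[ℝ] E₁) (D L : E₂ →L[ℝ] E₁) (S : E₁ →L[ℝ] E₂) (ε : ℝ)

/-- The map `u ↦ u + ε u² / 2` for a bilinear product. -/
def addHalfSq (u : E₁) : E₁ := u + (ε / 2) • B u u

theorem contDiff_addHalfSq : ContDiff ℝ ∞ (addHalfSq B ε) :=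
  contDiff_id.add ((contDiff_quadratic B).const_smul (ε / 2))

theorem hasDerivWithinAt_addHalfSq (hB : ∀ u v, B u v = B v u) {u : ℝ → E₁} {u' : E₁} {s : Set ℝ}
    {t : ℝ} (h : HasDerivWithinAt u u' s t) :
    HasDerivWithinAt (fun t => addHalfSq B ε (u t)) (u' + ε • B (u t) u') s t := by
  have h1 := h.add ((hasDerivWithinAt_quadratic B h).const_smul (ε / 2))
  rw [hB u', ← two_smul ℝ, smul_smul, div_mul_cancel₀ ε two_ne_zero] at h1
  exact h1

theorem lipschitzOnBalls_addHalfSq : LipschitzOnBalls (addHalfSq B ε) :=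
  (lipschitzOnBalls_clm (ContinuousLinearMap.id ℝ E₁)).add
    ((lipschitzOnBalls_quadratic B).clm_comp ((ε / 2) • ContinuousLinearMap.id ℝ E₁))

/-- The vector field `(u, v) ↦ (-D v, S (ε (L v)² + u + ε u² / 2))`. -/
def quadraticField (z : E₁ × E₂) : E₁ × E₂ :=
  (-D z.2, S (ε • B (L z.2) (L z.2) + addHalfSq B ε z.1))

theorem contDiff_quadraticField : ContDiff ℝ ∞ (quadraticField B D L S ε) := by
  have h1 : ContDiff ℝ ∞ fun z : E₁ × E₂ => B (L z.2) (L z.2) :=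
    (contDiff_quadratic B).comp (L.contDiff.comp contDiff_snd)
  exact (D.contDiff.comp contDiff_snd).neg.prodMk
    (S.contDiff.comp ((h1.const_smul ε).add ((contDiff_addHalfSq B ε).comp contDiff_fst)))

theorem lipschitzOnBalls_quadraticField : LipschitzOnBalls (quadraticField B D L S ε) := by
  have h1 : LipschitzOnBalls fun z : E₁ × E₂ => ε • B (L z.2) (L z.2) :=
    ((lipschitzOnBalls_quadratic B).clm_comp (ε • ContinuousLinearMap.id ℝ E₁)).comp_clm
      (L.comp (ContinuousLinearMap.snd ℝ E₁ E₂))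
  have h2 := h1.add ((lipschitzOnBalls_addHalfSq B ε).comp_clm (ContinuousLinearMap.fst ℝ E₁ E₂))
  exact (lipschitzOnBalls_clm (-(D.comp (ContinuousLinearMap.snd ℝ E₁ E₂)))).prodMk
    (h2.clm_comp S)

theorem hasDerivWithinAt_fst {z : ℝ → E₁ × E₂} {z' : E₁ × E₂} {s : Set ℝ} {t : ℝ}
    (h : HasDerivWithinAt z z' s t) : HasDerivWithinAt (fun t => (z t).1) z'.1 s t :=
  (ContinuousLinearMap.fst ℝ E₁ E₂).hasFDerivAt.comp_hasDerivWithinAt t h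

theorem hasDerivWithinAt_snd {z : ℝ → E₁ × E₂} {z' : E₁ × E₂} {s : Set ℝ} {t : ℝ}
    (h : HasDerivWithinAt z z' s t) : HasDerivWithinAt (fun t => (z t).2) z'.2 s t :=
  (ContinuousLinearMap.snd ℝ E₁ E₂).hasFDerivAt.comp_hasDerivWithinAt t h

theorem hasDerivWithinAt_clm (A : E₁ →L[ℝ] E₂) {z : ℝ → E₁} {z' : E₁} {s : Set ℝ} {t : ℝ}
    (h : HasDerivWithinAt z z' s t) : HasDerivWithinAt (fun t => A (z t)) (A z') s t :=
  A.hasFDerivAt.comp_hasDerivWithinAt t h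

theorem contDiffOn_addHalfSq_prodMk {m : WithTop ℕ∞} (hm : m ≤ (⊤ : ℕ∞)) {z : ℝ → E₁ × E₂}
    {s : Set ℝ} (hz : ContDiffOn ℝ m z s) :
    ContDiffOn ℝ m (fun t => (addHalfSq B ε (z t).1, (z t).2)) s :=
  (((contDiff_addHalfSq B ε).of_le hm).comp_contDiffOn (contDiff_fst.comp_contDiffOn hz)).prodMk
    (contDiff_snd.comp_contDiffOn hz)

end Generic

variable {R ε δ α : ℝ} {n k : ℕ} [hR : Fact (0 < R)]

theorem ae_mem_closedDomain (R : ℝ) : ∀ᵐ x ∂fluidMeasure R, x ∈ closedDomain R :=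
  (ae_restrict_mem (measurableSet_fluidDomain R)).mono fun _ hx =>
    fluidDomain_subset_closedDomain R hx

theorem sobolev_ext_of_rep {u v : Sobolev R (k + 1)} (h : ∀ x ∈ closedDomain R, rep u x = rep v x) :
    u = v := by
  refine sobolev_ext ?_
  filter_upwards [dx_zero_ae_eq_rep u, dx_zero_ae_eq_rep v, ae_mem_closedDomain R] with x h1 h2 h3
  rw [h1, h2, h x h3]

/-- `θ = ζ + ε ζ² / 2`. -/
def toTheta (ε : ℝ) (ζ : Sobolev R (k + 1)) : Sobolev R (k + 1) := addHalfSq mulL ε ζ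

/-- `ε q² + θ` as an element of `H^{n+1}(ℰ)`, with `θ = ζ + ε ζ² / 2`. -/
def momentumFlux (ε : ℝ) (z : HH R n) : Sobolev R (n + 1) :=
  ε • mulL (incl z.2) (incl z.2) + toTheta ε z.1

/-- The vector field of the transmission problem in the variables `(ζ, q)`. -/
def vectorField (ε : ℝ) (hδ : 0 < δ) (hα : 0 ≤ α) (z : HH R n) : HH R n :=
  (-tail z.2, ellipticSolver hδ hα n (momentumFlux ε z))

/-- The pairs `(ζ, q)` such that `1 + ε ζ` is bounded from below by a positive constant. -/
def positiveSet (R ε : ℝ) (n : ℕ) [Fact (0 < R)] : Set (HH R n) :=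
  {z | ∃ m > 0, ∀ x ∈ closedDomain R, m ≤ 1 + ε * rep z.1 x}

theorem rep_toTheta (ζ : Sobolev R (k + 1)) {x : ℝ} (hx : x ∈ closedDomain R) :
    rep (toTheta ε ζ) x = rep ζ x + ε / 2 * rep ζ x ^ 2 := by
  rw [toTheta, addHalfSq, rep_add _ _ hx, rep_smul _ _ hx, rep_mulL _ _ hx, sq]

theorem one_add_rep_toTheta (ζ : Sobolev R (k + 1)) {x : ℝ} (hx : x ∈ closedDomain R) :
    1 + 2 * ε * rep (toTheta ε ζ) x = (1 + ε * rep ζ x) ^ 2 := by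
  rw [rep_toTheta ζ hx]
  ring

theorem hasDerivWithinAt_toTheta {u : ℝ → Sobolev R (k + 1)} {u' : Sobolev R (k + 1)} {s : Set ℝ}
    {t : ℝ} (h : HasDerivWithinAt u u' s t) :
    HasDerivWithinAt (fun t => toTheta ε (u t)) (u' + ε • mulL (u t) u') s t :=
  hasDerivWithinAt_addHalfSq mulL ε mulL_comm h

theorem contDiff_vectorField (hδ : 0 < δ) (hα : 0 ≤ α) :
    ContDiff ℝ ∞ (vectorField ε hδ hα : HH R n → HH R n) :=
  contDiff_quadraticField mulL tail incl (ellipticSolver hδ hα n) ε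

theorem lipschitzOnBalls_vectorField (hδ : 0 < δ) (hα : 0 ≤ α) :
    LipschitzOnBalls (vectorField ε hδ hα : HH R n → HH R n) :=
  lipschitzOnBalls_quadraticField mulL tail incl (ellipticSolver hδ hα n) ε

theorem isOpen_positiveSet : IsOpen (positiveSet R ε n) := by
  rw [Metric.isOpen_iff]
  rintro z ⟨m, hm, h⟩
  -- The sup norm is dominated by the Sobolev norm, so this radius changes `εζ` by at most `m / 2`;
  -- the `+ 1` covers `ε = 0`.
  refine ⟨m / (2 * (|ε| + 1)), by positivity, fun w hw => ⟨m / 2, by positivity, fun x hx => ?_⟩⟩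
  rw [Metric.mem_ball, dist_eq_norm] at hw
  have h1 : ‖w.1 - z.1‖ ≤ ‖w - z‖ := norm_fst_le (w - z)
  have h2 : |evalL ⟨x, hx⟩ (w.1 - z.1)| ≤ ‖w.1 - z.1‖ := abs_rep_le _ hx
  rw [map_sub, evalL_apply, evalL_apply] at h2
  have h3 : |ε * (rep w.1 x - rep z.1 x)| ≤ m / 2 := by
    rw [abs_mul]
    have h4 : |rep w.1 x - rep z.1 x| ≤ m / (2 * (|ε| + 1)) := (h2.trans h1).trans hw.le
    calc |ε| * |rep w.1 x - rep z.1 x| ≤ (|ε| + 1) * (m / (2 * (|ε| + 1))) := by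
          gcongr; linarith
      _ = m / 2 := by field_simp
  have h5 := (abs_le.1 h3).1
  have h6 := h x hx
  nlinarith

/-- The jump `u(R) - u(-R)`. -/
def jumpL : Sobolev R (k + 1) →L[ℝ] ℝ := evalRight - evalLeft

/-- The average of `u(R)` and `u(-R)`. -/
def averageL : Sobolev R (k + 1) →L[ℝ] ℝ := (1 / 2 : ℝ) • (evalRight + evalLeft)

theorem jump_eq_jumpL (u : Sobolev R (k + 1)) : jump R (dx 0 u) = jumpL u := jump_eq u

theorem jumpL_apply (u : Sobolev R (k + 1)) : jumpL u = evalRight u - evalLeft u := rfl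

theorem averageL_apply (u : Sobolev R (k + 1)) : averageL u = 1 / 2 * (evalRight u + evalLeft u) :=
  rfl

theorem average_eq_averageL (u : Sobolev R (k + 1)) : average R (dx 0 u) = averageL u := by
  rw [average_eq, averageL_apply]
  ring

theorem hasWeakDeriv_sq (q : Sobolev R (n + 2)) :
    HasWeakDeriv (fluidDomain R) (fun x => dx 0 q x ^ 2) (dx 1 (mulL (incl q) (incl q))) := by
  refine (hasWeakDeriv_dx (mulL (incl q) (incl q))).congr ?_ EventuallyEq.rfl
  filter_upwards [dx_mulL (incl q) (incl q)] with x hx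
  rw [hx, sq]
  rfl

theorem dx_one_momentumFlux (z : HH R n) : dx 1 (momentumFlux ε z) =ᵐ[fluidMeasure R]
    fun x => ε * dx 1 (mulL (incl z.2) (incl z.2)) x + dx 1 (toTheta ε z.1) x := by
  filter_upwards [dx_add 1 (ε • mulL (incl z.2) (incl z.2)) (toTheta ε z.1),
    dx_smul 1 ε (mulL (incl z.2) (incl z.2))] with x h1 h2
  rw [momentumFlux, h1, h2]

/-- Equal boundary values of `q` give equal boundary values of `q²`, so only `θ` contributes. This
is why the flux condition can be stated for the whole of `εq² + θ`. -/
theorem jump_momentumFlux {z : HH R n} (hz : evalRight z.2 - evalLeft z.2 = 0) :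
    evalRight (momentumFlux ε z) - evalLeft (momentumFlux ε z) =
      evalRight (toTheta ε z.1) - evalLeft (toTheta ε z.1) := by
  have h1 : evalRight (mulL (incl z.2) (incl z.2)) = evalRight z.2 * evalRight z.2 := by
    rw [evalRight_apply, rep_mulL _ _ (right_mem_closedDomain R),
      rep_incl _ (right_mem_closedDomain R)]
    rfl
  have h2 : evalLeft (mulL (incl z.2) (incl z.2)) = evalLeft z.2 * evalLeft z.2 := by
    rw [evalLeft_apply, rep_mulL _ _ (left_mem_closedDomain R),
      rep_incl _ (left_mem_closedDomain R)]
    rfl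
  rw [momentumFlux, map_add, map_add, map_smul, map_smul, h1, h2, sub_eq_zero.1 hz]
  ring

theorem coeff_rep_toTheta {ζ : Sobolev R (k + 1)} {x : ℝ} (hx : x ∈ closedDomain R)
    (h : 0 < 1 + ε * rep ζ x) : coeff ε (rep (toTheta ε ζ) x) = 1 / (1 + ε * rep ζ x) := by
  have h1 := one_add_rep_toTheta (ε := ε) ζ hx
  rw [coeff_eq (by rw [h1]; positivity), h1, Real.sqrt_sq h.le]

/-- The two lower bounds come from `1 + 2εθ = (1 + εζ)²` and `coeff = 1 / (1 + εζ)`, the latter with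
`|ζ| ≤ ‖ζ‖`. -/
theorem admissible_toTheta {ζ : Sobolev R (k + 1)} {m : ℝ} (hm : 0 < m)
    (h : ∀ x ∈ closedDomain R, m ≤ 1 + ε * rep ζ x) : Admissible ε (toTheta ε ζ) := by
  refine ⟨min (m ^ 2) (1 / (1 + |ε| * ‖ζ‖)), by positivity, ?_⟩
  filter_upwards [dx_zero_ae_eq_rep (toTheta ε ζ), ae_mem_closedDomain R] with x h1 hx
  have h2 := h x hx
  have h3 : 0 < 1 + ε * rep ζ x := hm.trans_le h2
  rw [h1, one_add_rep_toTheta ζ hx, coeff_rep_toTheta hx h3]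
  refine ⟨(min_le_left _ _).trans (by gcongr), (min_le_right _ _).trans ?_⟩
  refine one_div_le_one_div_of_le h3 (add_le_add_right ((le_abs_self _).trans ?_) 1)
  rw [abs_mul]
  exact mul_le_mul_of_nonneg_left (abs_rep_le ζ hx) (abs_nonneg ε)

/-- Solutions in the variables `(ζ, q)` give solutions in the variables `(θ, q)`. -/
theorem IsODESolution.isSolution (hδ : 0 < δ) (hα : 0 ≤ α) {z₀ : HH R n} {T : EReal}
    {z : ℝ → HH R n} (hz₀ : evalRight z₀.2 - evalLeft z₀.2 = 0)
    (h : IsODESolution (vectorField ε hδ hα) (positiveSet R ε n) z₀ T z) :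
    IsSolution R ε δ α (toTheta ε z₀.1, z₀.2) T fun t => (toTheta ε (z t).1, (z t).2) := by
  have hud := uniqueDiffOn_timeInterval T
  have hd1 : ∀ t ∈ timeInterval T,
      HasDerivWithinAt (fun s => (z s).1) (-tail (z t).2) (timeInterval T) t := fun t ht =>
    hasDerivWithinAt_fst (h.hasDeriv t ht)
  have hd2 : ∀ t ∈ timeInterval T, HasDerivWithinAt (fun s => (z s).2)
      (ellipticSolver hδ hα n (momentumFlux ε (z t))) (timeInterval T) t := fun t ht =>
    hasDerivWithinAt_snd (h.hasDeriv t ht)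
  have hS : ∀ t, SolvesElliptic δ α (momentumFlux ε (z t))
      (ellipticSolver hδ hα n (momentumFlux ε (z t))) := fun t =>
    solvesElliptic_ellipticSolver hδ hα _
  have hj : ∀ t ∈ timeInterval T, evalRight (z t).2 - evalLeft (z t).2 = 0 := by
    intro t ht
    -- The solver only produces functions without jump, so `⟦q⟧` is constant in time and keeps its
    -- initial value `0`.
    have hJ : ∀ s ∈ timeInterval T, HasDerivWithinAt (fun s => jumpL (z s).2)
        ((fun _ => (0 : ℝ)) s) (timeInterval T) s := fun s hs => by
      have h1 := hasDerivWithinAt_clm jumpL (hd2 s hs)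
      rw [jumpL_apply, (hS s).jump_zero] at h1
      exact h1
    exact eq_of_hasDerivWithinAt_timeInterval hJ
      (fun s hs => hasDerivWithinAt_const s (timeInterval T) (0 : ℝ))
      (by rw [h.initial, jumpL_apply, hz₀]) ht
  refine ⟨h.pos, ?_, ?_, ?_, ?_, ?_, ?_, by rw [h.initial]⟩
  · exact (contDiffOn_addHalfSq_prodMk mulL ε le_rfl
      (h.contDiffOn (contDiff_vectorField hδ hα))).of_le (by exact_mod_cast le_top)
  · intro t ht
    obtain ⟨m, hm, hmz⟩ := h.mem t ht
    exact admissible_toTheta hm hmz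
  · intro t ht
    obtain ⟨m, hm, hmz⟩ := h.mem t ht
    have h1 := (hasDerivWithinAt_toTheta (ε := ε) (hd1 t ht)).derivWithin (hud t ht)
    simp only [h1]
    filter_upwards [dx_zero_ae_eq_rep (toTheta ε (z t).1), dx_zero_ae_eq_rep (z t).1,
      ae_mem_closedDomain R, dx_add 0 (-tail (z t).2) (ε • mulL (z t).1 (-tail (z t).2)),
      dx_smul 0 ε (mulL (z t).1 (-tail (z t).2)), dx_mulL (z t).1 (-tail (z t).2),
      dx_neg 0 (tail (z t).2)] with x e1 e2 hx e3 e4 e5 e6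
    have h2 : 0 < 1 + ε * rep (z t).1 x := hm.trans_le (hmz x hx)
    rw [e3, e4, e5, e6, e1, e2, coeff_rep_toTheta hx h2]
    have e7 : dx 1 (z t).2 x = dx 0 (tail (z t).2) x := rfl
    rw [e7]
    field_simp
    ring
  · intro t ht
    refine ⟨_, hasWeakDeriv_sq (z t).2, ?_⟩
    have h1 := (hd2 t ht).derivWithin (hud t ht)
    simp only [h1]
    set p := ellipticSolver hδ hα n (momentumFlux ε (z t)) with hp
    have h2 := (hS t).eqn
    rw [← hp, Lp.ext_iff] at h2
    filter_upwards [h2, Lp.coeFn_zero ℝ 2 (fluidMeasure R),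
      Lp.coeFn_add (dxL 0 p - δ ^ 2 • dxL 2 p) (dxL 1 (momentumFlux ε (z t))),
      Lp.coeFn_sub (dxL 0 p) (δ ^ 2 • dxL 2 p), Lp.coeFn_smul (δ ^ 2) (dxL 2 p),
      dx_one_momentumFlux (ε := ε) (z t)] with x e1 e2 e3 e4 e5 e6
    rw [e3, e2, Pi.add_apply, e4, Pi.sub_apply, e5, Pi.smul_apply, dxL_coe, dxL_coe, dxL_coe, e6,
      smul_eq_mul, Pi.zero_apply] at e1
    linarith
  · intro t ht
    exact (jump_eq _).trans (hj t ht)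
  · intro t ht
    set p := ellipticSolver hδ hα n (momentumFlux ε (z t)) with hp
    have e1 : (fun s => jump R (dx 1 (z s).2)) = fun s => jumpL (tail (z s).2) :=
      funext fun s => jump_eq_jumpL (tail (z s).2)
    have e2 : (fun s => average R (dx 0 (z s).2)) = fun s => averageL (z s).2 :=
      funext fun s => average_eq_averageL (z s).2
    have d1 := (hasDerivWithinAt_clm jumpL (hasDerivWithinAt_clm tail (hd2 t ht))).derivWithin
      (hud t ht)
    have d2 := (hasDerivWithinAt_clm averageL (hd2 t ht)).derivWithin (hud t ht)
    have d1' : derivWithin (fun s => jump R (dx 1 (z s).2)) (timeInterval T) t =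
        evalRight (tail p) - evalLeft (tail p) := by
      rw [e1]; exact d1
    have d2' : derivWithin (fun s => average R (dx 0 (z s).2)) (timeInterval T) t =
        1 / 2 * (evalRight p + evalLeft p) := by
      rw [e2]; exact d2
    simp only [d1', d2', jump_eq]
    have h1 := (hS t).jump_zero
    have h2 := (hS t).flux
    rw [jump_momentumFlux (hj t ht), ← hp] at h2
    rw [← hp] at h1
    -- The elliptic problem is stated with `p(R)` and the transmission condition with `⟨p⟩`; they
    -- differ by `⟦p⟧ / 2`, which is zero.
    linear_combination -h2 - (α / 2) * h1

end VectorField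

/-! ### Equivalence of the two formulations and bounds for the blow-up criterion. -/

section Solutions

theorem alpha_nonneg {R ε : ℝ} {ζw : ℝ → ℝ} (hζw : ∀ x ∈ Ioo (-R) R, 0 < 1 + ε * ζw x) :
    0 ≤ alpha R ε ζw :=
  setIntegral_nonneg measurableSet_Ioo fun x hx => (one_div_pos.2 (hζw x hx)).le

variable {R ε δ α : ℝ} {n k : ℕ} [hR : Fact (0 < R)]

theorem Admissible.exists_forall_le {θ : Sobolev R (k + 1)} (h : Admissible ε θ) :
    ∃ m > 0, ∀ x ∈ closedDomain R, m ≤ 1 + 2 * ε * rep θ x := by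
  obtain ⟨m, hm, hθ⟩ := h
  refine ⟨m, hm, forall_le_of_ae_le
    (continuous_const.add (continuous_const.mul (continuous_rep θ))) ?_⟩
  filter_upwards [hθ, dx_zero_ae_eq_rep θ] with x h1 h2
  rw [← h2]
  exact h1.1

/-- An admissible `θ` is of the form `ζ + ε ζ² / 2` with `ζ = h(θ)` in the same Sobolev space. -/
theorem exists_elevation {θ : Sobolev R (k + 1)} (h : Admissible ε θ) :
    ∃ ζ : Sobolev R (k + 1), ∀ x ∈ closedDomain R, rep ζ x = elevation ε (rep θ x) := by
  obtain ⟨m, hm, hθ⟩ := h.exists_forall_le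
  let l : ℝ → ℝ := fun y => 1 + 2 * ε * y
  have hl : Continuous l := by fun_prop
  have hO : IsOpen {y : ℝ | 0 < l y} := isOpen_lt continuous_const hl
  -- A compact convex set of values of `θ` on which `h` is smooth; the bound is `min m 1` rather
  -- than `m` so that the set contains `0`.
  have hJc : IsCompact ({y | min m 1 ≤ l y} ∩ Icc (-‖θ‖) ‖θ‖) :=
    isCompact_Icc.inter_left (isClosed_le continuous_const hl)
  have hJv : Convex ℝ ({y | min m 1 ≤ l y} ∩ Icc (-‖θ‖) ‖θ‖) := by
    refine Convex.inter ?_ (convex_Icc _ _)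
    intro x hx y hy a b ha hb hab
    simp only [mem_ofPred_eq, l, smul_eq_mul] at hx hy ⊢
    have e : 1 + 2 * ε * (a * x + b * y) = a * (1 + 2 * ε * x) + b * (1 + 2 * ε * y) := by
      linear_combination (-1 : ℝ) * hab
    rw [e]
    have e2 : min m 1 = a * min m 1 + b * min m 1 := by rw [← add_mul, hab, one_mul]
    rw [e2]
    gcongr
  have hJ0 : (0 : ℝ) ∈ {y | min m 1 ≤ l y} ∩ Icc (-‖θ‖) ‖θ‖ :=
    ⟨by simp [l], by simp, by simp⟩
  have hJO : {y | min m 1 ≤ l y} ∩ Icc (-‖θ‖) ‖θ‖ ⊆ {y : ℝ | 0 < l y} := fun y hy =>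
    lt_of_lt_of_le (lt_min hm one_pos) hy.1
  obtain ⟨ζ, hζ⟩ := exists_comp hJc hJv hJ0 hO hJO k (elevation ε) (contDiffOn_elevation ε)
    (elevation_zero ε) θ (fun x hx => ⟨(min_le_left _ _).trans (hθ x hx),
      abs_le.1 (abs_rep_le θ hx)⟩)
  refine ⟨ζ, fun x hx => rep_eq_of_ae_eq ζ ((continuous_elevation ε).comp (continuous_rep θ)) ?_ hx⟩
  filter_upwards [hζ, dx_zero_ae_eq_rep θ] with x h1 h2
  rw [h1, h2, Function.comp_apply]

theorem eq_toTheta_of_rep_eq_elevation {ζ θ : Sobolev R (k + 1)}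
    (hθ : ∀ x ∈ closedDomain R, 0 ≤ 1 + 2 * ε * rep θ x)
    (h : ∀ x ∈ closedDomain R, rep ζ x = elevation ε (rep θ x)) : θ = toTheta ε ζ :=
  sobolev_ext_of_rep fun x hx => by
    rw [rep_toTheta ζ hx, h x hx, elevation_add_sq (hθ x hx)]

/-- Solutions in the variables `(θ, q)` come from solutions in the variables `(ζ, q)`. -/
theorem IsSolution.exists_isODESolution (hδ : 0 < δ) (hα : 0 ≤ α) {Uin : HH R n} {T : EReal}
    {V : ℝ → HH R n} (h : IsSolution R ε δ α Uin T V) {ζ₀ : Sobolev R (n + 1)}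
    (hζ₀ : ∀ x ∈ closedDomain R, rep ζ₀ x = elevation ε (rep Uin.1 x)) :
    ∃ z, IsODESolution (vectorField ε hδ hα) (positiveSet R ε n) (ζ₀, Uin.2) T z ∧
      ∀ t ∈ timeInterval T, V t = (toTheta ε (z t).1, (z t).2) := by
  have hud := uniqueDiffOn_timeInterval T
  have hV : ∀ t ∈ timeInterval T,
      HasDerivWithinAt V (derivWithin V (timeInterval T) t) (timeInterval T) t := fun t ht =>
    (h.contDiffOn.differentiableOn one_ne_zero t ht).hasDerivWithinAt
  have hd1 : ∀ t ∈ timeInterval T, HasDerivWithinAt (fun s => (V s).1)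
      (derivWithin (fun s => (V s).1) (timeInterval T) t) (timeInterval T) t := fun t ht =>
    (hasDerivWithinAt_fst (hV t ht)).differentiableWithinAt.hasDerivWithinAt
  have hd2 : ∀ t ∈ timeInterval T, HasDerivWithinAt (fun s => (V s).2)
      (derivWithin (fun s => (V s).2) (timeInterval T) t) (timeInterval T) t := fun t ht =>
    (hasDerivWithinAt_snd (hV t ht)).differentiableWithinAt.hasDerivWithinAt
  have hq : ContinuousOn (fun s => tail (V s).2) (timeInterval T) := fun t ht =>
    (hasDerivWithinAt_clm tail (hd2 t ht)).continuousWithinAt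
  -- Defining `ζ` by integrating the mass equation in time avoids proving that `θ ↦ h(θ)` is
  -- differentiable in Sobolev norm. That `ζ = h(θ)` is then checked at each point `x` by comparing
  -- scalar time derivatives.
  set ζ : ℝ → Sobolev R (n + 1) := fun t => ζ₀ - ∫ r in 0..t, tail (V r).2 with hζ
  have hζd : ∀ t ∈ timeInterval T, HasDerivWithinAt ζ (-tail (V t).2) (timeInterval T) t :=
    fun t ht => (hasDerivWithinAt_integral_timeInterval hq ht).const_sub ζ₀
  have hζ0 : ζ 0 = ζ₀ := by simp only [hζ, intervalIntegral.integral_same, sub_zero]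
  have hrep : ∀ t ∈ timeInterval T, ∀ x ∈ closedDomain R,
      rep (ζ t) x = elevation ε (rep (V t).1 x) := by
    intro t ht x hx
    refine eq_of_hasDerivWithinAt_timeInterval (f' := fun t => -rep (tail (V t).2) x)
      (f := fun t => evalL ⟨x, hx⟩ (ζ t)) (g := fun t => elevation ε (evalL ⟨x, hx⟩ (V t).1))
      (fun s hs => ?_) (fun s hs => ?_) ?_ ht
    · have h1 := hasDerivWithinAt_clm (evalL ⟨x, hx⟩) (hζd s hs)
      rw [map_neg] at h1
      exact h1
    · obtain ⟨m, hm, hθ⟩ := (h.admissible s hs).exists_forall_le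
      have hpos : 0 < 1 + 2 * ε * rep (V s).1 x := hm.trans_le (hθ x hx)
      have h1 := (hasDerivAt_elevation hpos).comp_hasDerivWithinAt s
        (hasDerivWithinAt_clm (evalL ⟨x, hx⟩) (hd1 s hs))
      -- The mass equation holds almost everywhere in `x`; solved for `∂ₜθ`, it has a continuous
      -- right-hand side and therefore holds at every point of the closed domain.
      have h2 : rep (derivWithin (fun s => (V s).1) (timeInterval T) s) x =
          -(√(1 + 2 * ε * rep (V s).1 x) * rep (tail (V s).2) x) := by
        refine rep_eq_of_ae_eq _ (f := fun x => -(√(1 + 2 * ε * rep (V s).1 x) *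
          rep (tail (V s).2) x)) (((continuous_const.add (continuous_const.mul
            (continuous_rep _))).sqrt.mul (continuous_rep _)).neg) ?_ hx
        filter_upwards [h.mass s hs, dx_zero_ae_eq_rep (V s).1, dx_zero_ae_eq_rep (tail (V s).2),
          ae_mem_closedDomain R] with y e1 e2 e3 hy
        have hy' : 0 < 1 + 2 * ε * rep (V s).1 y := hm.trans_le (hθ y hy)
        have e4 : dx 1 (V s).2 y = rep (tail (V s).2) y := e3
        have hs' := Real.sqrt_pos.2 hy'
        rw [e2, e4, coeff_eq hy'] at e1
        field_simp at e1
        linarith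
      rw [evalL_apply, h2, coeff_eq hpos] at h1
      have hs' := Real.sqrt_pos.2 hpos
      have e : 1 / √(1 + 2 * ε * rep (V s).1 x) * -(√(1 + 2 * ε * rep (V s).1 x) *
          rep (tail (V s).2) x) = -rep (tail (V s).2) x := by
        field_simp
      rw [e] at h1
      exact h1
    · simp only [evalL_apply, hζ0, h.initial]
      exact hζ₀ x hx
  have hθ : ∀ t ∈ timeInterval T, (V t).1 = toTheta ε (ζ t) := fun t ht => by
    obtain ⟨m, hm, hθ⟩ := (h.admissible t ht).exists_forall_le
    exact eq_toTheta_of_rep_eq_elevation (fun x hx => hm.le.trans (hθ x hx)) (hrep t ht)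
  have hjq : ∀ t ∈ timeInterval T, evalRight (V t).2 - evalLeft (V t).2 = 0 := fun t ht =>
    (jump_eq _).symm.trans (h.jump_q t ht)
  refine ⟨fun t => (ζ t, (V t).2), ⟨h.pos, ?_, ?_, by simp only [hζ0, h.initial]⟩, fun t ht =>
    Prod.ext (hθ t ht) rfl⟩
  · intro t ht
    set p := derivWithin (fun s => (V s).2) (timeInterval T) t with hp
    have hjp : evalRight p - evalLeft p = 0 := by
      have h1 := (hasDerivWithinAt_clm jumpL (hd2 t ht)).derivWithin (hud t ht)
      -- Since `⟦q⟧` vanishes at all times, so does its time derivative `⟦p⟧`.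
      have h2 : derivWithin (fun s => jumpL (V s).2) (timeInterval T) t = 0 :=
        (derivWithin_congr (f := fun _ => (0 : ℝ)) (fun s hs => hjq s hs) (hjq t ht)).trans
          (by simp)
      rw [h2] at h1
      exact h1.symm
    have hsol : SolvesElliptic δ α (momentumFlux ε (ζ t, (V t).2)) p := by
      refine ⟨?_, hjp, ?_⟩
      · obtain ⟨w, hw, hmom⟩ := h.momentum t ht
        have hw' := (hasWeakDeriv_sq (V t).2).unique hw
        refine Lp.ext ?_
        rw [hθ t ht] at hmom
        filter_upwards [hmom, hw', Lp.coeFn_zero ℝ 2 (fluidMeasure R),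
          Lp.coeFn_add (dxL 0 p - δ ^ 2 • dxL 2 p) (dxL 1 (momentumFlux ε (ζ t, (V t).2))),
          Lp.coeFn_sub (dxL 0 p) (δ ^ 2 • dxL 2 p), Lp.coeFn_smul (δ ^ 2) (dxL 2 p),
          dx_one_momentumFlux (ε := ε) (ζ t, (V t).2)] with x e1 e2 e3 e4 e5 e6 e7
        rw [e4, e3, Pi.add_apply, e5, Pi.sub_apply, e6, Pi.smul_apply, dxL_coe, dxL_coe, dxL_coe,
          e7, smul_eq_mul, Pi.zero_apply]
        rw [← e2] at e1
        linarith
      · rw [jump_momentumFlux (z := (ζ t, (V t).2)) (hjq t ht)]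
        have e1 : (fun s => jump R (dx 1 (V s).2)) = fun s => jumpL (tail (V s).2) :=
          funext fun s => jump_eq_jumpL (tail (V s).2)
        have e2 : (fun s => average R (dx 0 (V s).2)) = fun s => averageL (V s).2 :=
          funext fun s => average_eq_averageL (V s).2
        have d1 := (hasDerivWithinAt_clm jumpL (hasDerivWithinAt_clm tail (hd2 t ht))).derivWithin
          (hud t ht)
        have d2 := (hasDerivWithinAt_clm averageL (hd2 t ht)).derivWithin (hud t ht)
        have h1 := h.jump_dq t ht
        rw [e1, e2, d1, d2, jump_eq, hθ t ht, jumpL_apply, averageL_apply, ← hp] at h1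
        linear_combination -h1 - (α / 2) * hjp
    have h3 : vectorField ε hδ hα (ζ t, (V t).2) = (-tail (V t).2, p) :=
      Prod.ext rfl (hsol.eq_ellipticSolver hδ hα).symm
    rw [h3]
    exact (hζd t ht).prodMk (hd2 t ht)
  · intro t ht
    obtain ⟨m, hm, hθm⟩ := (h.admissible t ht).exists_forall_le
    refine ⟨√m, Real.sqrt_pos.2 hm, fun x hx => ?_⟩
    simp only [hrep t ht x hx, one_add_elevation (hm.le.trans (hθm x hx))]
    exact Real.sqrt_le_sqrt (hθm x hx)

/-- All terms of the field are linear except the two squares; where these are bounded linearly, the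
whole field is, and Grönwall's inequality applies. -/
theorem norm_quadraticField_le {E₁ E₂ : Type*} [NormedAddCommGroup E₁] [NormedSpace ℝ E₁]
    [NormedAddCommGroup E₂] [NormedSpace ℝ E₂] (B : E₁ →L[ℝ] E₁ →L[ℝ] E₁) (D L : E₂ →L[ℝ] E₁)
    (S : E₁ →L[ℝ] E₂) (ε : ℝ) {A : ℝ} (hA : 0 ≤ A) :
    ∃ K, 0 ≤ K ∧ ∀ z : E₁ × E₂, ‖B z.1 z.1‖ ≤ A * ‖z.1‖ → ‖B (L z.2) (L z.2)‖ ≤ A * ‖z.2‖ →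
      ‖quadraticField B D L S ε z‖ ≤ K * ‖z‖ := by
  refine ⟨‖D‖ + ‖S‖ * (|ε| * A + 1 + |ε / 2| * A), by positivity, fun z h1 h2 => ?_⟩
  have n1 : ‖z.1‖ ≤ ‖z‖ := norm_fst_le z
  have n2 : ‖z.2‖ ≤ ‖z‖ := norm_snd_le z
  have e1 : ‖-D z.2‖ ≤ ‖D‖ * ‖z‖ := by
    rw [norm_neg]
    exact (D.le_opNorm _).trans (by gcongr)
  have e2 : ‖ε • B (L z.2) (L z.2) + addHalfSq B ε z.1‖ ≤
      (|ε| * A + 1 + |ε / 2| * A) * ‖z‖ := by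
    have h3 : ‖ε • B (L z.2) (L z.2)‖ ≤ |ε| * (A * ‖z‖) := by
      rw [norm_smul, Real.norm_eq_abs]
      gcongr
      exact h2.trans (by gcongr)
    have h4 : ‖(ε / 2) • B z.1 z.1‖ ≤ |ε / 2| * (A * ‖z‖) := by
      rw [norm_smul, Real.norm_eq_abs]
      gcongr
      exact h1.trans (by gcongr)
    refine (norm_add_le _ _).trans ?_
    have h5 : ‖addHalfSq B ε z.1‖ ≤ ‖z.1‖ + ‖(ε / 2) • B z.1 z.1‖ := norm_add_le _ _
    linarith
  have e3 : ‖S (ε • B (L z.2) (L z.2) + addHalfSq B ε z.1)‖ ≤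
      ‖S‖ * ((|ε| * A + 1 + |ε / 2| * A) * ‖z‖) := (S.le_opNorm _).trans (by gcongr)
  rw [quadraticField, Prod.norm_mk, add_mul]
  refine max_le (e1.trans (le_add_of_nonneg_right (by positivity))) ?_
  rw [mul_assoc]
  exact e3.trans (le_add_of_nonneg_left (by positivity))

/-- Derivative, product and elliptic solver all commute with the inclusions. Hence a solution of
higher regularity is also one of lower regularity, which drives the induction on `n`. -/
theorem vectorField_incl (hδ : 0 < δ) (hα : 0 ≤ α) (z : HH R (n + 1)) :
    vectorField ε hδ hα (n := n) (incl z.1, incl z.2) =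
      (incl (vectorField ε hδ hα z).1, incl (vectorField ε hδ hα z).2) := by
  have h1 : incl (momentumFlux ε z) = momentumFlux (n := n) ε (incl z.1, incl z.2) := by
    simp only [momentumFlux, toTheta, addHalfSq, map_add, map_smul, incl_mulL]
  refine Prod.ext ?_ ?_
  · change -tail (incl z.2) = incl (-tail z.2)
    rw [map_neg, incl_tail]
  · change _ = incl (ellipticSolver hδ hα (n + 1) (momentumFlux ε z))
    rw [incl_ellipticSolver, h1]
    rfl

theorem IsODESolution.norm_le_of_quadratic_le (hδ : 0 < δ) (hα : 0 ≤ α) {τ A : ℝ} (hA : 0 ≤ A)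
    {z₀ : HH R n} {z : ℝ → HH R n}
    (h : IsODESolution (vectorField ε hδ hα) univ z₀ τ z)
    (h1 : ∀ t ∈ Ico 0 τ, ‖mulL (z t).1 (z t).1‖ ≤ A * ‖(z t).1‖)
    (h2 : ∀ t ∈ Ico 0 τ, ‖mulL (incl (z t).2) (incl (z t).2)‖ ≤ A * ‖(z t).2‖) :
    ∃ r, ∀ t ∈ Ico 0 τ, ‖z t‖ ≤ r := by
  obtain ⟨K, hK, hb⟩ := norm_quadraticField_le
    (mulL : Sobolev R (n + 1) →L[ℝ] Sobolev R (n + 1) →L[ℝ] Sobolev R (n + 1)) tail incl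
    (ellipticSolver hδ hα n) ε hA
  exact ⟨_, h.norm_le_of_norm_le_mul hK fun t ht => hb (z t) (h1 t ht) (h2 t ht)⟩

/-- Uniform bounds on `ζ` and `q` prevent blow-up of the Sobolev norms in finite time. -/
theorem IsODESolution.exists_norm_le (hδ : 0 < δ) (hα : 0 ≤ α) {τ M : ℝ} (hM : 0 ≤ M) (n : ℕ) :
    ∀ {z₀ : HH R n} {z : ℝ → HH R n}, IsODESolution (vectorField ε hδ hα) univ z₀ τ z →
      (∀ t ∈ Ico 0 τ, ∀ᵐ x ∂fluidMeasure R, |dx 0 (z t).1 x| ≤ M ∧ |dx 0 (z t).2 x| ≤ M) →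
      ∃ r, ∀ t ∈ Ico 0 τ, ‖z t‖ ≤ r := by
  induction n with
  | zero =>
    intro z₀ z h hb
    -- At the lowest order the sup bounds alone make the squares linear in the norm.
    refine h.norm_le_of_quadratic_le hδ hα (A := 3 * M) (by positivity) (fun t ht => ?_)
      (fun t ht => ?_)
    · exact norm_mulL_self_le_of_bound ((hb t ht).mono fun x hx => hx.1) hM
    · refine (norm_mulL_self_le_of_bound (u := incl (z t).2)
        ((hb t ht).mono fun x hx => hx.2) hM).trans ?_
      exact mul_le_mul_of_nonneg_left (norm_incl_le _) (by positivity)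
  | succ n ih =>
    intro z₀ z h hb
    have h' : IsODESolution (vectorField ε hδ hα) univ (incl z₀.1, incl z₀.2) τ
        (fun t => ((incl (z t).1, incl (z t).2) : HH R n)) := by
      refine ⟨h.pos, fun t ht => ?_, fun _ _ => mem_univ _, by rw [h.initial]⟩
      have h1 := hasDerivWithinAt_clm incl (hasDerivWithinAt_fst (h.hasDeriv t ht))
      have h2 := hasDerivWithinAt_clm incl (hasDerivWithinAt_snd (h.hasDeriv t ht))
      rw [vectorField_incl]
      exact h1.prodMk h2
    obtain ⟨r, hr⟩ := ih h' hb
    obtain ⟨C, hC, hmul⟩ := norm_mulL_self_le_incl (R := R) (k := n)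
    -- The norm one order lower, bounded by `r` through the induction hypothesis, now plays the role
    -- of the sup norm.
    refine h.norm_le_of_quadratic_le hδ hα (A := C * max r 0) (by positivity) (fun t ht => ?_)
      (fun t ht => ?_)
    · refine (hmul _).trans ?_
      have h3 : ‖incl (z t).1‖ ≤ max r 0 :=
        (norm_fst_le (((incl (z t).1, incl (z t).2) : HH R n))).trans
          ((hr t ht).trans (le_max_left _ _))
      gcongr
    · refine (hmul _).trans ?_
      have h3 : ‖incl (z t).2‖ ≤ max r 0 :=
        (norm_snd_le (((incl (z t).1, incl (z t).2) : HH R n))).trans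
          ((hr t ht).trans (le_max_left _ _))
      have h4 := (norm_incl_le (incl (z t).2)).trans h3
      have h5 := norm_incl_le (z t).2
      gcongr

theorem ae_abs_le_of_eLpNorm_top_le {μ : Measure ℝ} {f : ℝ → ℝ} {M : NNReal}
    (h : eLpNorm f ∞ μ ≤ M) : ∀ᵐ x ∂μ, |f x| ≤ M := by
  rw [eLpNorm_exponent_top] at h
  filter_upwards [ae_le_eLpNormEssSup (f := f) (μ := μ)] with x hx
  have h1 := hx.trans h
  rw [← Real.norm_eq_abs, ← coe_nnnorm]
  rw [enorm_le_coe] at h1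
  exact_mod_cast h1

/-- Bounds on `ζ`, `q` and `1 + ε ζ` in terms of the quantity in the blow-up criterion. -/
theorem bounds_of_supNorm_le {ζ : Sobolev R (n + 1)} {q : Sobolev R (n + 2)} {M : NNReal}
    (hpos : ∀ x ∈ closedDomain R, 0 < 1 + ε * rep ζ x)
    (h : supNorm ε ((toTheta ε ζ, q) : HH R n) ≤ M) :
    (∀ᵐ x ∂fluidMeasure R, |dx 0 ζ x| ≤ 2 * M ∧ |dx 0 q x| ≤ 2 * M) ∧
      ∀ x ∈ closedDomain R, 1 / ((M : ℝ) + 1) ≤ 1 + ε * rep ζ x := by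
  simp only [supNorm, sup_le_iff] at h
  obtain ⟨⟨⟨⟨h1, h2⟩, _⟩, _⟩, h5⟩ := h
  have hM : (0 : ℝ) ≤ M := M.2
  refine ⟨?_, forall_le_of_ae_le
    (continuous_const.add (continuous_const.mul (continuous_rep ζ))) ?_⟩
  · filter_upwards [ae_abs_le_of_eLpNorm_top_le h1, ae_abs_le_of_eLpNorm_top_le h2,
      dx_zero_ae_eq_rep ζ, dx_zero_ae_eq_rep (toTheta ε ζ), ae_mem_closedDomain R]
      with x e1 e2 e3 e4 hx
    refine ⟨?_, by linarith⟩
    have hp := hpos x hx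
    rw [e4, rep_toTheta ζ hx] at e1
    rw [e3]
    -- Since `1 + εζ > 0`, the second factor exceeds `1 / 2`; hence `|ζ| ≤ 2|θ|`, which is the
    -- origin of the bound `2 * M`.
    have e5 : rep ζ x + ε / 2 * rep ζ x ^ 2 = rep ζ x * ((2 + ε * rep ζ x) / 2) := by ring
    rw [e5, abs_mul, abs_of_pos (by linarith : 0 < (2 + ε * rep ζ x) / 2)] at e1
    nlinarith [abs_nonneg (rep ζ x)]
  · filter_upwards [ae_abs_le_of_eLpNorm_top_le h5, dx_zero_ae_eq_rep (toTheta ε ζ),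
      ae_mem_closedDomain R] with x e1 e2 hx
    have hp := hpos x hx
    -- An upper bound for `coeff = 1 / (1 + εζ)` is a lower bound for `1 + εζ`; the denominator `M +
    -- 1` avoids a division by zero.
    rw [e2, coeff_rep_toTheta hx hp, abs_of_pos (by positivity), div_le_iff₀ hp] at e1
    rw [div_le_iff₀ (by positivity)]
    nlinarith

/-- Failure of divergence gives a bound `M` valid for times `T` arbitrarily close to `τ`. Each `t <
τ` lies below such a `T`, and `f t` is one of the terms of the supremum. -/
theorem exists_forall_le_of_not_tendsto {f : ℝ → ℝ≥0∞} {τ : ℝ}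
    (h : ¬ Tendsto (fun T : ℝ => ⨆ t ∈ Icc 0 T, f t) (𝓝[<] τ) (𝓝 ⊤)) :
    ∃ M : NNReal, ∀ t ∈ Ico 0 τ, f t ≤ M := by
  rw [ENNReal.tendsto_nhds_top_iff_nnreal] at h
  push Not at h
  obtain ⟨M, hM⟩ := h
  refine ⟨M, fun t ht => ?_⟩
  obtain ⟨T, hT, htT⟩ := (hM.and_eventually (Ioo_mem_nhdsLT ht.2)).exists
  exact (le_iSup₂_of_le t ⟨ht.1, htT.1.le⟩ le_rfl).trans hT

end Solutions

end

end WaveObstacle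

/-! ### The main theorem. -/

open WaveObstacle in
theorem proposition3p2 (n : ℕ) (R ε δ : ℝ) (hR : 0 < R) (hε : ε ∈ Set.Icc (0 : ℝ) 1) (hδ : 0 < δ)
    (ζw : ℝ → ℝ) (hζw : ∀ x ∈ Set.Ioo (-R) R, 0 < 1 + ε * ζw x)
    (hα : IntegrableOn (fun x => 1 / (1 + ε * ζw x)) (Set.Ioo (-R) R))
    (Uin : WaveObstacle.HH R n) (hjump : WaveObstacle.jump R (WaveObstacle.dx 0 Uin.2) = 0)
    (hadm : WaveObstacle.Admissible ε Uin.1) :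
    ∃ (Tstar : EReal) (U : ℝ → WaveObstacle.HH R n),
      WaveObstacle.IsSolution R ε δ (WaveObstacle.alpha R ε ζw) Uin Tstar U ∧
      ContDiffOn ℝ ∞ U (WaveObstacle.timeInterval Tstar) ∧
      (∀ (T : EReal) (V : ℝ → WaveObstacle.HH R n),
        WaveObstacle.IsSolution R ε δ (WaveObstacle.alpha R ε ζw) Uin T V →
          T ≤ Tstar ∧ Set.EqOn V U (WaveObstacle.timeInterval T)) ∧
      (∀ τ : ℝ, Tstar = (τ : EReal) →
        Tendsto (fun T : ℝ => ⨆ t ∈ Set.Icc 0 T, WaveObstacle.supNorm ε (U t))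
          (𝓝[<] τ) (𝓝 ⊤)) := by
  have : Fact (0 < R) := ⟨hR⟩
  have hα0 : 0 ≤ alpha R ε ζw := alpha_nonneg hζw
  obtain ⟨ζ₀, hζ₀⟩ := exists_elevation hadm
  obtain ⟨m, hm, hθm⟩ := hadm.exists_forall_le
  have hθ₀ : Uin.1 = toTheta ε ζ₀ :=
    eq_toTheta_of_rep_eq_elevation (fun x hx => hm.le.trans (hθm x hx)) hζ₀
  have hz₀ : ((ζ₀, Uin.2) : HH R n) ∈ positiveSet R ε n := by
    refine ⟨√m, Real.sqrt_pos.2 hm, fun x hx => ?_⟩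
    simp only [hζ₀ x hx, one_add_elevation (hm.le.trans (hθm x hx))]
    exact Real.sqrt_le_sqrt (hθm x hx)
  have hj₀ : evalRight Uin.2 - evalLeft Uin.2 = 0 := (jump_eq _).symm.trans hjump
  have hL : ∀ r, ∃ K, LipschitzOnWith K (vectorField ε hδ hα0 : HH R n → HH R n)
      (Metric.closedBall 0 r) := (lipschitzOnBalls_vectorField hδ hα0).exists_lipschitzOnWith
  obtain ⟨Tstar, z, hz, hmax, hblow⟩ := exists_maximal_isODESolution
    (contDiff_vectorField hδ hα0) hL isOpen_positiveSet hz₀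
  have hU : IsSolution R ε δ (alpha R ε ζw) Uin Tstar fun t => (toTheta ε (z t).1, (z t).2) := by
    have h1 := IsODESolution.isSolution (z₀ := ((ζ₀, Uin.2) : HH R n)) hδ hα0 hj₀ hz
    have h2 : ((toTheta ε ζ₀, Uin.2) : HH R n) = Uin := Prod.ext hθ₀.symm rfl
    rw [h2] at h1
    exact h1
  refine ⟨Tstar, _, hU, contDiffOn_addHalfSq_prodMk mulL ε le_rfl
    (hz.contDiffOn (contDiff_vectorField hδ hα0)), ?_, ?_⟩
  · intro T V hV
    obtain ⟨v, hv, hVv⟩ := hV.exists_isODESolution hδ hα0 hζ₀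
    obtain ⟨hT, hvz⟩ := hmax T v hv
    exact ⟨hT, fun t ht => by rw [hVv t ht, hvz ht]⟩
  · intro τ hτ
    subst hτ
    by_contra hnot
    obtain ⟨M, hM⟩ := exists_forall_le_of_not_tendsto hnot
    have hb : ∀ t ∈ Ico 0 τ, (∀ᵐ x ∂fluidMeasure R,
        |dx 0 (z t).1 x| ≤ 2 * M ∧ |dx 0 (z t).2 x| ≤ 2 * M) ∧
        ∀ x ∈ closedDomain R, 1 / ((M : ℝ) + 1) ≤ 1 + ε * rep (z t).1 x := by
      intro t ht
      obtain ⟨m', hm', hz'⟩ := hz.mem t (by rw [timeInterval_coe]; exact ht)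
      exact bounds_of_supNorm_le (fun x hx => hm'.trans_le (hz' x hx)) (hM t ht)
    obtain ⟨r, hr⟩ := IsODESolution.exists_norm_le (ε := ε) hδ hα0
      (show (0 : ℝ) ≤ 2 * M by positivity) n
      ⟨hz.pos, hz.hasDeriv, fun _ _ => mem_univ _, hz.initial⟩ fun t ht => (hb t ht).1
    obtain ⟨y, hy⟩ := hz.exists_tendsto hL hr
    -- It remains to see that the limit `y` lies in the positive set: the bound `1 / (M + 1)` is
    -- uniform in time and passes to the limit at each point `x`, evaluation being continuous.
    refine hblow τ rfl y ⟨1 / ((M : ℝ) + 1), by positivity, fun x hx => ?_⟩ hy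
    have h1 : Tendsto (fun t => 1 + ε * evalL ⟨x, hx⟩ (z t).1) (𝓝[<] τ)
        (𝓝 (1 + ε * evalL ⟨x, hx⟩ y.1)) :=
      (((evalL ⟨x, hx⟩).continuous.tendsto y.1).comp hy.fst_nhds).const_mul ε |>.const_add 1
    refine ge_of_tendsto h1 ?_
    have hτ : 0 < τ := by exact_mod_cast hz.pos
    filter_upwards [Ico_mem_nhdsLT hτ] with t ht using (hb t ht).2 x hx
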